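/- Let $(\mathcal C,\mathbb E,\mathfrak s)$ be a small extriangulated category (in the sense of Nakaoka--Palu) with enough $\mathbb E$-projectives, let $\mathcal P_{\mathbb E}(\mathcal C)$ be the class of $\mathbb E$-projective objects, and let $\{\mathbb E^i\}_{i\ge1}$ be higher $\mathbb E$-extension groups of $\mathcal C$, that is, additive bifunctors $\mathcal C^{op}\times\mathcal C\to\mathrm{Ab}$ with $\mathbb E^1=\mathbb E$, with natural connecting morphisms $\mathbb E^i(A,-)\to\mathbb E^{i+1}(C,-)$ and $\mathbb E^i(-,C)\to\mathbb E^{i+1}(-,A)$ for each $\mathbb E$-triangle $A\to B\to C\dashrightarrow$, compatible with morphisms of $\mathbb E$-triangles and making the sequences $\mathbb E^i(C,-)\to\mathbb E^i(B,-)\to\mathbb E^i(A,-)\to\mathbb E^{i+1}(C,-)$ and $\mathbb E^i(-,A)\to\mathbb E^i(-,B)\to\mathbb E^i(-,C)\to\mathbb E^{i+1}(-,A)$ exact, and such that, for all $i\geq 1$, $\mathbb E^i(f,-)=0$ if $\mathbb E(f,-)=0$, and $\mathbb E^i(-,g)=0$ if $\mathbb E(-,g)=0$. Let $n\ge 0$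 and let $\mathcal X\subseteq\mathcal C$ be a full subcategory, equal to the class $\mathrm{add}(\mathcal X)$ of direct summands of finite coproducts of its objects, which contains $\mathcal P_{\mathbb E}(\mathcal C)$ and is $(n+2)$-rigid: $\mathbb E^i(\mathcal X,\mathcal X)=0$ for $1\le i\le n+1$. Let $\mathcal X_k^\vee$ be the class of objects of $\mathcal X$-coresolution dimension at most $k$; let $\underline{\mathcal X_n^\vee}$ be the quotient of $\mathcal X_n^\vee$ by the ideal of morphisms $f$ with $\mathbb E(f,-)=0$, and $\mathsf{Mod}\,\underline{\mathcal X_n^\vee}$ the category of additive functors $(\underline{\mathcal X_n^\vee})^{op}\to\mathrm{Ab}$. Let $\mathcal M=\mathcal X_{n+1}^\vee/[\mathcal X]$, where $[\mathcal X]$ is the ideal of morphisms which factor through objects of $\mathcal X$, and write $[h]$ for the class of a morphism $h$. Let $\mathbb F:\mathcal M\to\mathsf{Mod}\,\underline{\mathcal X_n^\vee}$ be the functor $M\mapsto\mathbb E(-,M)|_{\mathcal X_n^\vee}$. Let $\mathcal R^n_{\mathcal X}\subseteq\mathsf{Mod}\,\underline{\mathcal X_n^\vee}$ be the full subcategory of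 those $G$ that admit an exact sequence $\underline{\mathcal X_n^\vee}(-,X_0)\to\underline{\mathcal X_n^\vee}(-,X_1)\to G\to0$ with $X_0\in\mathcal X$ and $X_1\in\mathcal X_n^\vee$; its conflations are the short exact sequences of modules with terms in $\mathcal R^n_{\mathcal X}$. Let $\varepsilon_{\mathbb F}$ be the class of pairs $(i,p)$ of composable morphisms of $\mathcal M$ for which $0\to\mathbb F(A')\xrightarrow{\mathbb F(i)}\mathbb F(A)\xrightarrow{\mathbb F(p)}\mathbb F(A'')\to0$ is exact. Then $(\mathcal M,\varepsilon_{\mathbb F})$ is a weakly idempotent complete exact category, $\mathcal R^n_{\mathcal X}$ is an exact category, $\mathbb F$ takes values in $\mathcal R^n_{\mathcal X}$, and $\mathbb F:\mathcal M\to\mathcal R^n_{\mathcal X}$ is an equivalence of exact categories. The category $\varepsilon(\mathcal M)$ of conflations of $(\mathcal M,\varepsilon_{\mathbb F})$, with the degreewise conflations $\varepsilon$, is an exact category. Let $\mathcal S(\mathcal M)\subseteq\varepsilon(\mathcal M)$ be the class of split conflations. Then: (a) $\mathcal S(\mathcal M)$ is a pseudo-cluster tilting subcategory of $(\varepsilon(\mathcal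 M),\varepsilon)$; that is, $\mathcal S(\mathcal M)=\mathrm{add}(\mathcal S(\mathcal M))$, and for every $\eta\in\varepsilon(\mathcal M)$ there are conflations $\eta\xrightarrow{\alpha}D_0\to D_1$ and $D_1'\to D_0'\xrightarrow{\beta}\eta$ in $(\varepsilon(\mathcal M),\varepsilon)$ with $D_0,D_1,D_0',D_1'\in\mathcal S(\mathcal M)$, where $\alpha$ is an $\mathcal S(\mathcal M)$-preenvelope and $\beta$ is an $\mathcal S(\mathcal M)$-precover. In particular $\varepsilon(\mathcal M)=\mathcal S(\mathcal M)^\wedge_1=\mathcal S(\mathcal M)^\vee_1$, that is, each object of $\varepsilon(\mathcal M)$ has $\mathcal S(\mathcal M)$-resolution dimension and $\mathcal S(\mathcal M)$-coresolution dimension at most $1$. (b) The quotient $\varepsilon(\mathcal M)/[\mathcal S(\mathcal M)]$ by the ideal of morphisms which factor through split conflations is an abelian category. (c) Let $\eta: K\xrightarrow{[a]}M\xrightarrow{[b]}N$ be a conflation in $\mathcal M$, where $a,b$ are morphisms of $\mathcal X_{n+1}^\vee$. Then $\eta\in\mathcal S(\mathcal M)$ if and only if there exist a split $\mathbb E$-triangle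 $K'\xrightarrow{a'}M\oplus X\oplus P\xrightarrow{(b\ g\ p)}N\dashrightarrow$ in $\mathcal C$ with $K'\in\mathcal X_{n+1}^\vee$, $X\in\mathcal X$ and $P\in\mathcal P_{\mathbb E}(\mathcal C)$, such that, writing $\mathbb F[a']:\mathbb F(K')\to\mathbb F(M\oplus X\oplus P)=\mathbb F(M)$, the sequence $\mathbb F(K')\xrightarrow{\mathbb F[a']}\mathbb F(M)\xrightarrow{\mathbb F[b]}\mathbb F(N)$ is a conflation in $\mathcal R^n_{\mathcal X}$, and an isomorphism $\theta:\mathbb F(K')\to\mathbb F(K)$ in $\mathcal R^n_{\mathcal X}$ with $\mathbb F[a]\circ\theta=\mathbb F[a']$. -/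

import Mathlib

open CategoryTheory CategoryTheory.Limits Opposite

universe v u v' u'

namespace Extri

/-! ### Classes of objects, sums and summands, ideals of morphisms -/

section General

variable {A : Type u'} [Category.{v'} A]

/-- `free D`: the finite (possibly empty) coproducts of objects of `D`. In a preadditive category
finite coproducts are biproducts. -/
def free [HasZeroMorphisms A] (D : ObjectProperty A) : ObjectProperty A := fun M =>
  ∃ (k : ℕ) (f : Fin k → A) (b : Bicone f),
    (∀ i, D (f i)) ∧ Nonempty b.IsBilimit ∧ Nonempty (b.pt ≅ M)

/-- `smd D`: the direct summands of objects of `D`. -/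
def smd [HasZeroMorphisms A] (D : ObjectProperty A) : ObjectProperty A := fun M =>
  ∃ (M' : A) (b : BinaryBicone M M'), Nonempty b.IsBilimit ∧ D b.pt

/-- `add D = smd (free D)`. -/
def add [HasZeroMorphisms A] (D : ObjectProperty A) : ObjectProperty A := smd (free D)

/-- The condition `D = add D`. -/
class IsAddClosed [HasZeroMorphisms A] (D : ObjectProperty A) : Prop where
  eq_add : D = add D

/-- `f` and `g` are identified modulo the ideal `[D]`: the difference `f - g` factors through an
object of `D`. -/
def factorRel [Preadditive A] (D : ObjectProperty A) : HomRel A := fun M N f g =>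
  ∃ (W : A) (p : M ⟶ W) (q : W ⟶ N), D W ∧ p ≫ q = f - g

/-- The quotient category `A/[D]`. -/
abbrev ModIdeal [Preadditive A] (D : ObjectProperty A) := CategoryTheory.Quotient (factorRel D)

/-- `D` is nonempty and any two of its objects have a biproduct diagram with vertex in `D`.
(Auxiliary: this makes the morphisms which factor through `D` an ideal.) -/
class HasSums [HasZeroMorphisms A] (D : ObjectProperty A) : Prop where
  nonempty : ∃ W, D W
  sum : ∀ M N, D M → D N → ∃ b : BinaryBicone M N, D b.pt

lemma factorRel_add [Preadditive A] (D : ObjectProperty A) [HasSums D] {M N : A}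
    (f₁ f₂ g₁ g₂ : M ⟶ N) (h : factorRel D f₁ f₂) (h' : factorRel D g₁ g₂) :
    factorRel D (f₁ + g₁) (f₂ + g₂) := by
  obtain ⟨W, p, q, hW, e⟩ := h
  obtain ⟨W', p', q', hW', e'⟩ := h'
  obtain ⟨b, hb⟩ := HasSums.sum W W' hW hW'
  refine ⟨b.pt, p ≫ b.inl + p' ≫ b.inr, b.fst ≫ q + b.snd ≫ q', hb, ?_⟩
  simp only [Preadditive.add_comp, Preadditive.comp_add, Category.assoc,
    BinaryBicone.inl_fst_assoc, BinaryBicone.inr_fst_assoc, BinaryBicone.inl_snd_assoc,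
    BinaryBicone.inr_snd_assoc, zero_comp, comp_zero, add_zero, zero_add, e, e']
  abel

instance [Preadditive A] (D : ObjectProperty A) [HasSums D] : Congruence (factorRel D) where
  comp_left f := by
    rintro g g' ⟨W, p, q, hW, e⟩
    exact ⟨W, f ≫ p, q, hW, by rw [Category.assoc, e, Preadditive.comp_sub]⟩
  comp_right g := by
    rintro ⟨W, p, q, hW, e⟩
    exact ⟨W, p, q ≫ g, hW, by rw [← Category.assoc, e, Preadditive.sub_comp]⟩
  equivalence :=
    { refl := fun f => by
        obtain ⟨W, hW⟩ := HasSums.nonempty (D := D)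
        exact ⟨W, 0, 0, hW, by simp⟩
      symm := by
        rintro f g ⟨W, p, q, hW, e⟩
        exact ⟨W, -p, q, hW, by rw [Preadditive.neg_comp, e, neg_sub]⟩
      trans := by
        intro f g h h₁ h₂
        obtain ⟨W, p, q, hW, e⟩ := factorRel_add D f g g h h₁ h₂
        exact ⟨W, p, q, hW, by rw [e]; abel⟩ }

instance [Preadditive A] (D : ObjectProperty A) [HasSums D] : Preadditive (ModIdeal D) :=
  CategoryTheory.Quotient.preadditive _ fun _ _ f₁ f₂ g₁ g₂ h h' => factorRel_add D f₁ f₂ g₁ g₂ h h'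

lemma hasSums_of_isAddClosed [Preadditive A] [HasZeroObject A] [HasBinaryBiproducts A]
    (D : ObjectProperty A) [IsAddClosed D] : HasSums D := by
  have hfree : ∀ M, free D M → D M := fun M hM => by
    rw [IsAddClosed.eq_add (D := D)]
    obtain ⟨O, hO⟩ := HasZeroObject.zero (C := A)
    refine ⟨O, ⟨M, 𝟙 M, 0, 𝟙 M, 0, by simp, by simp, by simp, hO.eq_of_src _ _⟩,
      ⟨isBinaryBilimitOfTotal _ ?_⟩, hM⟩
    simp
  have : HasFiniteProducts A := hasFiniteProducts_of_has_binary_and_terminal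
  have : HasFiniteBiproducts A := HasFiniteBiproducts.of_hasFiniteProducts
  have hsum : ∀ (k : ℕ) (f : Fin k → A), (∀ i, D (f i)) → D (⨁ f) := fun k f hf =>
    hfree _ ⟨k, f, biproduct.bicone f, hf, ⟨biproduct.isBilimit f⟩, ⟨Iso.refl _⟩⟩
  refine ⟨⟨_, hsum 0 Fin.elim0 fun i => i.elim0⟩, fun M N hM hN => ?_⟩
  let f : Fin 2 → A := ![M, N]
  have hf : ∀ i, D (f i) := by
    intro i
    fin_cases i
    · exact hM
    · exact hN
  exact ⟨{ pt := ⨁ f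
           fst := biproduct.π f 0
           snd := biproduct.π f 1
           inl := biproduct.ι f 0
           inr := biproduct.ι f 1
           inl_fst := biproduct.ι_π_self f 0
           inl_snd := biproduct.ι_π_ne f (by decide)
           inr_fst := biproduct.ι_π_ne f (by decide)
           inr_snd := biproduct.ι_π_self f 1 }, hsum 2 f hf⟩

/-- A class of composable pairs of morphisms, thought of as the conflations. -/
abbrev PairClass (A : Type u') [Category.{v'} A] :=
  ∀ ⦃M N L : A⦄, (M ⟶ N) → (N ⟶ L) → Prop

/-- `M` has an `X`-coresolution of length exactly `m`: conflations
`M ⟶ Y₀ ⟶ Z₁`, `Z₁ ⟶ Y₁ ⟶ Z₂`, …, ending with `Z_m ≅ Y_m`, with all `Y_i` in `X`. -/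
def HasCoresolution (conf : PairClass A) (X : ObjectProperty A) : ℕ → ObjectProperty A
  | 0 => fun M => ∃ Y, X Y ∧ Nonempty (M ≅ Y)
  | m + 1 => fun M => ∃ (Y Z : A) (i : M ⟶ Y) (p : Y ⟶ Z),
      conf i p ∧ X Y ∧ HasCoresolution conf X m Z

/-- `M` has an `X`-resolution of length exactly `m`. -/
def HasResolution (conf : PairClass A) (X : ObjectProperty A) : ℕ → ObjectProperty A
  | 0 => fun M => ∃ Y, X Y ∧ Nonempty (M ≅ Y)
  | m + 1 => fun M => ∃ (Z Y : A) (i : Z ⟶ Y) (p : Y ⟶ M),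
      conf i p ∧ X Y ∧ HasResolution conf X m Z

/-- `X_n^∨`: the objects of `X`-coresolution dimension at most `n`. -/
def coresdimLE (conf : PairClass A) (X : ObjectProperty A) (n : ℕ) : ObjectProperty A :=
  fun M => ∃ m ≤ n, HasCoresolution conf X m M

/-- `X_n^∧`: the objects of `X`-resolution dimension at most `n`. -/
def resdimLE (conf : PairClass A) (X : ObjectProperty A) (n : ℕ) : ObjectProperty A :=
  fun M => ∃ m ≤ n, HasResolution conf X m M

/-- `α : M ⟶ N` is a `D`-preenvelope of `M`. -/
def IsPreenvelope (D : ObjectProperty A) {M N : A} (α : M ⟶ N) : Prop :=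
  D N ∧ ∀ ⦃L : A⦄, D L → ∀ f : M ⟶ L, ∃ g : N ⟶ L, α ≫ g = f

/-- `β : N ⟶ M` is a `D`-precover of `M`. -/
def IsPrecover (D : ObjectProperty A) {N M : A} (β : N ⟶ M) : Prop :=
  D N ∧ ∀ ⦃L : A⦄, D L → ∀ f : L ⟶ M, ∃ g : L ⟶ N, g ≫ β = f

end General

/-! ### Exact categories and their categories of conflations -/

section Exact

variable {A : Type u'} [Category.{v'} A] [Preadditive A]

/-- The pairs of morphisms underlying a class of short complexes. -/
def pairs (conf : ObjectProperty (ShortComplex A)) : PairClass A := fun _ _ _ i p =>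
  ∃ w : i ≫ p = 0, conf (ShortComplex.mk i p w)

/-- Admissible monomorphisms. -/
def IsInflation (conf : ObjectProperty (ShortComplex A)) {M N : A} (i : M ⟶ N) : Prop :=
  ∃ (L : A) (p : N ⟶ L), pairs conf i p

/-- Admissible epimorphisms. -/
def IsDeflation (conf : ObjectProperty (ShortComplex A)) {N L : A} (p : N ⟶ L) : Prop :=
  ∃ (M : A) (i : M ⟶ N), pairs conf i p

/-- `(A, conf)` is an exact category in the sense of Quillen (axioms as in Bühler's survey):
`A` is additive and `conf` is an exact structure on it. -/
structure IsExactCategory (conf : ObjectProperty (ShortComplex A)) : Prop where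
  hasFiniteBiproducts : HasFiniteBiproducts A
  isKernel : ∀ S, conf S → Nonempty (IsLimit (KernelFork.ofι S.f S.zero))
  isCokernel : ∀ S, conf S → Nonempty (IsColimit (CokernelCofork.ofπ S.g S.zero))
  of_iso : ∀ S S' : ShortComplex A, Nonempty (S ≅ S') → conf S → conf S'
  inflation_id : ∀ M : A, IsInflation conf (𝟙 M)
  deflation_id : ∀ M : A, IsDeflation conf (𝟙 M)
  inflation_comp : ∀ ⦃M N L : A⦄ (i : M ⟶ N) (j : N ⟶ L),
    IsInflation conf i → IsInflation conf j → IsInflation conf (i ≫ j)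
  deflation_comp : ∀ ⦃M N L : A⦄ (p : M ⟶ N) (q : N ⟶ L),
    IsDeflation conf p → IsDeflation conf q → IsDeflation conf (p ≫ q)
  pushout : ∀ ⦃M N M' : A⦄ (i : M ⟶ N) (f : M ⟶ M'), IsInflation conf i →
    ∃ (N' : A) (g : N ⟶ N') (i' : M' ⟶ N'), IsPushout i f g i' ∧ IsInflation conf i'
  pullback : ∀ ⦃N L L' : A⦄ (p : N ⟶ L) (f : L' ⟶ L), IsDeflation conf p →
    ∃ (N' : A) (p' : N' ⟶ L') (g : N' ⟶ N), IsPullback p' g f p ∧ IsDeflation conf p'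

/-- Weakly idempotent complete: every split epimorphism has a kernel. -/
def IsWeaklyIdempotentComplete (A : Type u') [Category.{v'} A] [Preadditive A] : Prop :=
  ∀ ⦃M N : A⦄ (f : M ⟶ N) (g : N ⟶ M), g ≫ f = 𝟙 N → HasKernel f

/-- The category of conflations: the full subcategory of short complexes which are conflations. -/
abbrev Conflations (conf : ObjectProperty (ShortComplex A)) := conf.FullSubcategory

/-- The degreewise exact structure on the category of conflations. -/
def degreewise (conf : ObjectProperty (ShortComplex A)) :
    ObjectProperty (ShortComplex (Conflations conf)) := fun S =>
  conf ((S.map conf.ι).map ShortComplex.π₁) ∧ conf ((S.map conf.ι).map ShortComplex.π₂) ∧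
    conf ((S.map conf.ι).map ShortComplex.π₃)

/-- The class of split conflations. -/
def splitConflations (conf : ObjectProperty (ShortComplex A)) :
    ObjectProperty (Conflations conf) := fun η => Nonempty η.obj.Splitting

/-- `D` is a pseudo-cluster tilting subcategory with respect to the conflations `conf`. -/
structure IsPseudoClusterTilting (conf : ObjectProperty (ShortComplex A))
    (D : ObjectProperty A) : Prop where
  eq_add : D = add D
  left : ∀ M : A, ∃ (D₀ D₁ : A) (α : M ⟶ D₀) (p : D₀ ⟶ D₁),
    pairs conf α p ∧ D D₀ ∧ D D₁ ∧ IsPreenvelope D α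
  right : ∀ M : A, ∃ (D₁ D₀ : A) (i : D₁ ⟶ D₀) (β : D₀ ⟶ M),
    pairs conf i β ∧ D D₀ ∧ D D₁ ∧ IsPrecover D β

/-- The class `ε_F` of short complexes sent to short exact sequences by `F`. -/
def inducedConf {B : Type*} [Category* B] [Preadditive B] (F : A ⥤ B) [F.PreservesZeroMorphisms] :
    ObjectProperty (ShortComplex A) := fun S => (S.map F).ShortExact

end Exact

/-! ### Extriangulated categories -/

section Extriangulated

variable {C : Type u} [Category.{v} C]

/-- The `𝔼`-extensions `𝔼(D, A)`. -/
abbrev Extn (E : Cᵒᵖ ⥤ C ⥤ AddCommGrpCat.{v}) (D A : C) : Type v := (E.obj (op D)).obj A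

/-- `a · δ = 𝔼(D, a)(δ)`. -/
def push (E : Cᵒᵖ ⥤ C ⥤ AddCommGrpCat.{v}) {D A A' : C} (a : A ⟶ A') (δ : Extn E D A) :
    Extn E D A' := ((E.obj (op D)).map a) δ

/-- `δ · c = 𝔼(c, A)(δ)`. -/
def pull (E : Cᵒᵖ ⥤ C ⥤ AddCommGrpCat.{v}) {D D' A : C} (c : D' ⟶ D) (δ : Extn E D A) :
    Extn E D' A := ((E.map c.op).app A) δ

variable (C)

/-- An external triangulation `(𝔼, 𝔰)` on an additive category `C`, after Nakaoka and Palu. The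
realization `𝔰` is given by the relation `Realizes x y δ`, meaning `𝔰(δ) = [A ⟶ B ⟶ D]`. -/
structure Extriangulation [Preadditive C] [HasZeroObject C] [HasBinaryBiproducts C] where
  /-- The bifunctor of extensions. -/
  E : Cᵒᵖ ⥤ C ⥤ AddCommGrpCat.{v}
  additive_left : E.Additive
  additive_right : ∀ D : Cᵒᵖ, (E.obj D).Additive
  /-- `𝔰(δ) = [A ⟶ B ⟶ D]`. -/
  Realizes : ∀ {A B D : C}, (A ⟶ B) → (B ⟶ D) → Extn E D A → Prop
  exists_realizes : ∀ {A D : C} (δ : Extn E D A), ∃ (B : C) (x : A ⟶ B) (y : B ⟶ D), Realizes x y δ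
  /-- The sequences realizing `δ` form exactly one equivalence class. -/
  realizes_iff : ∀ {A B B' D : C} {x : A ⟶ B} {y : B ⟶ D} {δ : Extn E D A}, Realizes x y δ →
    ∀ (x' : A ⟶ B') (y' : B' ⟶ D),
      Realizes x' y' δ ↔ ∃ b : B ≅ B', x ≫ b.hom = x' ∧ b.hom ≫ y' = y
  /-- Morphisms of extensions are realized by morphisms of sequences. -/
  exists_hom : ∀ {A B D A' B' D' : C} {x : A ⟶ B} {y : B ⟶ D} {δ : Extn E D A}
    {x' : A' ⟶ B'} {y' : B' ⟶ D'} {δ' : Extn E D' A'}, Realizes x y δ → Realizes x' y' δ' →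
    ∀ (a : A ⟶ A') (c : D ⟶ D'), push E a δ = pull E c δ' →
      ∃ b : B ⟶ B', x ≫ b = a ≫ x' ∧ b ≫ y' = y ≫ c
  realizes_zero : ∀ A D : C,
    Realizes (biprod.inl : A ⟶ A ⊞ D) (biprod.snd : A ⊞ D ⟶ D) (0 : Extn E D A)
  realizes_sum : ∀ {A B D A' B' D' : C} {x : A ⟶ B} {y : B ⟶ D} {δ : Extn E D A}
    {x' : A' ⟶ B'} {y' : B' ⟶ D'} {δ' : Extn E D' A'}, Realizes x y δ → Realizes x' y' δ' →
    Realizes (biprod.map x x') (biprod.map y y')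
      ((push E biprod.inl (pull E biprod.fst δ) +
        push E biprod.inr (pull E biprod.snd δ') : Extn E (D ⊞ D') (A ⊞ A')))
  et3 : ∀ {A B D A' B' D' : C} {x : A ⟶ B} {y : B ⟶ D} {δ : Extn E D A}
    {x' : A' ⟶ B'} {y' : B' ⟶ D'} {δ' : Extn E D' A'}, Realizes x y δ → Realizes x' y' δ' →
    ∀ (a : A ⟶ A') (b : B ⟶ B'), x ≫ b = a ≫ x' →
      ∃ c : D ⟶ D', push E a δ = pull E c δ' ∧ b ≫ y' = y ≫ c
  et3_op : ∀ {A B D A' B' D' : C} {x : A ⟶ B} {y : B ⟶ D} {δ : Extn E D A}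
    {x' : A' ⟶ B'} {y' : B' ⟶ D'} {δ' : Extn E D' A'}, Realizes x y δ → Realizes x' y' δ' →
    ∀ (b : B ⟶ B') (c : D ⟶ D'), b ≫ y' = y ≫ c →
      ∃ a : A ⟶ A', push E a δ = pull E c δ' ∧ x ≫ b = a ≫ x'
  et4 : ∀ {A B D M F : C} {f : A ⟶ B} {f' : B ⟶ D} {δ : Extn E D A}
    {g : B ⟶ M} {g' : M ⟶ F} {δ' : Extn E F B}, Realizes f f' δ → Realizes g g' δ' →
    ∃ (N : C) (d : D ⟶ N) (e : N ⟶ F) (h' : M ⟶ N) (δ'' : Extn E N A),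
      f' ≫ d = g ≫ h' ∧ h' ≫ e = g' ∧ Realizes (f ≫ g) h' δ'' ∧
      Realizes d e (push E f' δ') ∧ pull E d δ'' = δ ∧ push E f δ'' = pull E e δ'
  et4_op : ∀ {D A B F M : C} {f' : D ⟶ A} {f : A ⟶ B} {δ : Extn E B D}
    {g' : F ⟶ B} {g : B ⟶ M} {δ' : Extn E M F}, Realizes f' f δ → Realizes g' g δ' →
    ∃ (N : C) (d : D ⟶ N) (e : N ⟶ F) (h' : N ⟶ A) (δ'' : Extn E M N),
      d ≫ h' = f' ∧ h' ≫ f = e ≫ g' ∧ Realizes h' (f ≫ g) δ'' ∧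
      Realizes d e (pull E g' δ) ∧ push E e δ'' = δ' ∧ push E d δ = pull E g δ''

variable {C}
variable [Preadditive C] [HasZeroObject C] [HasBinaryBiproducts C] (T : Extriangulation C)

namespace Extriangulation

/-- The conflations of an extriangulated category. -/
def conf : PairClass C := fun M _ L x y => ∃ δ : Extn T.E L M, T.Realizes x y δ

/-- `𝔼`-projective objects. -/
def IsProj : ObjectProperty C := fun P =>
  ∀ ⦃M N L : C⦄ (x : M ⟶ N) (y : N ⟶ L), T.conf x y → ∀ f : P ⟶ L, ∃ g : P ⟶ N, g ≫ y = f

/-- There are enough `𝔼`-projectives. -/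
def EnoughProj : Prop :=
  ∀ L : C, ∃ (M P : C) (x : M ⟶ P) (y : P ⟶ L), T.conf x y ∧ T.IsProj P

/-- `𝔼`-projective morphisms: `𝔼(f, -) = 0`. -/
def IsProjMor {M N : C} (f : M ⟶ N) : Prop := T.E.map f.op = 0

/-- `𝔼`-injective morphisms: `𝔼(-, g) = 0`. -/
def IsInjMor {M N : C} (g : M ⟶ N) : Prop := ∀ D : Cᵒᵖ, (T.E.obj D).map g = 0

/-- The family with first member `E` and with the further members given by `G`. -/
def consFamily (E : Cᵒᵖ ⥤ C ⥤ AddCommGrpCat.{v}) (G : ℕ → Cᵒᵖ ⥤ C ⥤ AddCommGrpCat.{v}) :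
    ℕ → Cᵒᵖ ⥤ C ⥤ AddCommGrpCat.{v}
  | 0 => E
  | i + 1 => G i

/-- A family `(𝔼^i)_{i ≥ 1}` of higher extension groups: `ext i` stands for `𝔼^{i+1}`, so that
`ext 0` is `𝔼` itself. -/
structure HigherExtensions where
  /-- `higher i` is `𝔼^{i+2}`. -/
  higher : ℕ → Cᵒᵖ ⥤ C ⥤ AddCommGrpCat.{v}
  higher_additive_left : ∀ i, (higher i).Additive
  higher_additive_right : ∀ i (D : Cᵒᵖ), ((higher i).obj D).Additive
  /-- The connecting morphism `𝔼^{i+1}(A, -) ⟶ 𝔼^{i+2}(D, -)` of an extension. -/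
  conn : ∀ (i : ℕ) {A D : C}, Extn T.E D A →
    ((consFamily T.E higher i).obj (op A) ⟶ (consFamily T.E higher (i + 1)).obj (op D))
  /-- The connecting morphism `𝔼^{i+1}(-, D) ⟶ 𝔼^{i+2}(-, A)` of an extension. -/
  conn' : ∀ (i : ℕ) {A D : C}, Extn T.E D A →
    ((consFamily T.E higher i).flip.obj D ⟶ (consFamily T.E higher (i + 1)).flip.obj A)
  exact_mid : ∀ (i : ℕ) {A B D : C} {x : A ⟶ B} {y : B ⟶ D} {δ : Extn T.E D A},
    T.Realizes x y δ → ∀ Z : C,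
      Function.Exact (((consFamily T.E higher i).map y.op).app Z)
        (((consFamily T.E higher i).map x.op).app Z)
  exact_conn : ∀ (i : ℕ) {A B D : C} {x : A ⟶ B} {y : B ⟶ D} {δ : Extn T.E D A},
    T.Realizes x y δ → ∀ Z : C,
      Function.Exact (((consFamily T.E higher i).map x.op).app Z) ((conn i δ).app Z)
  exact_mid' : ∀ (i : ℕ) {A B D : C} {x : A ⟶ B} {y : B ⟶ D} {δ : Extn T.E D A},
    T.Realizes x y δ → ∀ Z : Cᵒᵖ,
      Function.Exact (((consFamily T.E higher i).obj Z).map x)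
        (((consFamily T.E higher i).obj Z).map y)
  exact_conn' : ∀ (i : ℕ) {A B D : C} {x : A ⟶ B} {y : B ⟶ D} {δ : Extn T.E D A},
    T.Realizes x y δ → ∀ Z : Cᵒᵖ,
      Function.Exact (((consFamily T.E higher i).obj Z).map y) ((conn' i δ).app Z)
  conn_natural : ∀ (i : ℕ) {A B D A' B' D' : C} {x : A ⟶ B} {y : B ⟶ D} {δ : Extn T.E D A}
    {x' : A' ⟶ B'} {y' : B' ⟶ D'} {δ' : Extn T.E D' A'},
    T.Realizes x y δ → T.Realizes x' y' δ' →
    ∀ (a : A ⟶ A') (b : B ⟶ B') (c : D ⟶ D'), push T.E a δ = pull T.E c δ' →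
      x ≫ b = a ≫ x' → b ≫ y' = y ≫ c →
      (consFamily T.E higher i).map a.op ≫ conn i δ =
        conn i δ' ≫ (consFamily T.E higher (i + 1)).map c.op
  conn'_natural : ∀ (i : ℕ) {A B D A' B' D' : C} {x : A ⟶ B} {y : B ⟶ D} {δ : Extn T.E D A}
    {x' : A' ⟶ B'} {y' : B' ⟶ D'} {δ' : Extn T.E D' A'},
    T.Realizes x y δ → T.Realizes x' y' δ' →
    ∀ (a : A ⟶ A') (b : B ⟶ B') (c : D ⟶ D'), push T.E a δ = pull T.E c δ' →
      x ≫ b = a ≫ x' → b ≫ y' = y ≫ c →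
      conn' i δ ≫ (consFamily T.E higher (i + 1)).flip.map a =
        (consFamily T.E higher i).flip.map c ≫ conn' i δ'
  projMor : ∀ (i : ℕ) {M N : C} (f : M ⟶ N), T.IsProjMor f →
    (consFamily T.E higher i).map f.op = 0
  injMor : ∀ (i : ℕ) {M N : C} (g : M ⟶ N), T.IsInjMor g →
    ∀ D : Cᵒᵖ, ((consFamily T.E higher i).obj D).map g = 0

variable {T}

/-- `H.ext i` is `𝔼^{i+1}`. -/
def HigherExtensions.ext (H : T.HigherExtensions) (i : ℕ) : Cᵒᵖ ⥤ C ⥤ AddCommGrpCat.{v} :=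
  consFamily T.E H.higher i

/-- `X` is `(n+2)`-rigid: `𝔼^i(X, X) = 0` for `1 ≤ i ≤ n + 1`. -/
def IsRigid (H : T.HigherExtensions) (n : ℕ) (X : ObjectProperty C) : Prop :=
  ∀ i ≤ n, ∀ M N : C, X M → X N → ∀ e : Extn (H.ext i) M N, e = 0

/-- Dimension shifting; needed to define the functor `𝔽` on the quotient by `[X]`. -/
lemma ext_coresolution_eq_zero (H : T.HigherExtensions) {n : ℕ} {X : ObjectProperty C}
    (hX : IsRigid H n X) (m : ℕ) : ∀ (i : ℕ), m + i ≤ n → ∀ M N : C,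
      HasCoresolution T.conf X m M → X N → ∀ e : Extn (H.ext i) M N, e = 0 := by
  induction m with
  | zero =>
    rintro i hi M N ⟨Y, hY, ⟨φ⟩⟩ hN e
    have h := hX i (by omega) Y N hY hN (pull (H.ext i) φ.inv e)
    have h' : pull (H.ext i) φ.hom (pull (H.ext i) φ.inv e) = e := by
      have : ((H.ext i).map φ.inv.op).app N ≫ ((H.ext i).map φ.hom.op).app N = 𝟙 _ := by
        rw [← NatTrans.comp_app, ← Functor.map_comp, ← op_comp, φ.hom_inv_id]
        simp
      exact congrArg (fun t => t.hom e) this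
    rw [← h', h]
    exact map_zero (((H.ext i).map φ.hom.op).app N).hom
  | succ m ih =>
    rintro i hi M N ⟨Y, Z, x, y, ⟨δ, hδ⟩, hY, hZ⟩ hN e
    have hz : ((H.conn i δ).app N) e = 0 := ih (i + 1) (by omega) Z N hZ hN _
    obtain ⟨e', he'⟩ := (H.exact_conn i hδ N e).1 hz
    have h0 : e' = 0 := hX i (by omega) Y N hY hN e'
    rw [← he', h0]
    exact map_zero (((H.ext i).map x.op).app N).hom

variable (T)

/-! ### Stable categories, the functor `𝔽`, and the class `R_X^n` -/

/-- Morphisms of the full subcategory `P` are identified if their difference is `𝔼`-projective. -/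
def stableRel (P : ObjectProperty C) : HomRel P.FullSubcategory := fun _ _ f g =>
  T.IsProjMor (f.hom - g.hom)

lemma stableRel_iff (P : ObjectProperty C) {M N : P.FullSubcategory} (f g : M ⟶ N) :
    T.stableRel P f g ↔ T.E.map f.hom.op = T.E.map g.hom.op := by
  have := T.additive_left
  unfold stableRel IsProjMor
  rw [op_sub, Functor.map_sub, sub_eq_zero]

instance (P : ObjectProperty C) : Congruence (T.stableRel P) where
  comp_left f := by
    intro g g' h
    rw [stableRel_iff] at h ⊢
    simp [h]
  comp_right g := by
    intro h
    rw [stableRel_iff] at h ⊢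
    simp [h]
  equivalence :=
    { refl := fun f => by rw [stableRel_iff]
      symm := fun h => by rw [stableRel_iff] at h ⊢; exact h.symm
      trans := fun h h' => by rw [stableRel_iff] at h h' ⊢; exact h.trans h' }

/-- The stable category of the full subcategory `P` of `C`. -/
abbrev Stable (P : ObjectProperty C) := CategoryTheory.Quotient (T.stableRel P)

instance (P : ObjectProperty C) : Preadditive (T.Stable P) :=
  CategoryTheory.Quotient.preadditive _ fun _ _ f₁ f₂ g₁ g₂ h h' => by
    have := T.additive_left
    rw [stableRel_iff] at h h' ⊢
    change T.E.map (f₁.hom + g₁.hom).op = T.E.map (f₂.hom + g₂.hom).op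
    rw [op_add, op_add, Functor.map_add, Functor.map_add, h, h']

/-- The bifunctor `𝔼` with its first variable in the stable category of `P`. -/
def stableExt (P : ObjectProperty C) : C ⥤ (T.Stable P)ᵒᵖ ⥤ AddCommGrpCat.{v} :=
  (CategoryTheory.Quotient.lift (T.stableRel P) (P.ι ⋙ T.E.rightOp) (fun _ _ f g h => by
    rw [stableRel_iff] at h
    exact congrArg Quiver.Hom.op h)).leftOp.flip

/-- `X_n^∨` in `C`. -/
abbrev cores (X : ObjectProperty C) (n : ℕ) : ObjectProperty C := coresdimLE T.conf X n

/-- The class `X` inside the full subcategory `X_n^∨`, which contains it. -/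
abbrev inCores (X : ObjectProperty C) (n : ℕ) : ObjectProperty (T.cores X n).FullSubcategory :=
  X.inverseImage (T.cores X n).ι

instance (X : ObjectProperty C) [IsAddClosed X] (n : ℕ) : HasSums (T.inCores X n) := by
  have hX := hasSums_of_isAddClosed X
  have h : ∀ W, X W → T.cores X n W := fun W hW => ⟨0, n.zero_le, W, hW, ⟨Iso.refl W⟩⟩
  refine ⟨?_, fun M N hM hN => ?_⟩
  · obtain ⟨W, hW⟩ := hX.nonempty
    exact ⟨⟨W, h W hW⟩, hW⟩
  · obtain ⟨b, hb⟩ := hX.sum M.obj N.obj hM hN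
    exact ⟨{ pt := ⟨b.pt, h _ hb⟩
             fst := ObjectProperty.homMk b.fst
             snd := ObjectProperty.homMk b.snd
             inl := ObjectProperty.homMk b.inl
             inr := ObjectProperty.homMk b.inr
             inl_fst := ObjectProperty.hom_ext _ b.inl_fst
             inl_snd := ObjectProperty.hom_ext _ b.inl_snd
             inr_fst := ObjectProperty.hom_ext _ b.inr_fst
             inr_snd := ObjectProperty.hom_ext _ b.inr_snd }, hb⟩

/-- The quotient category `X_{n+1}^∨/[X]`. -/
abbrev QuotCores (X : ObjectProperty C) (n : ℕ) := ModIdeal (T.inCores X (n + 1))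

/-- The quotient functor `X_{n+1}^∨ ⥤ X_{n+1}^∨/[X]`. -/
abbrev toQuot (X : ObjectProperty C) (n : ℕ) :
    (T.cores X (n + 1)).FullSubcategory ⥤ T.QuotCores X n :=
  CategoryTheory.Quotient.functor _

/-- The functor `ℍ`, sending `M` in `X_{n+1}^∨` to the functor `𝔼(-, M)` on the stable category of
`X_n^∨`. -/
abbrev functorH (X : ObjectProperty C) (n : ℕ) :
    (T.cores X (n + 1)).FullSubcategory ⥤ (T.Stable (T.cores X n))ᵒᵖ ⥤ AddCommGrpCat.{v} :=
  (T.cores X (n + 1)).ι ⋙ T.stableExt (T.cores X n)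

lemma functorH_map_eq {H : T.HigherExtensions} {n : ℕ} {X : ObjectProperty C} (hX : IsRigid H n X)
    {M N : (T.cores X (n + 1)).FullSubcategory} (f g : M ⟶ N)
    (h : factorRel (T.inCores X (n + 1)) f g) :
    (T.functorH X n).map f = (T.functorH X n).map g := by
  obtain ⟨W, p, q, hW, e⟩ := h
  apply NatTrans.ext
  funext Z
  have := T.additive_right (op Z.unop.as.obj)
  change (T.E.obj (op Z.unop.as.obj)).map f.hom = (T.E.obj (op Z.unop.as.obj)).map g.hom
  rw [← sub_eq_zero, ← Functor.map_sub]
  have e' : p.hom ≫ q.hom = f.hom - g.hom := congrArg (fun t => t.hom) e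
  rw [← e', Functor.map_comp]
  obtain ⟨m, hm, hZ⟩ := Z.unop.as.property
  ext ξ
  have h0 : ((T.E.obj (op Z.unop.as.obj)).map p.hom) ξ = 0 :=
    ext_coresolution_eq_zero H hX m 0 (by omega) Z.unop.as.obj W.obj hZ hW _
  change ((T.E.obj (op Z.unop.as.obj)).map q.hom) (((T.E.obj (op Z.unop.as.obj)).map p.hom) ξ) = 0
  rw [h0]
  exact map_zero ((T.E.obj (op Z.unop.as.obj)).map q.hom).hom

/-- The functor `𝔽 : X_{n+1}^∨/[X] ⥤ Mod(stable category of X_n^∨)` induced by `ℍ`, with values in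
the abelian category of all contravariant functors to abelian groups. (Kernels and cokernels of
additive functors are additive, so exactness is the same in the category of modules.) -/
def functorF {H : T.HigherExtensions} {n : ℕ} {X : ObjectProperty C} (hX : IsRigid H n X) :
    T.QuotCores X n ⥤ (T.Stable (T.cores X n))ᵒᵖ ⥤ AddCommGrpCat.{v} :=
  CategoryTheory.Quotient.lift _ (T.functorH X n) fun _ _ f g h => T.functorH_map_eq hX f g h

instance {H : T.HigherExtensions} {n : ℕ} {X : ObjectProperty C} [IsAddClosed X]
    (hX : IsRigid H n X) : (T.functorF hX).PreservesZeroMorphisms where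
  map_zero M N := by
    apply NatTrans.ext
    funext Z
    have := T.additive_right (op Z.unop.as.obj)
    change (T.E.obj (op Z.unop.as.obj)).map (0 : M.as.obj ⟶ N.as.obj) = 0
    exact Functor.map_zero _ _ _

/-- `R_X^n`: the additive functors `G` with a presentation
`Hom(-, X₀) ⟶ Hom(-, X₁) ⟶ G ⟶ 0` over the stable category of `X_n^∨`, where `X₀` is in `X` and
`X₁` is in `X_n^∨`. -/
def classR (X : ObjectProperty C) (n : ℕ) :
    ObjectProperty ((T.Stable (T.cores X n))ᵒᵖ ⥤ AddCommGrpCat.{v}) := fun G =>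
  G.Additive ∧ ∃ (X₀ X₁ : T.Stable (T.cores X n)) (α : preadditiveYoneda.obj X₀ ⟶
    preadditiveYoneda.obj X₁) (β : preadditiveYoneda.obj X₁ ⟶ G) (w : α ≫ β = 0),
    X X₀.as.obj ∧ (ShortComplex.mk α β w).Exact ∧ Epi β

/-- The exact structure on `R_X^n` inherited from the category of modules. -/
abbrev confR (X : ObjectProperty C) (n : ℕ) :
    ObjectProperty (ShortComplex (T.classR X n).FullSubcategory) := inducedConf (T.classR X n).ι

/-- The exact structure `ε_𝔽` on `X_{n+1}^∨/[X]`. -/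
abbrev confF {H : T.HigherExtensions} {n : ℕ} {X : ObjectProperty C} [IsAddClosed X]
    (hX : IsRigid H n X) : ObjectProperty (ShortComplex (T.QuotCores X n)) :=
  inducedConf (T.functorF hX)

/-- `𝔽` as a functor `X_{n+1}^∨/[X] ⥤ R_X^n`, once its values are known to lie in `R_X^n`. -/
abbrev functorFR {H : T.HigherExtensions} {n : ℕ} {X : ObjectProperty C} (hX : IsRigid H n X)
    (hR : ∀ M, T.classR X n ((T.functorF hX).obj M)) :
    T.QuotCores X n ⥤ (T.classR X n).FullSubcategory :=
  (T.classR X n).lift (T.functorF hX) hR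

end Extriangulation

end Extriangulated

end Extri

open Extri

/-!
The whole statement is deduced from one fact: `𝔽` identifies `X_{n+1}^∨/[X]` with a full subcategory
of an abelian category of functors, namely `R_X^n`, and this subcategory contains zero and is closed
under extensions (`isExtensionClosedEmbedding_functorF`).

*The functor `𝔽`.* Let `M` be in `X_{n+1}^∨`, with a conflation `M ⟶ Y ⟶ Z` of extension `δ` such
that `Y` is in `X` and `Z` is in `X_n^∨`. By dimension shifting, rigidity gives `𝔼(X_n^∨, Y) = 0`,
so the functor `𝔼(-, M)` on the stable category of `X_n^∨` is generated by `δ`, and the relations of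
`δ` are the morphisms which lift to `Y` (`isPresentation_of_realizes`). Therefore `𝔽` takes values
in `R_X^n`; it is full because an element of `𝔼(Z, N)` which vanishes on `Y` is a pushforward of
`δ`; it is faithful because a morphism which pushes `δ` forward to zero extends to `Y`. Conversely a
presentation by `f : X₀ ⟶ X₁` is realized by the cocone of a deflation `X₀ ⊞ P ⟶ X₁` with
component `f` and with `P` projective (`functorF_exists_iso`). That `R_X^n` is closed under
extensions is the horseshoe lemma.

*Exact structures.* An extension-closed full subcategory of an abelian category is an exact category
(`IsExtensionClosedEmbedding.isExactCategory`). Its conflations form an extension-closed full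
subcategory of the abelian category of short complexes, so they are an exact category for the
degreewise structure (`IsExtensionClosedEmbedding.isExactCategory_degreewise`).

*Split conflations.* A conflation `K ⟶ M ⟶ N` embeds in the split conflation on `M` and `N`, with
quotient `N ⟶ N ⟶ 0`, and it is a quotient of the split conflation on `K` and `M`, with kernel
`0 ⟶ K ⟶ K`; both morphisms have the required approximation property. A morphism from
`K ⟶ M ⟶ N` to `K' ⟶ M' ⟶ N'` factors through a split conflation exactly when its component
`N ⟶ N'` factors through `M'` (`factorRel_splitConflations_iff`). With the pullback `E` of `N` and
`M'` over `N'`, the kernel and the cokernel of the class of a morphism are the conflations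
`K ⟶ M ⊞ K' ⟶ E` and `E ⟶ M' ⊞ N ⟶ N'`. If the class is a monomorphism, then the first of them
splits, and this makes the class the kernel of its cokernel; dually for epimorphisms. Hence the
quotient is abelian.

*Split epimorphisms modulo `[X]`.* If the class of `b : M ⟶ N` has a section, then `(b g p)` has a
section for some `g : W ⟶ N` with `W` in `X` and any deflation `p : P ⟶ N` from a projective
object. Since `(b g p)` is a deflation, it belongs to a split `𝔼`-triangle, and its kernel, a
retract of `M ⊞ W ⊞ P`, is in `X_{n+1}^∨` because this class is closed under retracts
(`cores_of_retract`). Modulo `[X]` the summands `W` and `P` vanish. This yields both weak idempotent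
completeness and the description of the split conflations in `X_{n+1}^∨/[X]`.
-/

namespace Extri

/-! ### Extensions, deflations and split triangles -/

section Extriangulated

variable {C : Type u} [Category.{v} C]

section PushPull

variable (E : Cᵒᵖ ⥤ C ⥤ AddCommGrpCat.{v})

lemma push_id {D A : C} (δ : Extn E D A) : push E (𝟙 A) δ = δ := by
  simp [push]

lemma pull_id {D A : C} (δ : Extn E D A) : pull E (𝟙 D) δ = δ := by
  simp [pull]

lemma push_comp {D A A' A'' : C} (a : A ⟶ A') (b : A' ⟶ A'') (δ : Extn E D A) :
    push E (a ≫ b) δ = push E b (push E a δ) := by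
  simp [push]

lemma pull_comp {D D' D'' A : C} (c : D' ⟶ D) (d : D'' ⟶ D') (δ : Extn E D A) :
    pull E (d ≫ c) δ = pull E d (pull E c δ) := by
  simp [pull]

lemma push_pull {D D' A A' : C} (a : A ⟶ A') (c : D' ⟶ D) (δ : Extn E D A) :
    push E a (pull E c δ) = pull E c (push E a δ) :=
  (congrArg (fun t => t.hom δ) ((E.map c.op).naturality a)).symm

@[simp]
lemma push_zero {D A A' : C} (a : A ⟶ A') : push E a (0 : Extn E D A) = 0 :=
  map_zero ((E.obj (op D)).map a).hom

@[simp]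
lemma pull_zero {D D' A : C} (c : D' ⟶ D) : pull E c (0 : Extn E D A) = 0 :=
  map_zero ((E.map c.op).app A).hom

end PushPull

variable [Preadditive C] [HasZeroObject C] [HasBinaryBiproducts C] (T : Extriangulation C)

namespace Extriangulation

lemma sub_push {D A A' : C} (a b : A ⟶ A') (δ : Extn T.E D A) :
    push T.E (a - b) δ = push T.E a δ - push T.E b δ := by
  have := T.additive_right (op D)
  simp [push, Functor.map_sub]

lemma sub_pull {D D' A : C} (a b : D' ⟶ D) (δ : Extn T.E D A) :
    pull T.E (a - b) δ = pull T.E a δ - pull T.E b δ := by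
  have := T.additive_left
  simp [pull, op_sub, Functor.map_sub]

lemma add_pull {D D' A : C} (a b : D' ⟶ D) (δ : Extn T.E D A) :
    pull T.E (a + b) δ = pull T.E a δ + pull T.E b δ := by
  have := T.additive_left
  simp [pull, op_add, Functor.map_add]

variable {T}

section Triangle

variable {A B D : C} {x : A ⟶ B} {y : B ⟶ D} {δ : Extn T.E D A}

/-- Obtained by comparing with the split triangle `A ⟶ A ⊞ O ⟶ O` of a zero object `O`. -/
lemma Realizes.comp_eq_zero (h : T.Realizes x y δ) : x ≫ y = 0 := by
  obtain ⟨O, hO⟩ := HasZeroObject.zero (C := C)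
  obtain ⟨c, -, e⟩ := T.et3 (T.realizes_zero A O) h (𝟙 A) (biprod.fst ≫ x) (by simp)
  have := congrArg (fun t => biprod.inl ≫ t) e
  simpa using this

/-- A morphism `f` lifts along the deflation of an `𝔼`-triangle iff it pulls the extension back to
zero. -/
lemma Realizes.lift_iff (h : T.Realizes x y δ) {Z : C} (f : Z ⟶ D) :
    (∃ g : Z ⟶ B, g ≫ y = f) ↔ pull T.E f δ = 0 := by
  constructor
  · rintro ⟨g, rfl⟩
    obtain ⟨a, e, -⟩ := T.et3_op (T.realizes_zero A B) h (biprod.desc x (𝟙 B)) y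
      (by ext <;> simp [Realizes.comp_eq_zero h])
    rw [pull_comp, ← e, push_zero, pull_zero]
  · intro e
    obtain ⟨b, -, hb⟩ := T.exists_hom (T.realizes_zero A Z) h (𝟙 A) f (by rw [e, push_zero])
    exact ⟨biprod.inr ≫ b, by rw [Category.assoc, hb, biprod.inr_snd_assoc]⟩

/-- A morphism `f` extends along the inflation of an `𝔼`-triangle iff it pushes the extension
forward to zero. -/
lemma Realizes.extend_iff (h : T.Realizes x y δ) {Z : C} (f : A ⟶ Z) :
    (∃ g : B ⟶ Z, x ≫ g = f) ↔ push T.E f δ = 0 := by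
  constructor
  · rintro ⟨g, rfl⟩
    obtain ⟨c, e, -⟩ := T.et3 h (T.realizes_zero B D) x (biprod.lift (𝟙 B) y)
      (by ext <;> simp [Realizes.comp_eq_zero h])
    rw [push_comp, e, pull_zero, push_zero]
  · intro e
    obtain ⟨b, hb, -⟩ := T.exists_hom h (T.realizes_zero Z D) f (𝟙 D) (by rw [e, pull_zero])
    exact ⟨b ≫ biprod.fst, by rw [reassoc_of% hb, biprod.inl_fst, Category.comp_id]⟩

/-- Exactness of `C(Z, D) ⟶ 𝔼(Z, A) ⟶ 𝔼(Z, B)`. -/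
lemma Realizes.exists_pull_eq (h : T.Realizes x y δ) {Z : C} (ε : Extn T.E Z A)
    (hε : push T.E x ε = 0) : ∃ c : Z ⟶ D, pull T.E c δ = ε := by
  obtain ⟨W, x', y', h'⟩ := T.exists_realizes ε
  obtain ⟨b, hb⟩ := (Realizes.extend_iff h' x).2 hε
  obtain ⟨c, e, -⟩ := T.et3 h' h (𝟙 A) b (by rw [hb, Category.id_comp])
  exact ⟨c, by rw [← e, push_id]⟩

/-- Exactness of `C(A, Z) ⟶ 𝔼(D, Z) ⟶ 𝔼(B, Z)`. -/
lemma Realizes.exists_push_eq (h : T.Realizes x y δ) {Z : C} (ε : Extn T.E D Z)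
    (hε : pull T.E y ε = 0) : ∃ f : A ⟶ Z, push T.E f δ = ε := by
  obtain ⟨W, x', y', h'⟩ := T.exists_realizes ε
  obtain ⟨b, hb⟩ := (Realizes.lift_iff h' y).2 hε
  obtain ⟨a, e, -⟩ := T.et3_op h h' b (𝟙 D) (by rw [hb, Category.comp_id])
  exact ⟨a, by rw [e, pull_id]⟩

lemma Realizes.pull_self (h : T.Realizes x y δ) : pull T.E y δ = 0 :=
  (Realizes.lift_iff h y).1 ⟨𝟙 B, Category.id_comp y⟩

lemma Realizes.of_iso (h : T.Realizes x y δ) {B' : C} (e : B ≅ B') :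
    T.Realizes (x ≫ e.hom) (e.inv ≫ y) δ :=
  (T.realizes_iff h _ _).2 ⟨e, rfl, by simp⟩

/-- An `𝔼`-triangle whose deflation is a split epimorphism realizes zero. -/
lemma Realizes.eq_zero_of_section (h : T.Realizes x y δ) (s : D ⟶ B) (hs : s ≫ y = 𝟙 D) :
    δ = 0 := by
  rw [← pull_id T.E δ]
  exact (Realizes.lift_iff h _).1 ⟨s, hs⟩

end Triangle

/-- The two halves of a split `𝔼`-triangle can be exchanged. -/
lemma Realizes.exists_splitting {A B D : C} {x : A ⟶ B} {y : B ⟶ D}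
    (h : T.Realizes x y (0 : Extn T.E D A)) :
    ∃ (s : D ⟶ B) (r : B ⟶ A), x ≫ r = 𝟙 A ∧ s ≫ y = 𝟙 D ∧ r ≫ x + y ≫ s = 𝟙 B ∧
      T.Realizes s r (0 : Extn T.E A D) := by
  obtain ⟨b, hb, hb'⟩ := (T.realizes_iff (T.realizes_zero A D) x y).1 h
  refine ⟨biprod.inr ≫ b.hom, b.inv ≫ biprod.fst, ?_, ?_, ?_, ?_⟩
  · simp [← hb]
  · simp [hb']
  · have hy : y = b.inv ≫ biprod.snd := by rw [← hb', Iso.inv_hom_id_assoc]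
    have : b.inv ≫ (biprod.fst ≫ biprod.inl + biprod.snd ≫ biprod.inr) ≫ b.hom = 𝟙 B := by
      simp
    rw [← hb, hy]
    simpa only [Preadditive.add_comp, Preadditive.comp_add, Category.assoc] using this
  · have := (Realizes.of_iso (T.realizes_zero D A) (biprod.braiding D A ≪≫ b))
    have h₁ : (biprod.inl : D ⟶ D ⊞ A) ≫ biprod.lift biprod.snd biprod.fst = biprod.inr := by
      ext <;> simp
    convert this using 1
    · simp [reassoc_of% h₁]
    · simp

variable (T)

/-- Being the deflation of a conflation. -/
def Defl {B D : C} (y : B ⟶ D) : Prop := ∃ (A : C) (x : A ⟶ B), T.conf x y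

/-- Being the inflation of a conflation. -/
def Infl {A B : C} (x : A ⟶ B) : Prop := ∃ (D : C) (y : B ⟶ D), T.conf x y

variable {T}

lemma Defl.comp {B D N : C} {y : B ⟶ D} {z : D ⟶ N} (hy : T.Defl y) (hz : T.Defl z) :
    T.Defl (y ≫ z) := by
  obtain ⟨A, x, δ, h⟩ := hy
  obtain ⟨A', x', δ', h'⟩ := hz
  obtain ⟨N, d, e, k, δ'', -, -, hk, -⟩ := T.et4_op h h'
  exact ⟨N, k, δ'', hk⟩

lemma Infl.comp {B D N : C} {y : B ⟶ D} {z : D ⟶ N} (hy : T.Infl y) (hz : T.Infl z) :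
    T.Infl (y ≫ z) := by
  obtain ⟨A, x, δ, h⟩ := hy
  obtain ⟨A', x', δ', h'⟩ := hz
  obtain ⟨N, d, e, k, δ'', -, -, hk, -⟩ := T.et4 h h'
  exact ⟨N, k, δ'', hk⟩

lemma conf_of_iso_left {A B O : C} (hO : IsZero O) (e : A ≅ B) :
    T.conf e.hom (0 : B ⟶ O) := by
  let e' : A ⊞ O ≅ A :=
    { hom := biprod.fst
      inv := biprod.inl
      hom_inv_id := by ext <;> simp [hO.eq_of_src _ (0 : O ⟶ O)]
      inv_hom_id := by simp }
  refine ⟨0, ?_⟩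
  have := Realizes.of_iso (T.realizes_zero A O) (e' ≪≫ e)
  convert this using 1
  · simp [e']
  · exact hO.eq_of_tgt _ _

lemma conf_of_iso_right {A B O : C} (hO : IsZero O) (e : A ≅ B) :
    T.conf (0 : O ⟶ A) e.hom := by
  let e' : O ⊞ B ≅ B :=
    { hom := biprod.snd
      inv := biprod.inr
      hom_inv_id := by ext <;> simp [hO.eq_of_src _ (0 : O ⟶ O)]
      inv_hom_id := by simp }
  refine ⟨0, ?_⟩
  have := Realizes.of_iso (T.realizes_zero O B) (e' ≪≫ e.symm)
  convert this using 1
  · exact hO.eq_of_src _ _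
  · simp [e']

lemma Defl.of_iso {A B : C} (e : A ≅ B) : T.Defl e.hom :=
  ⟨_, _, conf_of_iso_right (isZero_zero C) e⟩

lemma conf_biprod_map {A B D A' B' D' : C} {x : A ⟶ B} {y : B ⟶ D} {x' : A' ⟶ B'} {y' : B' ⟶ D'}
    (h : T.conf x y) (h' : T.conf x' y') : T.conf (biprod.map x x') (biprod.map y y') := by
  obtain ⟨δ, h⟩ := h
  obtain ⟨δ', h'⟩ := h'
  exact ⟨_, T.realizes_sum h h'⟩

/-- A deflation stays a deflation if further components are added: up to an automorphism of
`M ⊞ N`, the morphism `(f p)` is `𝟙 ⊞ p` followed by a projection. -/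
lemma Defl.desc {M P N : C} (f : M ⟶ N) {p : P ⟶ N} (hp : T.Defl p) :
    T.Defl (biprod.desc f p) := by
  let e : M ⊞ N ≅ M ⊞ N :=
    { hom := biprod.lift biprod.fst (biprod.fst ≫ f + biprod.snd)
      inv := biprod.lift biprod.fst (biprod.snd - biprod.fst ≫ f)
      hom_inv_id := by ext <;> simp
      inv_hom_id := by ext <;> simp }
  obtain ⟨K, x, hx⟩ := hp
  have h₁ : T.Defl (biprod.map (𝟙 M) p) :=
    ⟨_, _, conf_biprod_map (conf_of_iso_right (isZero_zero C) (Iso.refl M)) hx⟩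
  have h₂ := (h₁.comp (Defl.of_iso e)).comp ⟨_, _, _, T.realizes_zero M N⟩
  convert h₂ using 1
  ext <;> simp [e]

/-- A split epimorphism with a deflation among its components is the deflation of a split
`𝔼`-triangle. -/
lemma Defl.exists_realizes_zero {B D : C} {y : B ⟶ D} (hy : T.Defl y) (s : D ⟶ B)
    (hs : s ≫ y = 𝟙 D) : ∃ (A : C) (x : A ⟶ B), T.Realizes x y (0 : Extn T.E D A) := by
  obtain ⟨A, x, δ, h⟩ := hy
  obtain rfl := Realizes.eq_zero_of_section h s hs
  exact ⟨A, x, h⟩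

end Extriangulation

end Extriangulated

/-! ### Classes of objects closed under sums and summands -/

section General

variable {A : Type u'} [Category.{v'} A]

lemma le_free [Preadditive A] (D : ObjectProperty A) : D ≤ free D := fun M hM =>
  ⟨1, fun _ => M,
    { pt := M
      π := fun _ => 𝟙 M
      ι := fun _ => 𝟙 M
      ι_π := fun i j => by simp [Subsingleton.elim i j] },
    fun _ => hM, ⟨isBilimitOfTotal _ (by simp)⟩, ⟨Iso.refl M⟩⟩

lemma le_smd [Preadditive A] [HasZeroObject A] (D : ObjectProperty A) : D ≤ smd D := fun M hM => by
  obtain ⟨O, hO⟩ := HasZeroObject.zero (C := A)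
  refine ⟨O, ⟨M, 𝟙 M, 0, 𝟙 M, 0, by simp, by simp, by simp, hO.eq_of_src _ _⟩,
    ⟨isBinaryBilimitOfTotal _ ?_⟩, hM⟩
  simp

lemma free_le_of_isAddClosed [Preadditive A] [HasZeroObject A] (D : ObjectProperty A)
    [IsAddClosed D] : free D ≤ D := fun M hM => by
  rw [IsAddClosed.eq_add (D := D)]
  exact le_smd _ _ hM

lemma smd_le_of_isAddClosed [Preadditive A] (D : ObjectProperty A)
    [IsAddClosed D] : smd D ≤ D := fun M ⟨M', b, hb, h⟩ => by
  rw [IsAddClosed.eq_add (D := D)]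
  exact ⟨M', b, hb, le_free _ _ h⟩

lemma prop_zero_of_isAddClosed [Preadditive A] [HasZeroObject A] (D : ObjectProperty A)
    [IsAddClosed D] {O : A} (hO : IsZero O) : D O :=
  free_le_of_isAddClosed _ _ ⟨0, Fin.elim0,
    { pt := O
      π := fun i => i.elim0
      ι := fun i => i.elim0
      ι_π := fun i => i.elim0 },
    fun i => i.elim0, ⟨isBilimitOfTotal _ (hO.eq_of_src _ _)⟩, ⟨Iso.refl O⟩⟩

lemma prop_biprod_of_isAddClosed [Preadditive A] [HasZeroObject A] [HasBinaryBiproducts A]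
    (D : ObjectProperty A) [IsAddClosed D] {M N : A} (hM : D M) (hN : D N) : D (M ⊞ N) := by
  have : HasFiniteProducts A := hasFiniteProducts_of_has_binary_and_terminal
  have : HasFiniteBiproducts A := HasFiniteBiproducts.of_hasFiniteProducts
  let f : Fin 2 → A := ![M, N]
  have hf : ∀ i, D (f i) := by
    intro i
    fin_cases i
    · exact hM
    · exact hN
  let π₀ : ⨁ f ⟶ M := biproduct.π f 0
  let π₁ : ⨁ f ⟶ N := biproduct.π f 1
  let ι₀ : M ⟶ ⨁ f := biproduct.ι f 0
  let ι₁ : N ⟶ ⨁ f := biproduct.ι f 1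
  have h₀₀ : ι₀ ≫ π₀ = 𝟙 M := biproduct.ι_π_self f 0
  have h₁₁ : ι₁ ≫ π₁ = 𝟙 N := biproduct.ι_π_self f 1
  have h₀₁ : ι₀ ≫ π₁ = 0 := biproduct.ι_π_ne f (by decide)
  have h₁₀ : ι₁ ≫ π₀ = 0 := biproduct.ι_π_ne f (by decide)
  have ht : π₀ ≫ ι₀ + π₁ ≫ ι₁ = 𝟙 (⨁ f) := by
    rw [← biproduct.total, Fin.sum_univ_two]
    rfl
  refine free_le_of_isAddClosed _ _ ⟨2, f, biproduct.bicone f, hf, ⟨biproduct.isBilimit f⟩, ⟨?_⟩⟩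
  exact
    { hom := biprod.lift π₀ π₁
      inv := biprod.desc ι₀ ι₁
      hom_inv_id := by rw [biprod.lift_desc]; exact ht
      inv_hom_id := by ext <;> simp [h₀₀, h₁₁, h₀₁, h₁₀] }

end General

/-! ### Closure properties of the classes `X_k^∨` -/

namespace Extriangulation

variable {C : Type u} [Category.{v} C] [Preadditive C] [HasZeroObject C] [HasBinaryBiproducts C]
  {T : Extriangulation C}

lemma EnoughProj.exists_defl (hproj : T.EnoughProj) (L : C) :
    ∃ (P : C) (p : P ⟶ L), T.IsProj P ∧ T.Defl p := by
  obtain ⟨M, P, x, y, h, hP⟩ := hproj L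
  exact ⟨P, y, hP, M, x, h⟩

/-- The first term of a split `𝔼`-triangle is a direct summand of the second. -/
lemma Realizes.smd_left {A B D : C} {x : A ⟶ B} {y : B ⟶ D}
    (h : T.Realizes x y (0 : Extn T.E D A)) {Y : ObjectProperty C} (hB : Y B) : smd Y A := by
  obtain ⟨s, r, h₁, h₂, h₃, h'⟩ := Realizes.exists_splitting h
  exact ⟨D, ⟨B, r, y, x, s, h₁, Realizes.comp_eq_zero h, Realizes.comp_eq_zero h', h₂⟩,
    ⟨isBinaryBilimitOfTotal _ h₃⟩, hB⟩

/-- A retract becomes a direct summand after adding a projective object. -/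
lemma EnoughProj.exists_realizes_zero_of_retract (hproj : T.EnoughProj) {M N : C} (s : M ⟶ N)
    (r : N ⟶ M) (h : s ≫ r = 𝟙 M) : ∃ (P K : C) (x : M ⟶ N ⊞ P) (y : N ⊞ P ⟶ K), T.IsProj P ∧
      T.Realizes x y (0 : Extn T.E K M) := by
  obtain ⟨P, p, hP, hp⟩ := hproj.exists_defl M
  obtain ⟨K, x, hx⟩ := (hp.desc r).exists_realizes_zero (s ≫ biprod.inl) (by simp [h])
  obtain ⟨s', r', -, -, -, h'⟩ := Realizes.exists_splitting hx
  exact ⟨P, K, s', r', hP, h'⟩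

lemma le_cores (X : ObjectProperty C) (k : ℕ) : X ≤ T.cores X k := fun M hM =>
  ⟨0, k.zero_le, M, hM, ⟨Iso.refl M⟩⟩

/-- Dimension shifting: `𝔼(X_n^∨, X) = 0`. -/
lemma extn_eq_zero {H : T.HigherExtensions} {n : ℕ} {X : ObjectProperty C} (hX : IsRigid H n X)
    {Z Y : C} (hZ : T.cores X n Z) (hY : X Y) (ε : Extn T.E Z Y) : ε = 0 := by
  obtain ⟨m, hm, hZ⟩ := hZ
  exact ext_coresolution_eq_zero H hX m 0 (by omega) Z Y hZ hY ε

section Closure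

variable (X : ObjectProperty C) [IsAddClosed X]

variable {X} in
lemma prop_of_retract (hproj : T.EnoughProj) (hPX : T.IsProj ≤ X) {M N : C} (s : M ⟶ N)
    (r : N ⟶ M) (h : s ≫ r = 𝟙 M) (hN : X N) : X M := by
  obtain ⟨P, K, x, y, hP, hx⟩ := hproj.exists_realizes_zero_of_retract s r h
  exact smd_le_of_isAddClosed X _
    (Realizes.smd_left hx (prop_biprod_of_isAddClosed X hN (hPX _ hP)))

/-- Coresolutions can be prolonged by zero. -/
lemma hasCoresolution_succ {m : ℕ} {M : C} (hM : HasCoresolution T.conf X m M) :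
    HasCoresolution T.conf X (m + 1) M := by
  induction m generalizing M with
  | zero =>
    obtain ⟨Y, hY, ⟨e⟩⟩ := hM
    obtain ⟨O, hO⟩ := HasZeroObject.zero (C := C)
    exact ⟨Y, O, e.hom, 0, conf_of_iso_left hO e, hY, O, prop_zero_of_isAddClosed X hO,
      ⟨Iso.refl O⟩⟩
  | succ m ih =>
    obtain ⟨Y, Z, i, p, h, hY, hZ⟩ := hM
    exact ⟨Y, Z, i, p, h, hY, ih hZ⟩

lemma cores_iff (k : ℕ) (M : C) : T.cores X k M ↔ HasCoresolution T.conf X k M := by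
  refine ⟨?_, fun h => ⟨k, le_rfl, h⟩⟩
  rintro ⟨m, hm, h⟩
  induction hm with
  | refl => exact h
  | step _ ih => exact hasCoresolution_succ X ih

lemma hasCoresolution_biprod {m : ℕ} {M N : C} (hM : HasCoresolution T.conf X m M)
    (hN : HasCoresolution T.conf X m N) : HasCoresolution T.conf X m (M ⊞ N) := by
  induction m generalizing M N with
  | zero =>
    obtain ⟨Y, hY, ⟨e⟩⟩ := hM
    obtain ⟨Y', hY', ⟨e'⟩⟩ := hN
    exact ⟨Y ⊞ Y', prop_biprod_of_isAddClosed X hY hY', ⟨biprod.mapIso e e'⟩⟩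
  | succ m ih =>
    obtain ⟨Y, Z, i, p, h, hY, hZ⟩ := hM
    obtain ⟨Y', Z', i', p', h', hY', hZ'⟩ := hN
    exact ⟨_, _, _, _, conf_biprod_map h h', prop_biprod_of_isAddClosed X hY hY', ih hZ hZ'⟩

lemma cores_biprod (k : ℕ) {M N : C} (hM : T.cores X k M) (hN : T.cores X k N) :
    T.cores X k (M ⊞ N) := by
  rw [cores_iff] at *
  exact hasCoresolution_biprod X hM hN

/-- `X_k^∨` is closed under retracts for `k ≤ n + 1`. Let `M` be a retract of `N` and let
`N ⟶ Y ⟶ Z` start a coresolution. After adding a projective object to `N`, there is a conflation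
with inflation `M ⟶ N`, so that the composite `M ⟶ N ⟶ Y` is an inflation. By rigidity its cone
is a retract of `Z ⊞ Y`. -/
lemma hasCoresolution_of_retract (hproj : T.EnoughProj) (hPX : T.IsProj ≤ X)
    {H : T.HigherExtensions} {n : ℕ} (hX : IsRigid H n X) {k : ℕ} (hk : k ≤ n + 1) {M N : C}
    (s : M ⟶ N) (r : N ⟶ M) (h : s ≫ r = 𝟙 M) (hN : HasCoresolution T.conf X k N) :
    HasCoresolution T.conf X k M := by
  induction k generalizing M N with
  | zero =>
    obtain ⟨Y, hY, ⟨e⟩⟩ := hN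
    exact ⟨M, prop_of_retract hproj hPX (s ≫ e.hom) (e.inv ≫ r) (by simp [h]) hY, ⟨Iso.refl M⟩⟩
  | succ k ih =>
    obtain ⟨P, K, s', y, hP, hs'⟩ := hproj.exists_realizes_zero_of_retract s r h
    have hPk : HasCoresolution T.conf X (k + 1) P := (cores_iff X _ P).1 (le_cores X _ _ (hPX _ hP))
    obtain ⟨Y, Z, i, p, ⟨δ, hδ⟩, hY, hZ⟩ := hasCoresolution_biprod X hN hPk
    obtain ⟨-, r', hr', -⟩ := Realizes.exists_splitting hs'
    -- the composite inflation `M ⟶ N ⊞ P ⟶ Y`, with cone `Z₁`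
    obtain ⟨Z₁, y₁, δ₁, h₁⟩ := Infl.comp ⟨_, _, _, hs'⟩ ⟨_, _, _, hδ⟩
    obtain ⟨c, hc, -⟩ := T.et3 h₁ hδ s' (𝟙 Y) (by simp)
    -- the retraction induces `c'` on cones, because `𝔼(Z, Y) = 0`
    obtain ⟨c', hc'⟩ := Realizes.exists_pull_eq h₁ (push T.E r' δ)
      (extn_eq_zero hX ⟨k, by omega, hZ⟩ hY _)
    -- `𝟙 - c ≫ c'` kills the extension of `Z₁`, hence factors through `Y`
    obtain ⟨t, ht⟩ := (Realizes.lift_iff h₁ (𝟙 Z₁ - c ≫ c')).2 (by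
      rw [T.sub_pull, pull_id, pull_comp, hc', ← push_pull, ← hc, ← push_comp, hr', push_id,
        sub_self])
    have hZY : HasCoresolution T.conf X k (Z ⊞ Y) :=
      hasCoresolution_biprod X hZ ((cores_iff X _ Y).1 (le_cores X _ _ hY))
    exact ⟨Y, Z₁, s' ≫ i, y₁, ⟨δ₁, h₁⟩, hY, ih (by omega) (biprod.lift c t) (biprod.desc c' y₁)
      (by rw [biprod.lift_desc, ht]; abel) hZY⟩

lemma cores_of_retract (hproj : T.EnoughProj) (hPX : T.IsProj ≤ X)
    {H : T.HigherExtensions} {n : ℕ} (hX : IsRigid H n X) {k : ℕ} (hk : k ≤ n + 1) {M N : C}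
    (s : M ⟶ N) (r : N ⟶ M) (h : s ≫ r = 𝟙 M) (hN : T.cores X k N) : T.cores X k M := by
  rw [cores_iff] at *
  exact hasCoresolution_of_retract X hproj hPX hX hk s r h hN

/-- An object of `X_{n+1}^∨` has an inflation into an object of `X` with cone in `X_n^∨`. -/
lemma cores_succ_exists {n : ℕ} {M : C} (hM : T.cores X (n + 1) M) :
    ∃ (Y Z : C) (i : M ⟶ Y) (p : Y ⟶ Z) (δ : Extn T.E Z M), T.Realizes i p δ ∧ X Y ∧
      T.cores X n Z := by
  obtain ⟨Y, Z, i, p, ⟨δ, h⟩, hY, hZ⟩ := (cores_iff X _ _).1 hM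
  exact ⟨Y, Z, i, p, δ, h, hY, (cores_iff X _ _).2 hZ⟩

lemma cores_succ_of_realizes {n : ℕ} {M Y Z : C} {i : M ⟶ Y} {p : Y ⟶ Z} {δ : Extn T.E Z M}
    (h : T.Realizes i p δ) (hY : X Y) (hZ : T.cores X n Z) : T.cores X (n + 1) M := by
  rw [cores_iff] at *
  exact ⟨Y, Z, i, p, ⟨δ, h⟩, hY, hZ⟩

end Closure

end Extriangulation

/-! ### Presentations of modules -/

section FunctorExact

variable {K : Type u} [Category.{v} K]

lemma functor_exact_iff (S : ShortComplex (K ⥤ AddCommGrpCat.{v})) :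
    S.Exact ↔ ∀ (k : K) (x : S.X₂.obj k), S.g.app k x = 0 → ∃ y : S.X₁.obj k, S.f.app k y = x := by
  have h : S.Exact ↔ ∀ k : K, (S.map ((evaluation K AddCommGrpCat.{v}).obj k)).Exact := by
    constructor
    · intro h k
      exact h.map _
    · intro h
      rw [ShortComplex.exact_iff_isZero_homology, Functor.isZero_iff]
      intro k
      exact ((ShortComplex.exact_iff_isZero_homology _).1 (h k)).of_iso
        (S.mapHomologyIso ((evaluation K AddCommGrpCat.{v}).obj k)).symm
  rw [h]
  refine forall_congr' fun k => ?_
  rw [ShortComplex.ab_exact_iff]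
  rfl

lemma functor_mono_iff {F G : K ⥤ AddCommGrpCat.{v}} (f : F ⟶ G) :
    Mono f ↔ ∀ (k : K) (x : F.obj k), f.app k x = 0 → x = 0 := by
  rw [NatTrans.mono_iff_mono_app]
  refine forall_congr' fun k => ?_
  rw [AddCommGrpCat.mono_iff_injective]
  exact injective_iff_map_eq_zero (f.app k).hom

lemma functor_epi_iff {F G : K ⥤ AddCommGrpCat.{v}} (f : F ⟶ G) :
    Epi f ↔ ∀ (k : K) (x : G.obj k), ∃ y : F.obj k, f.app k y = x := by
  rw [NatTrans.epi_iff_epi_app]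
  refine forall_congr' fun k => ?_
  rw [AddCommGrpCat.epi_iff_surjective]
  rfl

end FunctorExact

section Elements

variable {A : Type u} [Category.{v} A] (G : Aᵒᵖ ⥤ AddCommGrpCat.{v}) {Z W V : A}

lemma elt_map_id (t : G.obj (op Z)) : G.map (𝟙 Z).op t = t := by simp

lemma elt_map_comp (h : Z ⟶ W) (k : W ⟶ V) (t : G.obj (op V)) :
    G.map (h ≫ k).op t = G.map h.op (G.map k.op t) := by simp

variable {G} in
lemma elt_naturality {G' : Aᵒᵖ ⥤ AddCommGrpCat.{v}} (φ : G ⟶ G') (h : Z ⟶ W)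
    (t : G.obj (op W)) : φ.app (op Z) (G.map h.op t) = G'.map h.op (φ.app (op W) t) :=
  congrArg (fun t' => t'.hom t) (φ.naturality h.op)

end Elements

section Presentation

variable {A : Type u} [Category.{v} A] [Preadditive A]

/-- `G` is generated by the element `x` of `G(X₁)` and the relations are generated by `f`; this is
the elementwise form of an exact sequence `Hom(-, X₀) ⟶ Hom(-, X₁) ⟶ G ⟶ 0`. -/
structure IsPresentation {X₀ X₁ : A} (f : X₀ ⟶ X₁) (G : Aᵒᵖ ⥤ AddCommGrpCat.{v})
    (x : G.obj (op X₁)) : Prop where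
  generates : ∀ (Z : A) (y : G.obj (op Z)), ∃ h : Z ⟶ X₁, G.map h.op x = y
  relations : ∀ (Z : A) (h : Z ⟶ X₁), G.map h.op x = 0 ↔ ∃ k : Z ⟶ X₀, k ≫ f = h

section Elements

variable (G : Aᵒᵖ ⥤ AddCommGrpCat.{v}) {Z W V : A}

lemma elt_map_add [G.Additive] (h k : Z ⟶ W) (t : G.obj (op W)) :
    G.map (h + k).op t = G.map h.op t + G.map k.op t := by
  rw [op_add, Functor.map_add]
  rfl

lemma elt_map_zero [G.Additive] (t : G.obj (op W)) : G.map (0 : Z ⟶ W).op t = 0 := by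
  rw [op_zero, Functor.map_zero]
  rfl

end Elements

/-- The Yoneda lemma: the natural transformation determined by an element of an additive functor. -/
def yonedaElt (G : Aᵒᵖ ⥤ AddCommGrpCat.{v}) [G.Additive] {Y : A} (x : G.obj (op Y)) :
    preadditiveYoneda.obj Y ⟶ G where
  app Z := AddCommGrpCat.ofHom
    { toFun := fun h : Z.unop ⟶ Y => G.map h.op x
      map_zero' := elt_map_zero G x
      map_add' := fun h h' => elt_map_add G h h' x }
  naturality Z W g := by
    ext (h : Z.unop ⟶ Y)
    change G.map (g.unop ≫ h).op x = G.map g (G.map h.op x)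
    simp

/-- The Yoneda lemma: a natural transformation is determined by its value at the identity. -/
lemma app_eq_map_app_id (G : Aᵒᵖ ⥤ AddCommGrpCat.{v}) {Y Z : A} (β : preadditiveYoneda.obj Y ⟶ G)
    (h : Z ⟶ Y) : β.app (op Z) h = G.map h.op (β.app (op Y) (𝟙 Y : Y ⟶ Y)) := by
  have := congrArg (fun t => t.hom (𝟙 Y : Y ⟶ Y)) (β.naturality h.op)
  refine Eq.trans ?_ this
  change β.app (op Z) h = β.app (op Z) (h ≫ 𝟙 Y)
  rw [Category.comp_id]

lemma IsPresentation.exact {X₀ X₁ : A} {f : X₀ ⟶ X₁} {G : Aᵒᵖ ⥤ AddCommGrpCat.{v}} [G.Additive]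
    {x : G.obj (op X₁)} (h : IsPresentation f G x) :
    ∃ w : preadditiveYoneda.map f ≫ yonedaElt G x = 0,
      (ShortComplex.mk _ _ w).Exact ∧ Epi (yonedaElt G x) := by
  refine ⟨?_, ?_, ?_⟩
  · ext Z (k : Z.unop ⟶ X₀)
    exact (h.relations _ (k ≫ f)).2 ⟨k, rfl⟩
  · rw [functor_exact_iff]
    intro Z (g : Z.unop ⟶ X₁) hg
    exact (h.relations _ g).1 hg
  · rw [functor_epi_iff]
    intro Z y
    exact h.generates _ y

lemma isPresentation_of_exact {X₀ X₁ : A} {G : Aᵒᵖ ⥤ AddCommGrpCat.{v}}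
    (α : preadditiveYoneda.obj X₀ ⟶ preadditiveYoneda.obj X₁) (β : preadditiveYoneda.obj X₁ ⟶ G)
    (w : α ≫ β = 0) (h : (ShortComplex.mk α β w).Exact) (hβ : Epi β) :
    IsPresentation (preadditiveYoneda.preimage α) G (β.app (op X₁) (𝟙 X₁ : X₁ ⟶ X₁)) := by
  obtain ⟨f, rfl⟩ := preadditiveYoneda.map_surjective α
  rw [Functor.preimage_map]
  rw [functor_exact_iff] at h
  rw [functor_epi_iff] at hβ
  constructor
  · intro Z y
    obtain ⟨g, hg⟩ := hβ (op Z) y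
    exact ⟨g, by rw [← hg]; exact (app_eq_map_app_id G β g).symm⟩
  · intro Z g
    rw [← app_eq_map_app_id G β g]
    constructor
    · exact h (op Z) g
    · rintro ⟨k, rfl⟩
      exact congrArg (fun t => (t.app (op Z)).hom k) w

/-- Functors with the same presentation are isomorphic. -/
lemma IsPresentation.nonempty_iso {X₀ X₁ Y₀ : A} {f : X₀ ⟶ X₁} {f' : Y₀ ⟶ X₁}
    {G G' : Aᵒᵖ ⥤ AddCommGrpCat.{v}} [G.Additive] [G'.Additive]
    {x : G.obj (op X₁)} {x' : G'.obj (op X₁)} (h : IsPresentation f G x)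
    (h' : IsPresentation f' G' x')
    (hf : ∀ (Z : A) (g : Z ⟶ X₁), (∃ k, k ≫ f = g) ↔ ∃ k, k ≫ f' = g) : Nonempty (G ≅ G') := by
  have h'' : IsPresentation f G' x' :=
    ⟨h'.generates, fun Z g => (h'.relations Z g).trans (hf Z g).symm⟩
  obtain ⟨w, he, hepi⟩ := h.exact
  obtain ⟨w', he', hepi'⟩ := h''.exact
  exact ⟨IsColimit.coconePointUniqueUpToIso he.gIsCokernel he'.gIsCokernel⟩

/-- The horseshoe lemma. The sums of generators and of relations are presented as biproducts. -/
lemma IsPresentation.horseshoe [HasBinaryBiproducts A]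
    {S : ShortComplex (Aᵒᵖ ⥤ AddCommGrpCat.{v})} (hS : S.ShortExact) [S.X₁.Additive] [S.X₂.Additive]
    {X₀ X₁ Y₀ Y₁ : A} {f : X₀ ⟶ X₁} {g : Y₀ ⟶ Y₁}
    {x : S.X₁.obj (op X₁)} {y : S.X₃.obj (op Y₁)} (hf : IsPresentation f S.X₁ x)
    (hg : IsPresentation g S.X₃ y) :
    ∃ (e : X₀ ⊞ Y₀ ⟶ X₁ ⊞ Y₁) (z : S.X₂.obj (op (X₁ ⊞ Y₁))), IsPresentation e S.X₂ z := by
  have he := (functor_exact_iff S).1 hS.exact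
  have hm := (functor_mono_iff S.f).1 hS.mono_f
  have hp := (functor_epi_iff S.g).1 hS.epi_g
  have hz (Z : A) (t : S.X₁.obj (op Z)) : S.g.app (op Z) (S.f.app (op Z) t) = 0 :=
    congrArg (fun t' => (t'.app (op Z)).hom t) S.zero
  obtain ⟨y', hy'⟩ := hp (op Y₁) y
  -- a relation among the lifted generator and the generator of the subfunctor
  obtain ⟨t, ht⟩ := he (op Y₀) (S.X₂.map g.op y') (by
    rw [elt_naturality, hy']; exact (hg.relations _ g).2 ⟨𝟙 _, Category.id_comp g⟩)
  obtain ⟨u, hu⟩ := hf.generates _ t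
  have hrel : S.X₂.map g.op y' = S.f.app _ (S.X₁.map u.op x) := by rw [hu, ht]
  let z : S.X₂.obj (op (X₁ ⊞ Y₁)) := S.X₂.map (biprod.fst : X₁ ⊞ Y₁ ⟶ X₁).op (S.f.app _ x) +
      S.X₂.map (biprod.snd : X₁ ⊞ Y₁ ⟶ Y₁).op y'
  have hz' {Z : A} (h : Z ⟶ X₁ ⊞ Y₁) : S.X₂.map h.op z =
      S.f.app _ (S.X₁.map (h ≫ biprod.fst).op x) + S.X₂.map (h ≫ biprod.snd).op y' := by
    rw [map_add, ← elt_map_comp, ← elt_map_comp, elt_naturality]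
  refine ⟨biprod.lift (biprod.fst ≫ f - biprod.snd ≫ u) (biprod.snd ≫ g), z, ?_, ?_⟩
  · intro Z s
    obtain ⟨b, hb⟩ := hg.generates _ (S.g.app _ s)
    obtain ⟨s', hs'⟩ := he (op Z) (s - S.X₂.map b.op y') (by
      rw [map_sub, elt_naturality, hy', hb, sub_self])
    obtain ⟨a, ha⟩ := hf.generates _ s'
    exact ⟨biprod.lift a b, by
      rw [hz', biprod.lift_fst, biprod.lift_snd, ha, hs', sub_add_cancel]⟩
  · intro Z h
    rw [hz']
    constructor
    · intro h0
      have h1 : S.X₃.map (h ≫ biprod.snd).op y = 0 := by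
        have := congrArg (fun s => S.g.app (op Z) s) h0
        rwa [map_add, hz, zero_add, elt_naturality, hy', map_zero] at this
      obtain ⟨k, hk⟩ := (hg.relations _ _).1 h1
      rw [← hk, elt_map_comp S.X₂ k g, hrel, ← elt_naturality, ← map_add] at h0
      have h2 := hm _ _ h0
      rw [← elt_map_comp, ← elt_map_add] at h2
      obtain ⟨k', hk'⟩ := (hf.relations _ _).1 h2
      refine ⟨biprod.lift k' k, ?_⟩
      ext
      · simp [hk']
      · simp [hk]
    · rintro ⟨k, rfl⟩
      simp only [Category.assoc, biprod.lift_fst, biprod.lift_snd, Preadditive.comp_sub]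
      rw [← Category.assoc k _ g, elt_map_comp S.X₂ _ g, hrel, ← elt_naturality, ← map_add,
        ← elt_map_comp, ← elt_map_add, Category.assoc k _ u, sub_add_cancel,
        (hf.relations _ _).2 ⟨k ≫ biprod.fst, Category.assoc _ _ _⟩, map_zero]

/-- An extension of additive functors is additive. On a biproduct, let `e₁`, `e₂` be the two
idempotents and `d = 1 - G(e₁) - G(e₂)`. Then `d` maps the middle functor into the additive
subfunctor, on which it vanishes, so `d` has square zero; but `d` is idempotent. -/
lemma additive_of_shortExact [HasZeroObject A] [HasBinaryBiproducts A]
    {S : ShortComplex (Aᵒᵖ ⥤ AddCommGrpCat.{v})}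
    (hS : S.ShortExact) (h₁ : S.X₁.Additive) (h₃ : S.X₃.Additive) : S.X₂.Additive := by
  have he := (functor_exact_iff S).1 hS.exact
  have hz (Z : A) (t : S.X₁.obj (op Z)) : S.g.app (op Z) (S.f.app (op Z) t) = 0 :=
    congrArg (fun t' => (t'.app (op Z)).hom t) S.zero
  have hzero : ∀ (Z W : A) (t : S.X₂.obj (op W)), S.X₂.map (0 : Z ⟶ W).op t = 0 := by
    intro Z W t
    obtain ⟨O, hO⟩ := HasZeroObject.zero (C := A)
    obtain ⟨s, hs⟩ := he (op O) (S.X₂.map (0 : O ⟶ W).op t) (by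
      rw [elt_naturality, elt_map_zero])
    have hs0 : s = 0 := by
      rw [← elt_map_id S.X₁ s, ← hO.eq_of_src (0 : O ⟶ O) (𝟙 O), elt_map_zero]
    have h0 : (0 : Z ⟶ W) = (0 : Z ⟶ O) ≫ (0 : O ⟶ W) := by simp
    rw [h0, elt_map_comp, ← hs, hs0, map_zero, map_zero]
  have hid : ∀ (Z W : A) (t : S.X₂.obj (op (Z ⊞ W))),
      t = S.X₂.map (biprod.fst ≫ biprod.inl : Z ⊞ W ⟶ Z ⊞ W).op t +
        S.X₂.map (biprod.snd ≫ biprod.inr : Z ⊞ W ⟶ Z ⊞ W).op t := by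
    intro Z W t
    obtain ⟨s, hs⟩ := he (op (Z ⊞ W)) (t - (S.X₂.map (biprod.fst ≫ biprod.inl).op t +
        S.X₂.map (biprod.snd ≫ biprod.inr).op t)) (by
      rw [map_sub, map_add, elt_naturality, elt_naturality, ← elt_map_add, biprod.total,
        elt_map_id, sub_self])
    have hs' : s = S.X₁.map (biprod.fst ≫ biprod.inl : Z ⊞ W ⟶ Z ⊞ W).op s +
        S.X₁.map (biprod.snd ≫ biprod.inr : Z ⊞ W ⟶ Z ⊞ W).op s := by
      rw [← elt_map_add, biprod.total, elt_map_id]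
    rw [← sub_eq_zero, ← hs, hs', map_add, elt_naturality, elt_naturality, hs]
    simp only [map_sub, map_add, ← elt_map_comp, Category.assoc, biprod.inl_fst_assoc,
      biprod.inr_snd_assoc, biprod.inl_snd_assoc, biprod.inr_fst_assoc, zero_comp, comp_zero,
      hzero]
    abel
  constructor
  intro Z W f g
  ext t
  change S.X₂.map (f.unop + g.unop).op t = S.X₂.map f.unop.op t + S.X₂.map g.unop.op t
  have h := hid _ _ (S.X₂.map (biprod.desc (𝟙 Z.unop) (𝟙 Z.unop)).op t)
  have h' := congrArg (fun s => S.X₂.map (biprod.lift f.unop g.unop).op s) h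
  simp only [map_add, ← elt_map_comp] at h'
  simpa using h'

end Presentation

/-! ### Biproducts in quotient categories -/

section Additive

variable {A : Type u} [Category.{v} A] [Preadditive A] {B : Type u'} [Category.{v'} B]
  [Preadditive B] (F : A ⥤ B) [F.Additive]

lemma hasBinaryBiproducts_of_surjective [HasBinaryBiproducts A] (hF : Function.Surjective F.obj) :
    HasBinaryBiproducts B where
  has_binary_biproduct M N := by
    obtain ⟨M, rfl⟩ := hF M
    obtain ⟨N, rfl⟩ := hF N
    have := preservesBinaryBiproducts_of_preservesBiproducts F
    exact HasBinaryBiproduct.mk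
      ⟨_, isBinaryBilimitOfPreserves F (BinaryBiproduct.isBilimit M N)⟩

lemma hasZeroObject_of_additive {A : Type u} [Category.{v} A] [Preadditive A] {B : Type u'}
    [Category.{v'} B] [Preadditive B] (F : A ⥤ B) [F.Additive] [HasZeroObject A] :
    HasZeroObject B := by
  obtain ⟨O, hO⟩ := HasZeroObject.zero (C := A)
  exact ⟨_, F.map_isZero hO⟩

end Additive

lemma hasFiniteBiproducts_of_binary {B : Type u'} [Category.{v'} B] [Preadditive B]
    [HasZeroObject B] [HasBinaryBiproducts B] : HasFiniteBiproducts B := by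
  have : HasFiniteProducts B := hasFiniteProducts_of_has_binary_and_terminal
  exact HasFiniteBiproducts.of_hasFiniteProducts

/-! ### The functor `𝔽` and its essential image -/

namespace Extriangulation

variable {C : Type u} [Category.{v} C] [Preadditive C] [HasZeroObject C] [HasBinaryBiproducts C]
  (T : Extriangulation C)

section Stable

variable (P : ObjectProperty C)

instance : (CategoryTheory.Quotient.functor (T.stableRel P)).Additive where
  map_add := rfl

lemma stable_map_eq_iff {P : ObjectProperty C} {M N : P.FullSubcategory} (f g : M ⟶ N) :
    (CategoryTheory.Quotient.functor (T.stableRel P)).map f =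
      (CategoryTheory.Quotient.functor (T.stableRel P)).map g ↔
      T.E.map f.hom.op = T.E.map g.hom.op := by
  rw [CategoryTheory.Quotient.functor_map_eq_iff, stableRel_iff]

instance (A : C) : ((T.stableExt P).obj A).Additive where
  map_add {M N} f g := by
    obtain ⟨f', hf⟩ := (CategoryTheory.Quotient.functor (T.stableRel P)).map_surjective f.unop
    obtain ⟨g', hg⟩ := (CategoryTheory.Quotient.functor (T.stableRel P)).map_surjective g.unop
    obtain rfl : f = ((CategoryTheory.Quotient.functor (T.stableRel P)).map f').op := by
      rw [hf]; rfl
    obtain rfl : g = ((CategoryTheory.Quotient.functor (T.stableRel P)).map g').op := by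
      rw [hg]; rfl
    ext δ
    exact T.add_pull f'.hom g'.hom δ

end Stable

variable {T} {H : T.HigherExtensions} {n : ℕ} {X : ObjectProperty C}

section

variable [IsAddClosed X]

/-- The full subcategory `X_k^∨` has biproducts. -/
instance (k : ℕ) : HasBinaryBiproducts (T.cores X k).FullSubcategory where
  has_binary_biproduct M N := HasBinaryBiproduct.mk
    { bicone :=
        { pt := ⟨M.obj ⊞ N.obj, cores_biprod X k M.property N.property⟩
          fst := ObjectProperty.homMk biprod.fst
          snd := ObjectProperty.homMk biprod.snd
          inl := ObjectProperty.homMk biprod.inl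
          inr := ObjectProperty.homMk biprod.inr
          inl_fst := ObjectProperty.hom_ext _ biprod.inl_fst
          inl_snd := ObjectProperty.hom_ext _ biprod.inl_snd
          inr_fst := ObjectProperty.hom_ext _ biprod.inr_fst
          inr_snd := ObjectProperty.hom_ext _ biprod.inr_snd }
      isBilimit := isBinaryBilimitOfTotal _ (ObjectProperty.hom_ext _ biprod.total) }

instance (k : ℕ) : HasZeroObject (T.cores X k).FullSubcategory := by
  obtain ⟨O, hO⟩ := HasZeroObject.zero (C := C)
  have h : T.cores X k O := le_cores X k _ (prop_zero_of_isAddClosed X hO)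
  refine ⟨⟨O, h⟩, ?_⟩
  rw [IsZero.iff_id_eq_zero]
  exact ObjectProperty.hom_ext _ (hO.eq_of_src _ _)

instance (k : ℕ) : HasBinaryBiproducts (T.Stable (T.cores X k)) :=
  hasBinaryBiproducts_of_surjective (CategoryTheory.Quotient.functor _) fun M => ⟨M.as, rfl⟩

instance (k : ℕ) : HasZeroObject (T.Stable (T.cores X k)) :=
  hasZeroObject_of_additive (CategoryTheory.Quotient.functor (T.stableRel (T.cores X k)))

end

/-- The quotient functor from `X_n^∨` to its stable category. -/
abbrev toStable (T : Extriangulation C) (X : ObjectProperty C) (n : ℕ) :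
    (T.cores X n).FullSubcategory ⥤ T.Stable (T.cores X n) :=
  CategoryTheory.Quotient.functor _

lemma IsProj.extn_eq_zero {P : C} (hP : T.IsProj P) {A : C} (ε : Extn T.E P A) : ε = 0 := by
  obtain ⟨B, x, y, h⟩ := T.exists_realizes ε
  obtain ⟨s, hs⟩ := hP x y ⟨ε, h⟩ (𝟙 P)
  exact Realizes.eq_zero_of_section h s hs

/-- A conflation `M ⟶ Y ⟶ Z` with `Y` in `X` and `Z` in `X_n^∨` gives a presentation of
`𝔼(-, M)`. -/
lemma isPresentation_of_realizes (hX : IsRigid H n X) {M : C}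
    {Y Z : (T.cores X n).FullSubcategory} {i : M ⟶ Y.obj} {p : Y ⟶ Z} {δ : Extn T.E Z.obj M}
    (h : T.Realizes i p.hom δ) (hY : X Y.obj) :
    IsPresentation ((T.toStable X n).map p) ((T.stableExt (T.cores X n)).obj M) δ := by
  constructor
  · intro W ε
    obtain ⟨c, hc⟩ := Realizes.exists_pull_eq h (Z := W.as.obj) ε
      (extn_eq_zero hX W.as.property hY _)
    exact ⟨(T.toStable X n).map (ObjectProperty.homMk c), hc⟩
  · intro W g
    obtain ⟨g, rfl⟩ := (T.toStable X n).map_surjective (X := W.as) g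
    change pull T.E g.hom δ = 0 ↔ _
    constructor
    · intro e
      obtain ⟨k, hk⟩ := (Realizes.lift_iff h _).2 e
      exact ⟨(T.toStable X n).map (ObjectProperty.homMk k),
        congrArg (T.toStable X n).map (ObjectProperty.hom_ext _ hk :
          (ObjectProperty.homMk k ≫ p : W.as ⟶ Z) = g)⟩
    · rintro ⟨k, hk⟩
      obtain ⟨k, rfl⟩ := (T.toStable X n).map_surjective (X := W.as) k
      have e : T.E.map (k.hom ≫ p.hom).op = T.E.map g.hom.op :=
        (T.stable_map_eq_iff (k ≫ p) g).1 hk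
      have : pull T.E g.hom δ = pull T.E (k.hom ≫ p.hom) δ := by
        unfold pull
        rw [e]
      rw [this]
      exact (Realizes.lift_iff h _).1 ⟨k.hom, rfl⟩

lemma classR_of_isPresentation {X₀ X₁ : T.Stable (T.cores X n)} {f : X₀ ⟶ X₁}
    {G : (T.Stable (T.cores X n))ᵒᵖ ⥤ AddCommGrpCat.{v}} [G.Additive] {x : G.obj (op X₁)}
    (h : IsPresentation f G x) (hX₀ : X X₀.as.obj) : T.classR X n G := by
  obtain ⟨w, h₁, h₂⟩ := h.exact
  exact ⟨inferInstance, X₀, X₁, _, _, w, hX₀, h₁, h₂⟩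

lemma exists_isPresentation_of_classR {G : (T.Stable (T.cores X n))ᵒᵖ ⥤ AddCommGrpCat.{v}}
    (hG : T.classR X n G) : G.Additive ∧ ∃ (X₀ X₁ : T.Stable (T.cores X n)) (f : X₀ ⟶ X₁)
      (x : G.obj (op X₁)), X X₀.as.obj ∧ IsPresentation f G x := by
  obtain ⟨h, X₀, X₁, α, β, w, hX₀, h₁, h₂⟩ := hG
  exact ⟨h, X₀, X₁, _, _, hX₀, isPresentation_of_exact α β w h₁ h₂⟩

variable [IsAddClosed X]

/-- `R_X^n` is closed under extensions, by the horseshoe lemma. -/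
lemma classR_of_shortExact
    {S : ShortComplex ((T.Stable (T.cores X n))ᵒᵖ ⥤ AddCommGrpCat.{v})} (hS : S.ShortExact)
    (h₁ : T.classR X n S.X₁) (h₃ : T.classR X n S.X₃) : T.classR X n S.X₂ := by
  obtain ⟨a₁, X₀, X₁, f, x, hX₀, hf⟩ := exists_isPresentation_of_classR h₁
  obtain ⟨a₃, Y₀, Y₁, g, y, hY₀, hg⟩ := exists_isPresentation_of_classR h₃
  have := additive_of_shortExact hS a₁ a₃
  obtain ⟨e, z, h⟩ := hf.horseshoe hS hg
  -- the biproduct of `X₀` and `Y₀` can be formed in `C`, where it lies in `X`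
  let W : T.Stable (T.cores X n) :=
    (T.toStable X n).obj ⟨X₀.as.obj ⊞ Y₀.as.obj,
      le_cores X n _ (prop_biprod_of_isAddClosed X hX₀ hY₀)⟩
  let fst : W ⟶ X₀ := (T.toStable X n).map (ObjectProperty.homMk biprod.fst)
  let snd : W ⟶ Y₀ := (T.toStable X n).map (ObjectProperty.homMk biprod.snd)
  let inl : X₀ ⟶ W := (T.toStable X n).map (ObjectProperty.homMk biprod.inl)
  let inr : Y₀ ⟶ W := (T.toStable X n).map (ObjectProperty.homMk biprod.inr)
  have h₁₁ : inl ≫ fst = 𝟙 X₀ := congrArg (T.toStable X n).map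
    (ObjectProperty.hom_ext _ biprod.inl_fst : _ = 𝟙 X₀.as)
  have h₂₂ : inr ≫ snd = 𝟙 Y₀ := congrArg (T.toStable X n).map
    (ObjectProperty.hom_ext _ biprod.inr_snd : _ = 𝟙 Y₀.as)
  have h₁₂ : inl ≫ snd = 0 := congrArg (T.toStable X n).map
    (ObjectProperty.hom_ext _ biprod.inl_snd : _ = (0 : X₀.as ⟶ Y₀.as))
  have h₂₁ : inr ≫ fst = 0 := congrArg (T.toStable X n).map
    (ObjectProperty.hom_ext _ biprod.inr_fst : _ = (0 : Y₀.as ⟶ X₀.as))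
  have hl : biprod.desc inl inr ≫ biprod.lift fst snd = 𝟙 (X₀ ⊞ Y₀) := by
    ext <;> simp [h₁₁, h₂₂, h₁₂, h₂₁]
  refine classR_of_isPresentation (f := biprod.lift fst snd ≫ e)
    ⟨h.generates, fun Z k => (h.relations Z k).trans ⟨?_, ?_⟩⟩
    (prop_biprod_of_isAddClosed X hX₀ hY₀ : X W.as.obj)
  · rintro ⟨t, rfl⟩
    exact ⟨t ≫ biprod.desc inl inr, by rw [Category.assoc, reassoc_of% hl]⟩
  · rintro ⟨t, rfl⟩
    exact ⟨t ≫ biprod.lift fst snd, Category.assoc _ _ _⟩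

lemma classR_zero : ∃ G : (T.Stable (T.cores X n))ᵒᵖ ⥤ AddCommGrpCat.{v}, IsZero G ∧
    T.classR X n G := by
  obtain ⟨O, hO⟩ := HasZeroObject.zero (C := C)
  have hXO := prop_zero_of_isAddClosed X hO
  let O' : (T.cores X n).FullSubcategory := ⟨O, le_cores X n _ hXO⟩
  have hO' : IsZero ((T.toStable X n).obj O') := (T.toStable X n).map_isZero (by
    rw [IsZero.iff_id_eq_zero]
    exact ObjectProperty.hom_ext _ (hO.eq_of_src _ _))
  refine ⟨preadditiveYoneda.obj ((T.toStable X n).obj O'), preadditiveYoneda.map_isZero hO',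
    ?_⟩
  refine classR_of_isPresentation (f := 𝟙 ((T.toStable X n).obj O'))
    (x := (0 : _ ⟶ (T.toStable X n).obj O')) ⟨fun Z y => ⟨y, hO'.eq_of_tgt _ _⟩,
      fun Z h => ⟨fun _ => ⟨h, Category.comp_id h⟩, fun _ => hO'.eq_of_tgt _ _⟩⟩ hXO

/-- `𝔽` takes values in `R_X^n`. -/
lemma classR_functorF (hX : IsRigid H n X) (M : T.QuotCores X n) :
    T.classR X n ((T.functorF hX).obj M) := by
  obtain ⟨Y, Z, i, p, δ, h, hY, hZ⟩ := cores_succ_exists X M.as.property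
  have : ((T.functorF hX).obj M).Additive :=
    inferInstanceAs ((T.stableExt (T.cores X n)).obj M.as.obj).Additive
  exact classR_of_isPresentation (X := X) (n := n)
    (isPresentation_of_realizes hX (Y := ⟨Y, le_cores X n _ hY⟩) (Z := ⟨Z, hZ⟩)
      (p := ObjectProperty.homMk p) h hY) hY

/-- A morphism `φ : 𝔼(-, M) ⟶ 𝔼(-, N)` is determined by the image `ε` of the extension `δ` of
`M ⟶ Y ⟶ Z`. Since `ε` vanishes on `Y`, it is the pushforward of `δ` along some `M ⟶ N`. -/
lemma functorF_full (hX : IsRigid H n X) : (T.functorF hX).Full where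
  map_surjective {M N} φ := by
    obtain ⟨Y, Z, i, p, δ, h, hY, hZ⟩ := cores_succ_exists X M.as.property
    let Y' : (T.cores X n).FullSubcategory := ⟨Y, le_cores X n _ hY⟩
    let Z' : (T.cores X n).FullSubcategory := ⟨Z, hZ⟩
    let p' : Y' ⟶ Z' := ObjectProperty.homMk p
    have hp := isPresentation_of_realizes hX (p := p') h hY
    obtain ⟨f, hf⟩ := Realizes.exists_push_eq h (φ.app (op ((T.toStable X n).obj Z')) δ) (by
      refine Eq.trans (elt_naturality φ ((T.toStable X n).map p') δ).symm ?_
      refine Eq.trans (congrArg (φ.app (op ((T.toStable X n).obj Y')))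
        (Realizes.pull_self h)) (map_zero _))
    refine ⟨(T.toQuot X n).map (ObjectProperty.homMk f), ?_⟩
    ext W (ε : Extn T.E W.unop.as.obj M.as.obj)
    obtain ⟨c, rfl⟩ := hp.generates W.unop ε
    refine Eq.trans ?_ (elt_naturality φ c δ).symm
    refine Eq.trans (elt_naturality ((T.functorF hX).map
      ((T.toQuot X n).map (ObjectProperty.homMk f : M.as ⟶ N.as))) c δ) ?_
    exact congrArg _ hf

/-- If `𝔼(-, f)` kills the extension of `M ⟶ Y ⟶ Z`, then `f` extends to `Y`, hence factors through
an object of `X`. -/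
lemma functorF_faithful (hX : IsRigid H n X) : (T.functorF hX).Faithful where
  map_injective {M N} f g e := by
    obtain ⟨f, rfl⟩ := (T.toQuot X n).map_surjective (X := M.as) (Y := N.as) f
    obtain ⟨g, rfl⟩ := (T.toQuot X n).map_surjective (X := M.as) (Y := N.as) g
    obtain ⟨Y, Z, i, p, δ, h, hY, hZ⟩ := cores_succ_exists X M.as.property
    have e' : push T.E f.hom δ = push T.E g.hom δ :=
      congrArg (fun t => (t.app (op ((T.toStable X n).obj ⟨Z, hZ⟩))).hom δ) e
    obtain ⟨k, hk⟩ := (Realizes.extend_iff h (f.hom - g.hom)).2 (by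
      rw [T.sub_push, e', sub_self])
    rw [CategoryTheory.Quotient.functor_map_eq_iff]
    exact ⟨⟨Y, le_cores X _ _ hY⟩, ObjectProperty.homMk i, ObjectProperty.homMk k, hY,
      ObjectProperty.hom_ext _ hk⟩

/-- Every `G` in `R_X^n` is in the essential image of `𝔽`: represent its relation by `f : X₀ ⟶ X₁`,
make `f` a deflation by adding a projective object `P`, and take the cocone of `X₀ ⊞ P ⟶ X₁`. -/
lemma functorF_exists_iso (hproj : T.EnoughProj) (hPX : T.IsProj ≤ X) (hX : IsRigid H n X)
    {G : (T.Stable (T.cores X n))ᵒᵖ ⥤ AddCommGrpCat.{v}} (hG : T.classR X n G) :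
    ∃ M, Nonempty ((T.functorF hX).obj M ≅ G) := by
  obtain ⟨a, X₀, X₁, f, x, hX₀, hf⟩ := exists_isPresentation_of_classR hG
  obtain ⟨f, rfl⟩ := (T.toStable X n).map_surjective (X := X₀.as) (Y := X₁.as) f
  obtain ⟨P, p, hP, hp⟩ := hproj.exists_defl X₁.as.obj
  obtain ⟨M, i, δ, h⟩ := hp.desc f.hom
  have hY : X (X₀.as.obj ⊞ P) := prop_biprod_of_isAddClosed X hX₀ (hPX _ hP)
  let M' : T.QuotCores X n := ⟨⟨M, cores_succ_of_realizes X h hY X₁.as.property⟩⟩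
  let Y : (T.cores X n).FullSubcategory := ⟨X₀.as.obj ⊞ P, le_cores X n _ hY⟩
  let p' : Y ⟶ X₁.as := ObjectProperty.homMk (biprod.desc f.hom p)
  have hM := isPresentation_of_realizes hX (p := p') h hY
  have : ((T.functorF hX).obj M').Additive :=
    inferInstanceAs ((T.stableExt (T.cores X n)).obj M).Additive
  refine ⟨M', IsPresentation.nonempty_iso (G := (T.functorF hX).obj M') hM hf fun Z g => ?_⟩
  obtain ⟨g, rfl⟩ := (T.toStable X n).map_surjective (X := Z.as) (Y := X₁.as) g
  constructor
  · rintro ⟨k, hk⟩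
    obtain ⟨k, rfl⟩ := (T.toStable X n).map_surjective (X := Z.as) (Y := Y) k
    refine ⟨(T.toStable X n).map (ObjectProperty.homMk (k.hom ≫ biprod.fst)), ?_⟩
    rw [← hk, ← Functor.map_comp, ← Functor.map_comp, stable_map_eq_iff]
    change T.E.map ((k.hom ≫ biprod.fst) ≫ f.hom).op = T.E.map (k.hom ≫ biprod.desc f.hom p).op
    have e : k.hom ≫ biprod.desc f.hom p =
        (k.hom ≫ biprod.fst) ≫ f.hom + (k.hom ≫ biprod.snd) ≫ p := by
      rw [biprod.desc_eq, Preadditive.comp_add, Category.assoc, Category.assoc]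
    -- the component through the projective summand vanishes in the stable category
    have e' : T.E.map ((k.hom ≫ biprod.snd) ≫ p).op = 0 := by
      ext A ε
      refine Eq.trans (pull_comp T.E p (k.hom ≫ biprod.snd) ε) ?_
      rw [hP.extn_eq_zero (pull T.E p ε), pull_zero]
      rfl
    have := T.additive_left
    rw [e, op_add, Functor.map_add, e', add_zero]
  · rintro ⟨k, hk⟩
    obtain ⟨k, rfl⟩ := (T.toStable X n).map_surjective (X := Z.as) (Y := X₀.as) k
    obtain ⟨K, j, ε, hε⟩ := hp
    rw [← Functor.map_comp, stable_map_eq_iff] at hk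
    obtain ⟨l, hl⟩ := (Realizes.lift_iff hε (g.hom - k.hom ≫ f.hom)).2 (by
      rw [T.sub_pull, sub_eq_zero]
      exact congrArg (fun t => (t.app K).hom ε) hk.symm)
    refine ⟨(T.toStable X n).map (ObjectProperty.homMk (biprod.lift k.hom l)), ?_⟩
    rw [← Functor.map_comp]
    congr 1
    apply ObjectProperty.hom_ext
    change biprod.lift k.hom l ≫ biprod.desc f.hom p = g.hom
    rw [biprod.lift_desc, hl, add_sub_cancel]

end Extriangulation

/-! ### Extension-closed subcategories of abelian categories -/

section KernelLemmas

variable {A : Type u} [Category.{v} A] [HasZeroMorphisms A] {M N L : A} {i : M ⟶ N} {p : N ⟶ L}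
  {w : i ≫ p = 0}

lemma exists_lift_of_isLimit (h : IsLimit (KernelFork.ofι i w)) {W : A} (k : W ⟶ N)
    (hk : k ≫ p = 0) : ∃ l : W ⟶ M, l ≫ i = k :=
  ⟨_, (KernelFork.IsLimit.lift' h k hk).2⟩

lemma exists_desc_of_isColimit (h : IsColimit (CokernelCofork.ofπ p w)) {W : A} (k : N ⟶ W)
    (hk : i ≫ k = 0) : ∃ l : L ⟶ W, p ≫ l = k :=
  ⟨_, (CokernelCofork.IsColimit.desc' h k hk).2⟩

lemma mono_of_isLimit (h : IsLimit (KernelFork.ofι i w)) : Mono i :=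
  ⟨fun _ _ e => Fork.IsLimit.hom_ext h e⟩

variable (w) in
lemma nonempty_isLimit_of_exists_lift (hi : Mono i)
    (h : ∀ ⦃W : A⦄ (k : W ⟶ N), k ≫ p = 0 → ∃ l : W ⟶ M, l ≫ i = k) :
    Nonempty (IsLimit (KernelFork.ofι i w)) :=
  ⟨KernelFork.IsLimit.ofι _ _ (fun k hk => (h k hk).choose) (fun k hk => (h k hk).choose_spec)
    (fun k hk b hb => by rw [← cancel_mono i, hb, (h k hk).choose_spec])⟩

variable (w) in
lemma nonempty_isColimit_of_exists_desc (hp : Epi p)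
    (h : ∀ ⦃W : A⦄ (k : N ⟶ W), i ≫ k = 0 → ∃ l : L ⟶ W, p ≫ l = k) :
    Nonempty (IsColimit (CokernelCofork.ofπ p w)) :=
  ⟨CokernelCofork.IsColimit.ofπ _ _ (fun k hk => (h k hk).choose)
    (fun k hk => (h k hk).choose_spec)
    (fun k hk b hb => by rw [← cancel_epi p, hb, (h k hk).choose_spec])⟩

end KernelLemmas

section AbelianLemmas

variable {𝒜 : Type u} [Category.{v} 𝒜] [Abelian 𝒜]

/-- `0 ⟶ coker f ⟶ coker (f ≫ g) ⟶ coker g ⟶ 0` is exact if `g` is a monomorphism. -/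
lemma shortExact_cokernels_comp {M N L : 𝒜} (f : M ⟶ N) (g : N ⟶ L) [Mono g] :
    ∃ S : ShortComplex 𝒜, S.ShortExact ∧ S.X₁ = cokernel f ∧ S.X₂ = cokernel (f ≫ g) ∧
      S.X₃ = cokernel g := by
  have h := kernelCokernelCompSequence_exact f g
  have h₂ := h.exact 2
  have h₃ := h.exact 3
  have hk : IsZero (kernel g) := isZero_kernel_of_mono g
  have := h₂.mono_g (hk.eq_of_src _ _)
  refine ⟨_, ⟨h₃⟩, rfl, rfl, rfl⟩

/-- `0 ⟶ ker f ⟶ ker (f ≫ g) ⟶ ker g ⟶ 0` is exact if `f` is an epimorphism. -/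
lemma shortExact_kernels_comp {M N L : 𝒜} (f : M ⟶ N) (g : N ⟶ L) [Epi f] :
    ∃ S : ShortComplex 𝒜, S.ShortExact ∧ S.X₁ = kernel f ∧ S.X₂ = kernel (f ≫ g) ∧
      S.X₃ = kernel g := by
  have h := kernelCokernelCompSequence_exact f g
  have h₂ := h.exact 1
  have h₃ := h.exact 0
  have hk : IsZero (cokernel f) := isZero_cokernel_of_epi f
  have := h₂.epi_f (hk.eq_of_tgt _ _)
  refine ⟨_, ⟨h₃⟩, rfl, rfl, rfl⟩

end AbelianLemmas

section Embedding

variable {B : Type u'} [Category.{v'} B] [Preadditive B] {𝒜 : Type u} [Category.{v} 𝒜] [Abelian 𝒜]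

/-- `F` is a fully faithful additive functor to an abelian category whose essential image contains
zero and is closed under extensions. -/
structure IsExtensionClosedEmbedding (F : B ⥤ 𝒜) : Prop where
  full : F.Full
  faithful : F.Faithful
  additive : F.Additive
  zero : ∃ O, IsZero O ∧ F.essImage O
  ext : ∀ S : ShortComplex 𝒜, S.ShortExact → F.essImage S.X₁ → F.essImage S.X₃ → F.essImage S.X₂

namespace IsExtensionClosedEmbedding

variable {F : B ⥤ 𝒜} (hF : IsExtensionClosedEmbedding F)

include hF

lemma hasFiniteBiproducts : HasFiniteBiproducts B := by
  have := hF.full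
  have := hF.faithful
  have := hF.additive
  have : HasZeroObject B := by
    obtain ⟨O, hO, O', ⟨e⟩⟩ := hF.zero
    refine ⟨O', ?_⟩
    rw [IsZero.iff_id_eq_zero]
    exact F.map_injective ((hO.of_iso e).eq_of_src _ _)
  have : HasBinaryBiproducts B := ⟨fun M N => by
    let S : ShortComplex 𝒜 := ShortComplex.mk (biprod.inl : F.obj M ⟶ F.obj M ⊞ F.obj N)
      biprod.snd (by simp)
    have hS : S.ShortExact :=
      ShortComplex.Splitting.shortExact
        { r := biprod.fst
          s := biprod.inr
          f_r := by simp [S]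
          s_g := by simp [S]
          id := by simp [S] }
    obtain ⟨W, ⟨e⟩⟩ := hF.ext S hS ⟨M, ⟨Iso.refl _⟩⟩ ⟨N, ⟨Iso.refl _⟩⟩
    let e' : F.obj W ≅ F.obj M ⊞ F.obj N := e
    let b : BinaryBicone M N :=
      { pt := W
        fst := F.preimage (e'.hom ≫ biprod.fst)
        snd := F.preimage (e'.hom ≫ biprod.snd)
        inl := F.preimage (biprod.inl ≫ e'.inv)
        inr := F.preimage (biprod.inr ≫ e'.inv)
        inl_fst := F.map_injective (by simp)
        inl_snd := F.map_injective (by simp)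
        inr_fst := F.map_injective (by simp)
        inr_snd := F.map_injective (by simp) }
    refine HasBinaryBiproduct.mk ⟨b, isBinaryBilimitOfTotal _ (F.map_injective ?_)⟩
    have : e'.hom ≫ (biprod.fst ≫ biprod.inl + biprod.snd ≫ biprod.inr) ≫ e'.inv = 𝟙 _ := by
      simp
    simpa only [b, Functor.map_add, Functor.map_comp, Functor.map_preimage, Preadditive.add_comp,
      Preadditive.comp_add, Category.assoc, F.map_id] using this⟩
  have : HasFiniteProducts B := hasFiniteProducts_of_has_binary_and_terminal
  exact HasFiniteBiproducts.of_hasFiniteProducts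

variable [F.PreservesZeroMorphisms]

omit hF in
lemma shortExact_of_pairs {M N L : B} {i : M ⟶ N} {p : N ⟶ L} (h : pairs (inducedConf F) i p) :
    ∃ w : F.map i ≫ F.map p = 0, (ShortComplex.mk (F.map i) (F.map p) w).ShortExact := by
  obtain ⟨w, h⟩ := h
  exact ⟨_, h⟩

lemma inflation_iff {M N : B} (i : M ⟶ N) :
    IsInflation (inducedConf F) i ↔ Mono (F.map i) ∧ F.essImage (cokernel (F.map i)) := by
  have := hF.full
  have := hF.faithful
  constructor
  · rintro ⟨L, p, h⟩
    obtain ⟨w, h⟩ := shortExact_of_pairs h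
    exact ⟨h.mono_f, L, ⟨IsColimit.coconePointUniqueUpToIso h.gIsCokernel (colimit.isColimit _)⟩⟩
  · rintro ⟨h, L, ⟨e⟩⟩
    refine ⟨L, F.preimage (cokernel.π (F.map i) ≫ e.inv), F.map_injective (by simp), ?_⟩
    have hS : (ShortComplex.mk (F.map i) (cokernel.π (F.map i)) (by simp)).ShortExact :=
      { exact := ShortComplex.exact_cokernel _ }
    refine ShortComplex.shortExact_of_iso (ShortComplex.isoMk (Iso.refl (F.obj M))
      (Iso.refl (F.obj N)) e.symm ?_ ?_) hS
    · exact (Category.id_comp _).trans (Category.comp_id _).symm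
    · change 𝟙 (F.obj N) ≫ F.map _ = cokernel.π (F.map i) ≫ e.inv
      simp

lemma deflation_iff {N L : B} (p : N ⟶ L) :
    IsDeflation (inducedConf F) p ↔ Epi (F.map p) ∧ F.essImage (kernel (F.map p)) := by
  have := hF.full
  have := hF.faithful
  constructor
  · rintro ⟨M, i, h⟩
    obtain ⟨w, h⟩ := shortExact_of_pairs h
    exact ⟨h.epi_g, M, ⟨IsLimit.conePointUniqueUpToIso h.fIsKernel (limit.isLimit _)⟩⟩
  · rintro ⟨h, M, ⟨e⟩⟩
    refine ⟨M, F.preimage (e.hom ≫ kernel.ι (F.map p)), F.map_injective (by simp), ?_⟩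
    have hS : (ShortComplex.mk (kernel.ι (F.map p)) (F.map p) (by simp)).ShortExact :=
      { exact := ShortComplex.exact_kernel _ }
    refine ShortComplex.shortExact_of_iso (ShortComplex.isoMk e.symm
      (Iso.refl (F.obj N)) (Iso.refl (F.obj L)) ?_ ?_) hS
    · change e.inv ≫ F.map _ = kernel.ι (F.map p) ≫ 𝟙 (F.obj N)
      simp
    · exact (Category.id_comp _).trans (Category.comp_id _).symm

/-- An extension-closed subcategory of an abelian category is an exact category. Inflations and
deflations are recognized by `inflation_iff` and `deflation_iff`, and pushouts and pullbacks are
those of the abelian category. -/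
theorem isExactCategory : IsExactCategory (inducedConf F) := by
  have := hF.full
  have := hF.faithful
  have := hF.additive
  have hz {O : 𝒜} (hO : IsZero O) : F.essImage O := by
    obtain ⟨O', hO', h⟩ := hF.zero
    exact F.essImage.prop_of_iso (hO'.iso hO) h
  refine
    { hasFiniteBiproducts := hF.hasFiniteBiproducts
      isKernel := fun S hS => nonempty_isLimit_of_exists_lift _
        (F.mono_of_mono_map (ShortComplex.ShortExact.mono_f hS)) fun W k hk => ?_
      isCokernel := fun S hS => nonempty_isColimit_of_exists_desc _
        (F.epi_of_epi_map (ShortComplex.ShortExact.epi_g hS)) fun W k hk => ?_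
      of_iso := fun S S' ⟨e⟩ hS => ShortComplex.shortExact_of_iso (F.mapShortComplex.mapIso e) hS
      inflation_id := fun M => ?_
      deflation_id := fun M => ?_
      inflation_comp := fun M N L i j hi hj => ?_
      deflation_comp := fun M N L i j hi hj => ?_
      pushout := fun M N M' i f hi => ?_
      pullback := fun N L L' p f hp => ?_ }
  · obtain ⟨l, hl⟩ : ∃ l : F.obj W ⟶ F.obj S.X₁, l ≫ F.map S.f = F.map k :=
      exists_lift_of_isLimit (ShortComplex.ShortExact.fIsKernel hS) (F.map k)
        ((F.map_comp _ _).symm.trans (by rw [hk]; exact F.map_zero _ _))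
    exact ⟨F.preimage l, F.map_injective (by rw [F.map_comp, F.map_preimage, hl])⟩
  · obtain ⟨l, hl⟩ : ∃ l : F.obj S.X₃ ⟶ F.obj W, F.map S.g ≫ l = F.map k :=
      exists_desc_of_isColimit (ShortComplex.ShortExact.gIsCokernel hS) (F.map k)
        ((F.map_comp _ _).symm.trans (by rw [hk]; exact F.map_zero _ _))
    exact ⟨F.preimage l, F.map_injective (by rw [F.map_comp, F.map_preimage, hl])⟩
  · rw [hF.inflation_iff, F.map_id]
    exact ⟨inferInstance, hz (isZero_cokernel_of_epi _)⟩
  · rw [hF.deflation_iff, F.map_id]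
    exact ⟨inferInstance, hz (isZero_kernel_of_mono _)⟩
  · rw [hF.inflation_iff] at *
    obtain ⟨h₁, h₂⟩ := hi
    obtain ⟨h₃, h₄⟩ := hj
    obtain ⟨S, hS, e₁, e₂, e₃⟩ := shortExact_cokernels_comp (F.map i) (F.map j)
    rw [F.map_comp]
    exact ⟨mono_comp _ _, e₂ ▸ hF.ext S hS (e₁ ▸ h₂) (e₃ ▸ h₄)⟩
  · rw [hF.deflation_iff] at *
    obtain ⟨h₁, h₂⟩ := hi
    obtain ⟨h₃, h₄⟩ := hj
    obtain ⟨S, hS, e₁, e₂, e₃⟩ := shortExact_kernels_comp (F.map i) (F.map j)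
    rw [F.map_comp]
    exact ⟨epi_comp _ _, e₂ ▸ hF.ext S hS (e₁ ▸ h₂) (e₃ ▸ h₄)⟩
  · rw [hF.inflation_iff] at hi
    obtain ⟨h₁, h₂⟩ := hi
    have sq := IsPushout.of_hasPushout (F.map i) (F.map f)
    have := isIso_cokernel_map_of_isPushout sq
    have h₃ : F.essImage (cokernel (pushout.inr (F.map i) (F.map f))) :=
      F.essImage.prop_of_iso (asIso (cokernel.map _ _ _ _ sq.w)) h₂
    have hS : (ShortComplex.mk (pushout.inr (F.map i) (F.map f))
        (cokernel.π (pushout.inr (F.map i) (F.map f))) (by simp)).ShortExact :=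
      { exact := ShortComplex.exact_cokernel _ }
    obtain ⟨N', ⟨e⟩⟩ := hF.ext _ hS ⟨M', ⟨Iso.refl _⟩⟩ h₃
    have e' : F.obj N' ≅ pushout (F.map i) (F.map f) := e
    have sq' : IsPushout (F.map i) (F.map f) (pushout.inl (F.map i) (F.map f) ≫ e'.inv)
        (pushout.inr (F.map i) (F.map f) ≫ e'.inv) :=
      sq.of_iso (Iso.refl _) (Iso.refl _) (Iso.refl _) e'.symm (by simp) (by simp) (by simp)
        (by simp)
    refine ⟨N', F.preimage (pushout.inl _ _ ≫ e'.inv), F.preimage (pushout.inr _ _ ≫ e'.inv),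
      IsPushout.of_map_of_faithful F (by simpa using sq'), ?_⟩
    rw [hF.inflation_iff, F.map_preimage]
    exact ⟨inferInstance, F.essImage.prop_of_iso (cokernelCompIsIso _ _).symm h₃⟩
  · rw [hF.deflation_iff] at hp
    obtain ⟨h₁, h₂⟩ := hp
    have sq := IsPullback.of_hasPullback (F.map f) (F.map p)
    have := isIso_kernel_map_of_isPullback sq
    have h₃ : F.essImage (kernel (pullback.fst (F.map f) (F.map p))) :=
      F.essImage.prop_of_iso (asIso (kernel.map _ _ _ _ sq.w)).symm h₂
    have hS : (ShortComplex.mk (kernel.ι (pullback.fst (F.map f) (F.map p)))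
        (pullback.fst (F.map f) (F.map p)) (by simp)).ShortExact :=
      { exact := ShortComplex.exact_kernel _ }
    obtain ⟨N', ⟨e⟩⟩ := hF.ext _ hS h₃ ⟨L', ⟨Iso.refl _⟩⟩
    have e' : F.obj N' ≅ pullback (F.map f) (F.map p) := e
    have sq' : IsPullback (e'.hom ≫ pullback.fst (F.map f) (F.map p))
        (e'.hom ≫ pullback.snd (F.map f) (F.map p)) (F.map f) (F.map p) :=
      sq.of_iso e'.symm (Iso.refl _) (Iso.refl _) (Iso.refl _) (by simp) (by simp) (by simp)
        (by simp)
    refine ⟨N', F.preimage (e'.hom ≫ pullback.fst _ _), F.preimage (e'.hom ≫ pullback.snd _ _),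
      IsPullback.of_map_of_faithful F (by simpa using sq'), ?_⟩
    rw [hF.deflation_iff, F.map_preimage]
    exact ⟨epi_comp _ _, F.essImage.prop_of_iso (kernelIsIsoComp _ _).symm h₃⟩

end IsExtensionClosedEmbedding

end Embedding

/-! ### The exact category of conflations -/

section ShortComplexLemmas

variable {𝒜 : Type u} [Category.{v} 𝒜] [Abelian 𝒜]

/-- Exactness in the abelian category of short complexes is degreewise. -/
lemma shortComplex_shortExact_iff (S : ShortComplex (ShortComplex 𝒜)) :
    S.ShortExact ↔ (S.map ShortComplex.π₁).ShortExact ∧ (S.map ShortComplex.π₂).ShortExact ∧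
      (S.map ShortComplex.π₃).ShortExact := by
  constructor
  · intro h
    exact ⟨h.map_of_exact _, h.map_of_exact _, h.map_of_exact _⟩
  · rintro ⟨h₁, h₂, h₃⟩
    have m₁ : Mono S.f.τ₁ := h₁.mono_f
    have m₂ : Mono S.f.τ₂ := h₂.mono_f
    have m₃ : Mono S.f.τ₃ := h₃.mono_f
    have e₁ : Epi S.g.τ₁ := h₁.epi_g
    have e₂ : Epi S.g.τ₂ := h₂.epi_g
    have e₃ : Epi S.g.τ₃ := h₃.epi_g
    refine ShortComplex.ShortExact.mk' ?_ ⟨fun a b h => ?_⟩ ⟨fun a b h => ?_⟩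
    · rw [ShortComplex.exact_iff_isZero_homology, IsZero.iff_id_eq_zero]
      have z₁ := ((ShortComplex.exact_iff_isZero_homology _).1 h₁.exact).of_iso
        (S.mapHomologyIso ShortComplex.π₁).symm
      have z₂ := ((ShortComplex.exact_iff_isZero_homology _).1 h₂.exact).of_iso
        (S.mapHomologyIso ShortComplex.π₂).symm
      have z₃ := ((ShortComplex.exact_iff_isZero_homology _).1 h₃.exact).of_iso
        (S.mapHomologyIso ShortComplex.π₃).symm
      exact ShortComplex.hom_ext _ _ (z₁.eq_of_src _ _) (z₂.eq_of_src _ _) (z₃.eq_of_src _ _)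
    · exact ShortComplex.hom_ext _ _ ((cancel_mono S.f.τ₁).1 (congrArg ShortComplex.Hom.τ₁ h))
        ((cancel_mono S.f.τ₂).1 (congrArg ShortComplex.Hom.τ₂ h))
        ((cancel_mono S.f.τ₃).1 (congrArg ShortComplex.Hom.τ₃ h))
    · exact ShortComplex.hom_ext _ _ ((cancel_epi S.g.τ₁).1 (congrArg ShortComplex.Hom.τ₁ h))
        ((cancel_epi S.g.τ₂).1 (congrArg ShortComplex.Hom.τ₂ h))
        ((cancel_epi S.g.τ₃).1 (congrArg ShortComplex.Hom.τ₃ h))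

/-- A degreewise extension of short exact sequences is short exact. -/
lemma shortExact_of_extension {S : ShortComplex (ShortComplex 𝒜)} (hS : S.ShortExact)
    (hX₁ : S.X₁.ShortExact) (hX₃ : S.X₃.ShortExact) : S.X₂.ShortExact := by
  obtain ⟨h₁, h₂, h₃⟩ := (shortComplex_shortExact_iff S).1 hS
  have m₂ : Mono S.f.τ₂ := h₂.mono_f
  have m₃ : Mono S.f.τ₃ := h₃.mono_f
  have e₁ : Epi S.g.τ₁ := h₁.epi_g
  have e₂ : Epi S.g.τ₂ := h₂.epi_g
  have := hX₁.mono_f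
  have := hX₁.epi_g
  have := hX₃.mono_f
  have := hX₃.epi_g
  refine ShortComplex.ShortExact.mk' ?_ ?_ ?_
  · rw [ShortComplex.exact_iff_exact_up_to_refinements]
    intro Z z hz
    obtain ⟨t, ht₃⟩ := exists_lift_of_isLimit hX₃.fIsKernel (z ≫ S.g.τ₂) (by
      rw [Category.assoc, S.g.comm₂₃, reassoc_of% hz, zero_comp])
    obtain ⟨Z', π, hπ, t', ht'⟩ := surjective_up_to_refinements_of_epi S.g.τ₁ t
    obtain ⟨s, hs'⟩ : ∃ s : Z' ⟶ S.X₁.X₂, s ≫ S.f.τ₂ = π ≫ z - t' ≫ S.X₂.f :=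
      exists_lift_of_isLimit h₂.fIsKernel (π ≫ z - t' ≫ S.X₂.f) (by
      change (π ≫ z - t' ≫ S.X₂.f) ≫ S.g.τ₂ = 0
      rw [Preadditive.sub_comp, Category.assoc, Category.assoc, ← S.g.comm₁₂, ← reassoc_of% ht',
        ht₃, sub_self])
    obtain ⟨r, hr'⟩ := exists_lift_of_isLimit hX₁.fIsKernel s (by
      rw [← cancel_mono S.f.τ₃, Category.assoc, ← S.f.comm₂₃, reassoc_of% hs',
        Preadditive.sub_comp, Category.assoc, Category.assoc, hz, S.X₂.zero]
      simp)
    exact ⟨Z', π, hπ, t' + r ≫ S.f.τ₁, by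
      rw [Preadditive.add_comp, Category.assoc, S.f.comm₁₂, reassoc_of% hr', hs',
        add_sub_cancel]⟩
  · rw [Preadditive.mono_iff_cancel_zero]
    intro Z z hz
    have hz' : z ≫ S.g.τ₁ = 0 := by
      rw [← cancel_mono S.X₃.f, Category.assoc, S.g.comm₁₂, reassoc_of% hz, zero_comp, zero_comp]
    obtain ⟨t, ht'⟩ : ∃ t : Z ⟶ S.X₁.X₁, t ≫ S.f.τ₁ = z :=
      exists_lift_of_isLimit h₁.fIsKernel z hz'
    have : t = 0 := by
      rw [← cancel_mono S.X₁.f, ← cancel_mono S.f.τ₂, Category.assoc, ← S.f.comm₁₂,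
        reassoc_of% ht', hz]
      simp
    rw [← ht', this, zero_comp]
  · rw [Preadditive.epi_iff_cancel_zero]
    intro Z z hz
    have hz' : S.f.τ₃ ≫ z = 0 := by
      rw [← cancel_epi S.X₁.g, ← S.f.comm₂₃_assoc, hz]
      simp
    obtain ⟨t, ht'⟩ : ∃ t : S.X₃.X₃ ⟶ Z, S.g.τ₃ ≫ t = z :=
      exists_desc_of_isColimit h₃.gIsCokernel z hz'
    have : t = 0 := by
      rw [← cancel_epi S.X₃.g, ← cancel_epi S.g.τ₂, S.g.comm₂₃_assoc, ht', hz]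
      simp
    rw [← ht', this, comp_zero]

end ShortComplexLemmas

section Degreewise

variable {B : Type u'} [Category.{v'} B] [Preadditive B] {𝒜 : Type u} [Category.{v} 𝒜] [Abelian 𝒜]
  (F : B ⥤ 𝒜) [F.PreservesZeroMorphisms]

/-- The functor from the category of conflations to the category of short complexes in the ambient
abelian category. -/
abbrev conflationsFunctor : Conflations (inducedConf F) ⥤ ShortComplex 𝒜 :=
  (inducedConf F).ι ⋙ F.mapShortComplex

instance : (conflationsFunctor F).PreservesZeroMorphisms where
  map_zero M N := by
    refine ShortComplex.hom_ext _ _ ?_ ?_ ?_ <;> exact F.map_zero _ _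

/-- The degreewise conflations are those induced from the abelian category of short complexes. -/
lemma degreewise_eq : degreewise (inducedConf F) = inducedConf (conflationsFunctor F) := by
  ext S
  exact (shortComplex_shortExact_iff (S.map (conflationsFunctor F))).symm

variable {F}

/-- The conflations of an extension-closed subcategory form an extension-closed subcategory of the
abelian category of short complexes. -/
lemma IsExtensionClosedEmbedding.conflations (hF : IsExtensionClosedEmbedding F) :
    IsExtensionClosedEmbedding (conflationsFunctor F) := by
  have := hF.full
  have := hF.faithful
  have := hF.additive
  -- the essential image: the short exact sequences with terms in the essential image of `F`
  have key (Q : ShortComplex 𝒜) : (conflationsFunctor F).essImage Q ↔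
      Q.ShortExact ∧ F.essImage Q.X₁ ∧ F.essImage Q.X₂ ∧ F.essImage Q.X₃ := by
    constructor
    · rintro ⟨η, ⟨e⟩⟩
      exact ⟨ShortComplex.shortExact_of_iso e η.property, ⟨_, ⟨ShortComplex.π₁.mapIso e⟩⟩,
        ⟨_, ⟨ShortComplex.π₂.mapIso e⟩⟩, ⟨_, ⟨ShortComplex.π₃.mapIso e⟩⟩⟩
    · rintro ⟨hQ, ⟨M, ⟨a⟩⟩, ⟨N, ⟨b⟩⟩, ⟨L, ⟨c⟩⟩⟩
      let S : ShortComplex B := ShortComplex.mk (F.preimage (a.hom ≫ Q.f ≫ b.inv))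
        (F.preimage (b.hom ≫ Q.g ≫ c.inv)) (F.map_injective (by simp))
      let e : S.map F ≅ Q := ShortComplex.isoMk a b c
        (by
          change a.hom ≫ Q.f = F.map (F.preimage _) ≫ b.hom
          simp)
        (by
          change b.hom ≫ Q.g = F.map (F.preimage _) ≫ c.hom
          simp)
      exact ⟨⟨S, ShortComplex.shortExact_of_iso e.symm hQ⟩, ⟨e⟩⟩
  have full : (conflationsFunctor F).Full := ⟨fun {M N} φ => by
    obtain ⟨a, ha⟩ : ∃ a : M.obj.X₁ ⟶ N.obj.X₁, F.map a = φ.τ₁ := F.map_surjective _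
    obtain ⟨b, hb⟩ : ∃ b : M.obj.X₂ ⟶ N.obj.X₂, F.map b = φ.τ₂ := F.map_surjective _
    obtain ⟨c, hc⟩ : ∃ c : M.obj.X₃ ⟶ N.obj.X₃, F.map c = φ.τ₃ := F.map_surjective _
    exact ⟨ObjectProperty.homMk
      { τ₁ := a
        τ₂ := b
        τ₃ := c
        comm₁₂ := F.map_injective (by
          rw [F.map_comp, F.map_comp, ha, hb]
          exact φ.comm₁₂)
        comm₂₃ := F.map_injective (by
          rw [F.map_comp, F.map_comp, hb, hc]
          exact φ.comm₂₃) }, ShortComplex.hom_ext _ _ ha hb hc⟩⟩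
  refine
    { full := full
      faithful := ⟨fun {M N} f g h => ?_⟩
      additive := ⟨fun {M N} f g => ?_⟩
      zero := ?_
      ext := fun S hS h₁ h₃ => ?_ }
  · apply ObjectProperty.hom_ext
    exact ShortComplex.hom_ext _ _ (F.map_injective (congrArg ShortComplex.Hom.τ₁ h))
      (F.map_injective (congrArg ShortComplex.Hom.τ₂ h))
      (F.map_injective (congrArg ShortComplex.Hom.τ₃ h))
  · exact ShortComplex.hom_ext _ _ F.map_add F.map_add F.map_add
  · obtain ⟨O, hO, h⟩ := hF.zero
    refine ⟨ShortComplex.mk (0 : O ⟶ O) (0 : O ⟶ O) (by simp), ?_, ?_⟩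
    · rw [IsZero.iff_id_eq_zero]
      exact ShortComplex.hom_ext _ _ (hO.eq_of_src _ _) (hO.eq_of_src _ _) (hO.eq_of_src _ _)
    · exact (key _).2 ⟨ShortComplex.ShortExact.mk' (ShortComplex.exact_of_isZero_X₂ _ hO)
        ⟨fun _ _ _ => hO.eq_of_tgt _ _⟩ ⟨fun _ _ _ => hO.eq_of_src _ _⟩, h, h, h⟩
  · obtain ⟨a₁, b₁, c₁, d₁⟩ := (key _).1 h₁
    obtain ⟨a₃, b₃, c₃, d₃⟩ := (key _).1 h₃
    obtain ⟨e₁, e₂, e₃⟩ := (shortComplex_shortExact_iff S).1 hS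
    exact (key _).2 ⟨shortExact_of_extension hS a₁ a₃, hF.ext (S.map ShortComplex.π₁) e₁ b₁ b₃,
      hF.ext (S.map ShortComplex.π₂) e₂ c₁ c₃, hF.ext (S.map ShortComplex.π₃) e₃ d₁ d₃⟩

/-- The category of conflations of an exact category which is embedded in an abelian category is
exact. -/
theorem IsExtensionClosedEmbedding.isExactCategory_degreewise (hF : IsExtensionClosedEmbedding F) :
    IsExactCategory (degreewise (inducedConf F)) := by
  rw [degreewise_eq]
  exact hF.conflations.isExactCategory

end Degreewise

/-! ### Split conflations -/

section SplitConflations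

variable {B : Type u'} [Category.{v'} B] [Preadditive B]

lemma nonempty_splitting_of_section {conf : ObjectProperty (ShortComplex B)}
    (hE : IsExactCategory conf) {S : ShortComplex B} (hS : conf S) (s : S.X₃ ⟶ S.X₂)
    (hs : s ≫ S.g = 𝟙 _) : Nonempty S.Splitting := by
  obtain ⟨hk⟩ := hE.isKernel S hS
  have := mono_of_isLimit hk
  obtain ⟨r, hr⟩ := exists_lift_of_isLimit hk (𝟙 _ - S.g ≫ s) (by simp [hs])
  exact ⟨{ r := r
           s := s
           f_r := by rw [← cancel_mono S.f, Category.assoc, hr]; simp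
           s_g := hs
           id := by rw [hr]; simp }⟩

lemma splitConflations_iff {conf : ObjectProperty (ShortComplex B)}
    (hE : IsExactCategory conf) (η : Conflations conf) :
    splitConflations conf η ↔ ∃ s : η.obj.X₃ ⟶ η.obj.X₂, s ≫ η.obj.g = 𝟙 _ :=
  ⟨fun ⟨σ⟩ => ⟨σ.s, σ.s_g⟩, fun ⟨s, hs⟩ => nonempty_splitting_of_section hE η.property s hs⟩

/-- The third term of a conflation. -/
abbrev thirdTerm (conf : ObjectProperty (ShortComplex B)) : Conflations conf ⥤ B :=
  conf.ι ⋙ ShortComplex.π₃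

instance (conf : ObjectProperty (ShortComplex B)) : (thirdTerm conf).Additive where
  map_add := rfl

/-- A section of the deflation of `η` is assembled from sections for the `ζ j`. -/
lemma splitConflations_of_sum {conf : ObjectProperty (ShortComplex B)}
    (hE : IsExactCategory conf) {k : ℕ} {ζ : Fin k → Conflations conf} {η : Conflations conf}
    (hζ : ∀ j, splitConflations conf (ζ j)) (π : ∀ j, η ⟶ ζ j) (ι : ∀ j, ζ j ⟶ η)
    (h : ∑ j, π j ≫ ι j = 𝟙 η) : splitConflations conf η := by
  choose s hs using fun j => (splitConflations_iff hE _).1 (hζ j)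
  refine (splitConflations_iff hE η).2 ⟨∑ j, (π j).hom.τ₃ ≫ s j ≫ (ι j).hom.τ₂, ?_⟩
  have h' := congrArg (thirdTerm conf).map h
  rw [(thirdTerm conf).map_sum, (thirdTerm conf).map_id] at h'
  rw [Preadditive.sum_comp]
  refine Eq.trans (Finset.sum_congr rfl fun j _ => ?_) h'
  rw [Category.assoc, Category.assoc, (ι j).hom.comm₂₃, reassoc_of% (hs j)]
  rfl

lemma splitConflations_of_retract {conf : ObjectProperty (ShortComplex B)}
    (hE : IsExactCategory conf) {ζ η : Conflations conf} (hζ : splitConflations conf ζ)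
    (i : η ⟶ ζ) (r : ζ ⟶ η) (h : i ≫ r = 𝟙 η) : splitConflations conf η :=
  splitConflations_of_sum hE (k := 1) (fun _ => hζ) (fun _ => i) (fun _ => r) (by simpa using h)

lemma add_splitConflations {conf : ObjectProperty (ShortComplex B)} (hE : IsExactCategory conf)
    [HasZeroObject (Conflations conf)] : splitConflations conf = add (splitConflations conf) := by
  refine le_antisymm ((le_free _).trans (le_smd _)) ?_
  rintro η ⟨η', b, -, k, f, b', hf, ⟨hb'⟩, ⟨e⟩⟩
  have h₁ : splitConflations conf b'.pt :=
    splitConflations_of_sum hE hf b'.π b'.ι (IsBilimit.total hb')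
  exact splitConflations_of_retract hE h₁ (b.inl ≫ e.inv) (e.hom ≫ b.fst) (by simp)

variable {𝒜 : Type u} [Category.{v} 𝒜] [Abelian 𝒜] {F : B ⥤ 𝒜} [F.PreservesZeroMorphisms]

lemma inducedConf_of_splitting [F.Additive] {S : ShortComplex B} (σ : S.Splitting) :
    inducedConf F S :=
  (σ.map F).shortExact

/-- The category of conflations has the split conflations as a pseudo-cluster tilting
subcategory: `K ⟶ M ⟶ N` embeds in `M ⟶ M ⊞ N ⟶ N` and is a quotient of `K ⟶ K ⊞ M ⟶ M`. -/
theorem IsExtensionClosedEmbedding.isPseudoClusterTilting (hF : IsExtensionClosedEmbedding F) :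
    IsPseudoClusterTilting (degreewise (inducedConf F)) (splitConflations (inducedConf F)) := by
  have hE := hF.isExactCategory
  have := hE.hasFiniteBiproducts
  have := hF.conflations.hasFiniteBiproducts
  have := hF.additive
  have : HasZeroObject B := hasZeroObject_of_hasFiniteBiproducts B
  have : HasZeroObject (Conflations (inducedConf F)) := hasZeroObject_of_hasFiniteBiproducts _
  have : HasBinaryBiproducts B := hasBinaryBiproducts_of_finite_biproducts B
  obtain ⟨O, hO⟩ := HasZeroObject.zero (C := B)
  have hbi (M N : B) : (ShortComplex.mk (biprod.inl : M ⟶ M ⊞ N) biprod.snd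
      biprod.inl_snd).Splitting :=
    { r := biprod.fst
      s := biprod.inr
      f_r := by simp
      s_g := by simp
      id := by simp }
  refine ⟨add_splitConflations hE, fun η => ?_, fun η => ?_⟩
  · obtain ⟨⟨i, p, w⟩, hη⟩ := η
    rename_i K M N
    have σ₁ : (ShortComplex.mk (𝟙 N) (0 : N ⟶ O) (by simp)).Splitting :=
      { r := 𝟙 N
        s := 0
        f_r := by simp
        s_g := hO.eq_of_src _ _
        id := by simp }
    have w₂ : biprod.lift (𝟙 M) p ≫ biprod.desc p (-𝟙 N) = 0 := by simp
    have σ₂ : (ShortComplex.mk _ _ w₂).Splitting :=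
      { r := biprod.fst
        s := -biprod.inr
        f_r := by simp
        s_g := by simp
        id := by ext <;> simp }
    let D₀ : Conflations (inducedConf F) := ⟨_, inducedConf_of_splitting (hbi M N)⟩
    let D₁ : Conflations (inducedConf F) := ⟨_, inducedConf_of_splitting σ₁⟩
    let α : (⟨⟨i, p, w⟩, hη⟩ : Conflations (inducedConf F)) ⟶ D₀ := ObjectProperty.homMk
      { τ₁ := i
        τ₂ := biprod.lift (𝟙 M) p
        τ₃ := 𝟙 N
        comm₁₂ := by ext <;> simp [D₀, w]
        comm₂₃ := by simp [D₀] }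
    let q : D₀ ⟶ D₁ := ObjectProperty.homMk
      { τ₁ := p
        τ₂ := biprod.desc p (-𝟙 N)
        τ₃ := 0
        comm₁₂ := by simp [D₀, D₁]
        comm₂₃ := by simp [D₀, D₁] }
    refine ⟨D₀, D₁, α, q, ⟨?_, hη, inducedConf_of_splitting σ₂, inducedConf_of_splitting σ₁⟩,
      ⟨hbi M N⟩, ⟨σ₁⟩, ⟨hbi M N⟩, ?_⟩
    · refine ObjectProperty.hom_ext _ (ShortComplex.hom_ext _ _ w ?_ comp_zero)
      exact w₂
    · rintro L ⟨σ⟩ f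
      -- a splitting of `L` transports `f` along `α`
      refine ⟨ObjectProperty.homMk
        { τ₁ := f.hom.τ₂ ≫ σ.r
          τ₂ := biprod.desc (f.hom.τ₂ ≫ σ.r ≫ L.obj.f) (f.hom.τ₃ ≫ σ.s)
          τ₃ := f.hom.τ₃
          comm₁₂ := by simp [D₀]
          comm₂₃ := by
            change biprod.desc _ _ ≫ L.obj.g = biprod.snd ≫ f.hom.τ₃
            ext <;> simp }, ObjectProperty.hom_ext _ (ShortComplex.hom_ext _ _ ?_ ?_ ?_)⟩
      · have e : f.hom.τ₁ ≫ L.obj.f = i ≫ f.hom.τ₂ := f.hom.comm₁₂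
        change i ≫ f.hom.τ₂ ≫ σ.r = f.hom.τ₁
        rw [← Category.assoc, ← e, Category.assoc, σ.f_r, Category.comp_id]
      · have e : f.hom.τ₂ ≫ L.obj.g = p ≫ f.hom.τ₃ := f.hom.comm₂₃
        refine biprod.lift_desc.trans ?_
        have key : f.hom.τ₂ ≫ (σ.r ≫ L.obj.f + L.obj.g ≫ σ.s) = f.hom.τ₂ := by
          rw [σ.id, Category.comp_id]
        rw [Preadditive.comp_add] at key
        rwa [Category.id_comp, ← reassoc_of% e]
      · exact Category.id_comp _
  · obtain ⟨⟨i, p, w⟩, hη⟩ := η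
    rename_i K M N
    have σ₁ : (ShortComplex.mk (0 : O ⟶ K) (𝟙 K) (by simp)).Splitting :=
      { r := 0
        s := 𝟙 K
        f_r := hO.eq_of_src _ _
        s_g := by simp
        id := by simp }
    have w₂ : biprod.lift (-𝟙 K) i ≫ biprod.desc i (𝟙 M) = 0 := by simp
    have σ₂ : (ShortComplex.mk _ _ w₂).Splitting :=
      { r := -biprod.fst
        s := biprod.inr
        f_r := by simp
        s_g := by simp
        id := by ext <;> simp }
    let D₀ : Conflations (inducedConf F) := ⟨_, inducedConf_of_splitting (hbi K M)⟩
    let D₁ : Conflations (inducedConf F) := ⟨_, inducedConf_of_splitting σ₁⟩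
    let β : D₀ ⟶ (⟨⟨i, p, w⟩, hη⟩ : Conflations (inducedConf F)) := ObjectProperty.homMk
      { τ₁ := 𝟙 K
        τ₂ := biprod.desc i (𝟙 M)
        τ₃ := p
        comm₁₂ := by simp [D₀]
        comm₂₃ := by ext <;> simp [D₀, w] }
    let q : D₁ ⟶ D₀ := ObjectProperty.homMk
      { τ₁ := 0
        τ₂ := biprod.lift (-𝟙 K) i
        τ₃ := i
        comm₁₂ := by simp [D₀, D₁]
        comm₂₃ := by simp [D₀, D₁] }
    refine ⟨D₁, D₀, q, β, ⟨?_, inducedConf_of_splitting σ₁, inducedConf_of_splitting σ₂, hη⟩,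
      ⟨hbi K M⟩, ⟨σ₁⟩, ⟨hbi K M⟩, ?_⟩
    · refine ObjectProperty.hom_ext _ (ShortComplex.hom_ext _ _ zero_comp ?_ w)
      exact w₂
    · rintro L ⟨σ⟩ f
      have e₁ : f.hom.τ₁ ≫ i = L.obj.f ≫ f.hom.τ₂ := f.hom.comm₁₂
      have e₂ : f.hom.τ₂ ≫ p = L.obj.g ≫ f.hom.τ₃ := f.hom.comm₂₃
      refine ⟨ObjectProperty.homMk
        { τ₁ := f.hom.τ₁
          τ₂ := biprod.lift (σ.r ≫ f.hom.τ₁) (L.obj.g ≫ σ.s ≫ f.hom.τ₂)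
          τ₃ := σ.s ≫ f.hom.τ₂
          comm₁₂ := by
            change f.hom.τ₁ ≫ biprod.inl = L.obj.f ≫ biprod.lift _ _
            ext <;> simp
          comm₂₃ := by
            change biprod.lift _ _ ≫ biprod.snd = _
            simp }, ObjectProperty.hom_ext _ (ShortComplex.hom_ext _ _ ?_ ?_ ?_)⟩
      · exact Category.comp_id _
      · refine biprod.lift_desc.trans ?_
        rw [Category.comp_id, Category.assoc, e₁, ← Category.assoc, ← Category.assoc,
          ← Preadditive.add_comp, σ.id, Category.id_comp]
      · change (σ.s ≫ f.hom.τ₂) ≫ p = f.hom.τ₃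
        rw [Category.assoc, e₂, σ.s_g_assoc]

lemma IsPseudoClusterTilting.resdimLE_one {conf : ObjectProperty (ShortComplex B)}
    {D : ObjectProperty B} (h : IsPseudoClusterTilting conf D) :
    resdimLE (pairs conf) D 1 = ⊤ := by
  ext M
  obtain ⟨D₁, D₀, i, β, hp, h₀, h₁, -⟩ := h.right M
  simpa using ⟨1, le_rfl, D₁, D₀, i, β, hp, h₀, D₁, h₁, ⟨Iso.refl _⟩⟩

lemma IsPseudoClusterTilting.coresdimLE_one {conf : ObjectProperty (ShortComplex B)}
    {D : ObjectProperty B} (h : IsPseudoClusterTilting conf D) :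
    coresdimLE (pairs conf) D 1 = ⊤ := by
  ext M
  obtain ⟨D₀, D₁, α, p, hp, h₀, h₁, -⟩ := h.left M
  simpa using ⟨1, le_rfl, D₀, D₁, α, p, hp, h₀, D₁, h₁, ⟨Iso.refl _⟩⟩

end SplitConflations

/-! ### The bicartesian squares of a morphism of conflations -/

section AbelianLemmas

variable {𝒜 : Type u} [Category.{v} 𝒜] [Abelian 𝒜] {K M N K' M' N' E Z : 𝒜}
  {i : K ⟶ M} {p : M ⟶ N} {j : K' ⟶ E} {v : E ⟶ N} {i' : K' ⟶ M'} {p' : M' ⟶ N'}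

/-- In a morphism of short exact sequences `(K, M, N) ⟶ (K', E, N)` which is the identity on `N`,
the left-hand square is bicartesian. -/
lemma shortExact_of_pushout {w : i ≫ p = 0} {w' : j ≫ v = 0}
    (h : (ShortComplex.mk i p w).ShortExact) (h' : (ShortComplex.mk j v w').ShortExact)
    {f₁ : K ⟶ K'} {m : M ⟶ E} (hm : m ≫ v = p) (hi : i ≫ m = f₁ ≫ j)
    (b : BinaryBicone M K') (hb : b.fst ≫ b.inl + b.snd ≫ b.inr = 𝟙 b.pt)
    {l : K ⟶ b.pt} {d : b.pt ⟶ E} (hl : l = i ≫ b.inl - f₁ ≫ b.inr)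
    (hd : d = b.fst ≫ m + b.snd ≫ j) (w'' : l ≫ d = 0) :
    (ShortComplex.mk l d w'').ShortExact := by
  subst hl hd
  have : Mono i := h.mono_f
  have : Mono j := h'.mono_f
  have : Epi p := h.epi_g
  refine ShortComplex.ShortExact.mk' ?_ ?_ ?_
  · rw [ShortComplex.exact_iff_exact_up_to_refinements]
    intro W z hz
    change W ⟶ b.pt at z
    replace hz : z ≫ b.fst ≫ m + z ≫ b.snd ≫ j = 0 := by
      rw [← Preadditive.comp_add]
      exact hz
    obtain ⟨k, hk⟩ : ∃ k : W ⟶ K, k ≫ i = z ≫ b.fst :=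
      exists_lift_of_isLimit h.fIsKernel (z ≫ b.fst) (by
        have := congrArg (· ≫ v) hz
        simpa [hm, w'] using this)
    have hk' : k ≫ f₁ = - z ≫ b.snd := by
      rw [← cancel_mono j, Category.assoc, ← hi, reassoc_of% hk, Preadditive.neg_comp,
        Category.assoc]
      exact eq_neg_of_add_eq_zero_left hz
    refine ⟨W, 𝟙 W, inferInstance, k, ?_⟩
    change 𝟙 W ≫ z = k ≫ (i ≫ b.inl - f₁ ≫ b.inr)
    rw [Preadditive.comp_sub, reassoc_of% hk, reassoc_of% hk', Preadditive.neg_comp,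
      sub_neg_eq_add, Category.assoc, ← Preadditive.comp_add, hb, Category.id_comp,
      Category.comp_id]
  · have : Mono ((i ≫ b.inl - f₁ ≫ b.inr) ≫ b.fst) := by simpa
    exact mono_of_mono _ b.fst
  · rw [Preadditive.epi_iff_cancel_zero]
    intro W z hz
    change E ⟶ W at z
    have h₁ : m ≫ z = 0 := by
      have := congrArg (b.inl ≫ ·) hz
      simpa using this
    have h₂ : j ≫ z = 0 := by
      have := congrArg (b.inr ≫ ·) hz
      simpa using this
    obtain ⟨l, hl⟩ : ∃ l : N ⟶ W, v ≫ l = z := exists_desc_of_isColimit h'.gIsCokernel z h₂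
    have : l = 0 := by rw [← cancel_epi p, ← hm, Category.assoc, hl, h₁, comp_zero]
    rw [← hl, this, comp_zero]

/-- In a morphism of short exact sequences `(K', E, N) ⟶ (K', M', N')` which is the identity on
`K'`, the right-hand square is bicartesian. -/
lemma shortExact_of_pullback {w : i' ≫ p' = 0} {w' : j ≫ v = 0}
    (h : (ShortComplex.mk i' p' w).ShortExact) (h' : (ShortComplex.mk j v w').ShortExact)
    {f₃ : N ⟶ N'} {t : E ⟶ M'} (ht : j ≫ t = i') (hp : v ≫ f₃ = t ≫ p')
    (b : BinaryBicone M' N) (hb : b.fst ≫ b.inl + b.snd ≫ b.inr = 𝟙 b.pt)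
    {l : E ⟶ b.pt} {d : b.pt ⟶ N'} (hl : l = t ≫ b.inl - v ≫ b.inr)
    (hd : d = b.fst ≫ p' + b.snd ≫ f₃) (w'' : l ≫ d = 0) :
    (ShortComplex.mk l d w'').ShortExact := by
  subst hl hd
  have : Mono i' := h.mono_f
  have : Epi v := h'.epi_g
  have : Epi p' := h.epi_g
  refine ShortComplex.ShortExact.mk' ?_ ?_ ?_
  · rw [ShortComplex.exact_iff_exact_up_to_refinements]
    intro W z hz
    change W ⟶ b.pt at z
    replace hz : z ≫ b.fst ≫ p' + z ≫ b.snd ≫ f₃ = 0 := by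
      rw [← Preadditive.comp_add]
      exact hz
    obtain ⟨W', π, hπ, e, he⟩ := surjective_up_to_refinements_of_epi v (-z ≫ b.snd)
    obtain ⟨k, hk⟩ : ∃ k : W' ⟶ K', k ≫ i' = π ≫ z ≫ b.fst - e ≫ t :=
      exists_lift_of_isLimit h.fIsKernel (π ≫ z ≫ b.fst - e ≫ t) (by
        rw [Preadditive.sub_comp, Category.assoc, Category.assoc, Category.assoc, ← hp,
          ← reassoc_of% he, Preadditive.neg_comp, Preadditive.comp_neg, sub_neg_eq_add,
          ← Preadditive.comp_add, Category.assoc, hz, comp_zero])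
    refine ⟨W', π, hπ, e + k ≫ j, ?_⟩
    change π ≫ z = (e + k ≫ j) ≫ (t ≫ b.inl - v ≫ b.inr)
    have h₁ : (e + k ≫ j) ≫ t = π ≫ z ≫ b.fst := by
      rw [Preadditive.add_comp, Category.assoc, ht, hk, add_sub_cancel]
    have h₂ : (e + k ≫ j) ≫ v = - π ≫ z ≫ b.snd := by
      rw [Preadditive.add_comp, Category.assoc, w', comp_zero, add_zero, ← he,
        Preadditive.comp_neg]
    rw [Preadditive.comp_sub, reassoc_of% h₁, reassoc_of% h₂, Preadditive.neg_comp,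
      sub_neg_eq_add, Category.assoc, Category.assoc, ← Preadditive.comp_add,
      ← Preadditive.comp_add, hb, Category.comp_id]
  · rw [Preadditive.mono_iff_cancel_zero]
    intro W z hz
    change W ⟶ E at z
    have h₁ : z ≫ t = 0 := by
      have := congrArg (· ≫ b.fst) hz
      simpa using this
    have h₂ : z ≫ v = 0 := by
      have := congrArg (· ≫ b.snd) hz
      simpa using this
    obtain ⟨l, hl⟩ : ∃ l : W ⟶ K', l ≫ j = z := exists_lift_of_isLimit h'.fIsKernel z h₂
    have : l = 0 := by rw [← cancel_mono i', ← ht, reassoc_of% hl, h₁, zero_comp]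
    rw [← hl, this, zero_comp]
  · have : Epi (b.inl ≫ (b.fst ≫ p' + b.snd ≫ f₃)) := by simpa
    exact epi_of_epi b.inl _

end AbelianLemmas

section Pullback

/-- A deflation and any kernel of it form a conflation. -/
lemma IsExactCategory.conf_of_isLimit {B : Type u'} [Category.{v'} B] [Preadditive B]
    {conf : ObjectProperty (ShortComplex B)}
    (hE : IsExactCategory conf) {S : ShortComplex B}
    (hS : IsLimit (KernelFork.ofι S.f S.zero)) (hg : IsDeflation conf S.g) : conf S := by
  obtain ⟨K, i, w, h⟩ := hg
  obtain ⟨hk⟩ := hE.isKernel _ h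
  let e : K ≅ S.X₁ := IsLimit.conePointUniqueUpToIso hk hS
  have he : e.hom ≫ S.f = i := IsLimit.conePointUniqueUpToIso_hom_comp hk hS .zero
  exact hE.of_iso (ShortComplex.mk i S.g w) S ⟨ShortComplex.isoMk e (Iso.refl _) (Iso.refl _)
    (by simpa using he) (by simp)⟩ h

variable {B : Type u'} [Category.{v'} B] [Preadditive B] [HasBinaryBiproducts B]

/-- For a morphism `f` from a conflation `η = (K, M, N)` to a conflation `ζ = (K', M', N')`: the
pullback `E` of `N ⟶ N'` and `M' ⟶ N'`, together with the conflations `K ⟶ M ⊞ K' ⟶ E` and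
`E ⟶ M' ⊞ N ⟶ N'`. Of the universal property of `E` only the existence of lifts is recorded. -/
structure PullbackData {conf : ObjectProperty (ShortComplex B)} {η ζ : Conflations conf}
    (f : η ⟶ ζ) where
  /-- The pullback. -/
  E : B
  /-- The projection to `N`. -/
  v : E ⟶ η.obj.X₃
  /-- The projection to `M'`. -/
  t : E ⟶ ζ.obj.X₂
  w : v ≫ f.hom.τ₃ = t ≫ ζ.obj.g
  exists_lift : ∀ {W : B} (a : W ⟶ η.obj.X₃) (b : W ⟶ ζ.obj.X₂), a ≫ f.hom.τ₃ = b ≫ ζ.obj.g →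
    ∃ l : W ⟶ E, l ≫ v = a ∧ l ≫ t = b
  /-- The kernel of the projection to `N`. -/
  j : ζ.obj.X₁ ⟶ E
  /-- The comparison morphism from `M`. -/
  m : η.obj.X₂ ⟶ E
  m_v : m ≫ v = η.obj.g
  j_v : j ≫ v = 0
  exists_lift_j : ∀ {W : B} (a : W ⟶ E), a ≫ v = 0 → ∃ l : W ⟶ ζ.obj.X₁, l ≫ j = a
  κ_zero : (η.obj.f ≫ biprod.inl - f.hom.τ₁ ≫ biprod.inr) ≫ (biprod.fst ≫ m + biprod.snd ≫ j) = 0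
  κ_conf : conf (ShortComplex.mk _ _ κ_zero)
  γ_zero : (t ≫ biprod.inl - v ≫ biprod.inr) ≫
    (biprod.fst ≫ ζ.obj.g + biprod.snd ≫ f.hom.τ₃) = 0
  γ_conf : conf (ShortComplex.mk _ _ γ_zero)

variable {𝒜 : Type u} [Category.{v} 𝒜] [Abelian 𝒜] {F : B ⥤ 𝒜} [F.PreservesZeroMorphisms]

theorem IsExtensionClosedEmbedding.nonempty_pullbackData (hF : IsExtensionClosedEmbedding F)
    {η ζ : Conflations (inducedConf F)} (f : η ⟶ ζ) : Nonempty (PullbackData f) := by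
  have hE := hF.isExactCategory
  have := hF.additive
  obtain ⟨⟨i, p, w⟩, hη⟩ := η
  rename_i K M N
  obtain ⟨⟨i', p', w'⟩, hζ⟩ := ζ
  rename_i K' M' N'
  obtain ⟨f₁, f₂, f₃, c₁, c₂, e₁, e₃⟩ : ∃ (f₁ : K ⟶ K') (f₂ : M ⟶ M') (f₃ : N ⟶ N'),
      f₁ ≫ i' = i ≫ f₂ ∧ f₂ ≫ p' = p ≫ f₃ ∧ f₁ = f.hom.τ₁ ∧ f₃ = f.hom.τ₃ :=
    ⟨f.hom.τ₁, f.hom.τ₂, f.hom.τ₃, f.hom.comm₁₂, f.hom.comm₂₃, rfl, rfl⟩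
  obtain ⟨hi'⟩ := hE.isKernel _ hζ
  have := mono_of_isLimit hi'
  obtain ⟨E, v, t, sq, hv⟩ := hE.pullback p' f₃ ⟨K', i', w', hζ⟩
  obtain ⟨j, hjv, hjt⟩ : ∃ j : K' ⟶ E, j ≫ v = 0 ∧ j ≫ t = i' :=
    ⟨sq.lift 0 i' (by simp [w']), sq.lift_fst _ _ _, sq.lift_snd _ _ _⟩
  obtain ⟨m, hmv, hmt⟩ : ∃ m : M ⟶ E, m ≫ v = p ∧ m ≫ t = f₂ :=
    ⟨sq.lift p f₂ c₂.symm, sq.lift_fst _ _ _, sq.lift_snd _ _ _⟩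
  have him : i ≫ m = f₁ ≫ j := sq.hom_ext
    (by rw [Category.assoc, Category.assoc, hmv, hjv, w, comp_zero])
    (by rw [Category.assoc, Category.assoc, hmt, hjt, c₁])
  have hlift : ∀ {W : B} (a : W ⟶ E), a ≫ v = 0 → ∃ l : W ⟶ K', l ≫ j = a := fun {W} a ha => by
    obtain ⟨l, hl⟩ := exists_lift_of_isLimit hi' (a ≫ t) (by
      rw [Category.assoc, ← sq.w, reassoc_of% ha, zero_comp])
    exact ⟨l, sq.hom_ext (by rw [Category.assoc, hjv, ha, comp_zero])
      (by rw [Category.assoc, hjt, hl])⟩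
  have : Mono j := by
    have : Mono (j ≫ t) := by rwa [hjt]
    exact mono_of_mono j t
  obtain ⟨hk⟩ := nonempty_isLimit_of_exists_lift hjv ‹_› fun W a ha => hlift a ha
  have hjv' : inducedConf F (ShortComplex.mk j v hjv) := hE.conf_of_isLimit hk hv
  have zκ : (i ≫ biprod.inl - f₁ ≫ biprod.inr) ≫ (biprod.fst ≫ m + biprod.snd ≫ j) = 0 := by
    simp [him]
  have zγ : (t ≫ biprod.inl - v ≫ biprod.inr) ≫ (biprod.fst ≫ p' + biprod.snd ≫ f₃) = 0 := by
    simp [sq.w]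
  let bi (M N : B) : BinaryBicone (F.obj M) (F.obj N) :=
    F.mapBinaryBicone (BinaryBiproduct.bicone M N)
  have hbi (M N : B) : (bi M N).fst ≫ (bi M N).inl + (bi M N).snd ≫ (bi M N).inr = 𝟙 _ := by
    have h : F.map biprod.fst ≫ F.map biprod.inl + F.map biprod.snd ≫ F.map biprod.inr =
        𝟙 (F.obj (M ⊞ N)) := by
      rw [← F.map_comp, ← F.map_comp, ← F.map_add, biprod.total, F.map_id]
    exact h
  have hκ : inducedConf F (ShortComplex.mk _ _ zκ) :=
    shortExact_of_pushout (f₁ := F.map f₁) (m := F.map m) hη hjv'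
      ((F.map_comp _ _).symm.trans (congrArg F.map hmv))
      (by simpa only [F.map_comp] using congrArg F.map him) (bi M K') (hbi M K')
      (by rw [F.map_sub, F.map_comp, F.map_comp]; rfl)
      (by rw [F.map_add, F.map_comp, F.map_comp]; rfl) _
  have hγ : inducedConf F (ShortComplex.mk _ _ zγ) :=
    shortExact_of_pullback (f₃ := F.map f₃) (t := F.map t) hζ hjv'
      ((F.map_comp _ _).symm.trans (congrArg F.map hjt))
      (by simpa only [F.map_comp] using congrArg F.map sq.w) (bi M' N) (hbi M' N)
      (by rw [F.map_sub, F.map_comp, F.map_comp]; rfl)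
      (by rw [F.map_add, F.map_comp, F.map_comp]; rfl) _
  subst e₁ e₃
  exact ⟨⟨E, v, t, sq.w, fun a b h => ⟨sq.lift a b h, sq.lift_fst _ _ _, sq.lift_snd _ _ _⟩, j, m,
    hmv, hjv, hlift, zκ, hκ, zγ, hγ⟩⟩

end Pullback

/-! ### The quotient by the split conflations -/

section Quotient

variable {B : Type u'} [Category.{v'} B] [Preadditive B] {conf : ObjectProperty (ShortComplex B)}

/-- A morphism between the last two terms of conflations extends to the first terms. -/
lemma Conflations.exists_hom (hE : IsExactCategory conf) {η ζ : Conflations conf}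
    (h₂ : η.obj.X₂ ⟶ ζ.obj.X₂) (h₃ : η.obj.X₃ ⟶ ζ.obj.X₃) (h : h₂ ≫ ζ.obj.g = η.obj.g ≫ h₃) :
    ∃ f : η ⟶ ζ, f.hom.τ₂ = h₂ ∧ f.hom.τ₃ = h₃ := by
  obtain ⟨hk⟩ := hE.isKernel _ ζ.property
  obtain ⟨l, hl⟩ := exists_lift_of_isLimit hk (η.obj.f ≫ h₂) (by
    rw [Category.assoc, h, ShortComplex.zero_assoc, zero_comp])
  exact ⟨ObjectProperty.homMk
    { τ₁ := l
      τ₂ := h₂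
      τ₃ := h₃
      comm₁₂ := hl
      comm₂₃ := h }, rfl, rfl⟩

lemma Conflations.hom_ext (hE : IsExactCategory conf) {η ζ : Conflations conf} {f g : η ⟶ ζ}
    (h₂ : f.hom.τ₂ = g.hom.τ₂) (h₃ : f.hom.τ₃ = g.hom.τ₃) : f = g := by
  obtain ⟨hk⟩ := hE.isKernel _ ζ.property
  have hm : Mono ζ.obj.f := mono_of_isLimit hk
  refine ObjectProperty.hom_ext _ (ShortComplex.hom_ext _ _ ?_ h₂ h₃)
  rw [← cancel_mono ζ.obj.f, f.hom.comm₁₂, g.hom.comm₁₂, h₂]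

variable [HasBinaryBiproducts B]

/-- A morphism of conflations `f - g : η ⟶ ζ` factors through a split conflation if and only if its
third component factors through the deflation of `ζ`. If so, the split conflation on the first two
terms of `ζ` can be used. -/
lemma factorRel_splitConflations_iff (hE : IsExactCategory conf) {η ζ : Conflations conf}
    (hsplit : ∀ {S : ShortComplex B}, S.Splitting → conf S) (f g : η ⟶ ζ) :
    factorRel (splitConflations conf) f g ↔
      ∃ t : η.obj.X₃ ⟶ ζ.obj.X₂, t ≫ ζ.obj.g = f.hom.τ₃ - g.hom.τ₃ := by
  constructor
  · rintro ⟨θ, a, b, ⟨σ⟩, e⟩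
    refine ⟨a.hom.τ₃ ≫ σ.s ≫ b.hom.τ₂, ?_⟩
    have e₃ : a.hom.τ₃ ≫ b.hom.τ₃ = f.hom.τ₃ - g.hom.τ₃ := congrArg (thirdTerm conf).map e
    rw [Category.assoc, Category.assoc, b.hom.comm₂₃, σ.s_g_assoc, e₃]
  · rintro ⟨t, ht⟩
    let S : ShortComplex B := ShortComplex.mk (biprod.inl : ζ.obj.X₁ ⟶ ζ.obj.X₁ ⊞ ζ.obj.X₂)
      biprod.snd biprod.inl_snd
    let σ : S.Splitting :=
      { r := biprod.fst
        s := biprod.inr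
        f_r := by simp [S]
        s_g := by simp [S]
        id := by simp [S] }
    let θ : Conflations conf := ⟨S, hsplit σ⟩
    obtain ⟨b, hb₂, hb⟩ := Conflations.exists_hom hE (η := θ) (ζ := ζ)
      (biprod.desc ζ.obj.f (𝟙 _)) ζ.obj.g (by
        change biprod.desc _ _ ≫ _ = biprod.snd ≫ _
        ext <;> simp)
    obtain ⟨hk⟩ := hE.isKernel _ ζ.property
    have hd : (f - g).hom.τ₃ = f.hom.τ₃ - g.hom.τ₃ := rfl
    obtain ⟨r, hr⟩ : ∃ r : η.obj.X₂ ⟶ ζ.obj.X₁, r ≫ ζ.obj.f = (f - g).hom.τ₂ - η.obj.g ≫ t :=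
      exists_lift_of_isLimit hk _ (by
        rw [Preadditive.sub_comp, Category.assoc, ht, ← hd, (f - g).hom.comm₂₃, sub_self])
    obtain ⟨a, ha₂, ha₃⟩ := Conflations.exists_hom hE (η := η) (ζ := θ)
      (biprod.lift r (η.obj.g ≫ t)) t (biprod.lift_snd _ _)
    refine ⟨θ, a, b, ⟨σ⟩, Conflations.hom_ext hE ?_ ?_⟩
    · change a.hom.τ₂ ≫ b.hom.τ₂ = _
      rw [ha₂, hb₂]
      refine biprod.lift_desc.trans ?_
      rw [hr, Category.comp_id, sub_add_cancel]
    · change a.hom.τ₃ ≫ b.hom.τ₃ = _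
      rw [ha₃, hb, ht, hd]

section ModSplit

/-- The quotient functor modulo the split conflations. -/
abbrev modSplit (conf : ObjectProperty (ShortComplex B)) :
    Conflations conf ⥤ ModIdeal (splitConflations conf) :=
  CategoryTheory.Quotient.functor _

variable {η ζ : Conflations conf} {f : η ⟶ ζ} (D : PullbackData f)

namespace PullbackData

/-- The conflation `K ⟶ M ⊞ K' ⟶ E`, which is the kernel of the class of `f`. -/
noncomputable abbrev κ : Conflations conf := ⟨_, D.κ_conf⟩

/-- The conflation `E ⟶ M' ⊞ N ⟶ N'`, which is the cokernel of the class of `f`. -/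
noncomputable abbrev γ : Conflations conf := ⟨_, D.γ_conf⟩

/-- The morphism `κ ⟶ η` given by the projections `M ⊞ K' ⟶ M` and `E ⟶ N`. -/
lemma exists_k (hE : IsExactCategory conf) : ∃ k : D.κ ⟶ η, k.hom.τ₃ = D.v := by
  obtain ⟨k, -, hk⟩ := Conflations.exists_hom hE (η := D.κ) (ζ := η) biprod.fst D.v (by
    change _ = (biprod.fst ≫ D.m + biprod.snd ≫ D.j) ≫ D.v
    rw [Preadditive.add_comp, Category.assoc, Category.assoc, D.m_v, D.j_v, comp_zero, add_zero])
  exact ⟨k, hk⟩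

/-- The morphism `ζ ⟶ γ` given by the inclusion `M' ⟶ M' ⊞ N` and the identity of `N'`. -/
lemma exists_c (hE : IsExactCategory conf) : ∃ c : ζ ⟶ D.γ, c.hom.τ₃ = 𝟙 _ := by
  obtain ⟨c, -, hc⟩ := Conflations.exists_hom hE (η := ζ) (ζ := D.γ) biprod.inl (𝟙 _) (by
    change biprod.inl ≫ (biprod.fst ≫ ζ.obj.g + biprod.snd ≫ f.hom.τ₃) = _
    simp)
  exact ⟨c, hc⟩

end PullbackData

/-- Morphisms of the quotient are represented by morphisms of conflations. -/
lemma modSplit_exists_hom {B : Type u'} [Category.{v'} B] [Preadditive B]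
    {conf : ObjectProperty (ShortComplex B)} {η ζ : Conflations conf}
    (f : (modSplit conf).obj η ⟶ (modSplit conf).obj ζ) : ∃ g, (modSplit conf).map g = f :=
  (modSplit conf).map_surjective f

variable [HasSums (splitConflations conf)]

instance : (modSplit conf).Additive where
  map_add := rfl

lemma modSplit_map_eq_iff (hE : IsExactCategory conf)
    (hsplit : ∀ {S : ShortComplex B}, S.Splitting → conf S) {η ζ : Conflations conf} (f g : η ⟶ ζ) :
    (modSplit conf).map f = (modSplit conf).map g ↔
      ∃ t : η.obj.X₃ ⟶ ζ.obj.X₂, t ≫ ζ.obj.g = f.hom.τ₃ - g.hom.τ₃ := by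
  rw [CategoryTheory.Quotient.functor_map_eq_iff, factorRel_splitConflations_iff hE hsplit]

lemma modSplit_map_eq_zero_iff (hE : IsExactCategory conf)
    (hsplit : ∀ {S : ShortComplex B}, S.Splitting → conf S) {η ζ : Conflations conf} (f : η ⟶ ζ) :
    (modSplit conf).map f = 0 ↔ ∃ t : η.obj.X₃ ⟶ ζ.obj.X₂, t ≫ ζ.obj.g = f.hom.τ₃ := by
  rw [← (modSplit conf).map_zero η ζ, modSplit_map_eq_iff hE hsplit]
  have : f.hom.τ₃ - (0 : η ⟶ ζ).hom.τ₃ = f.hom.τ₃ := sub_zero _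
  rw [this]

variable (hE : IsExactCategory conf) (hsplit : ∀ {S : ShortComplex B}, S.Splitting → conf S)

namespace PullbackData

variable {D} {k : D.κ ⟶ η} (hk : k.hom.τ₃ = D.v) {c : ζ ⟶ D.γ} (hc : c.hom.τ₃ = 𝟙 _)

include hE hsplit

include hk in
lemma k_f : (modSplit conf).map k ≫ (modSplit conf).map f = 0 := by
  rw [← Functor.map_comp, modSplit_map_eq_zero_iff hE hsplit]
  refine ⟨D.t, ?_⟩
  change _ = k.hom.τ₃ ≫ f.hom.τ₃
  rw [hk, D.w]

include hc in
lemma f_c : (modSplit conf).map f ≫ (modSplit conf).map c = 0 := by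
  rw [← Functor.map_comp, modSplit_map_eq_zero_iff hE hsplit]
  refine ⟨biprod.inr, ?_⟩
  change biprod.inr ≫ (biprod.fst ≫ ζ.obj.g + biprod.snd ≫ f.hom.τ₃) = f.hom.τ₃ ≫ c.hom.τ₃
  rw [hc]
  simp

include hk in
/-- The class of `κ ⟶ η` is the kernel of the class of `f`. -/
lemma nonempty_isLimit : Nonempty (IsLimit (KernelFork.ofι _ (k_f hE hsplit hk))) := by
  refine nonempty_isLimit_of_exists_lift _ ?_ ?_
  · rw [Preadditive.mono_iff_cancel_zero]
    rintro ⟨θ⟩ g hg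
    obtain ⟨g, rfl⟩ := modSplit_exists_hom (η := θ) (ζ := D.κ) g
    rw [← Functor.map_comp, modSplit_map_eq_zero_iff hE hsplit] at hg
    obtain ⟨s, hs⟩ := hg
    replace hs : s ≫ η.obj.g = g.hom.τ₃ ≫ k.hom.τ₃ := hs
    rw [modSplit_map_eq_zero_iff hE hsplit]
    obtain ⟨r, hr⟩ := D.exists_lift_j (g.hom.τ₃ - s ≫ D.m) (by
      rw [Preadditive.sub_comp, Category.assoc, D.m_v, hs, hk]
      exact sub_self _)
    refine ⟨biprod.lift s r, ?_⟩
    change biprod.lift s r ≫ (biprod.fst ≫ D.m + biprod.snd ≫ D.j) = _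
    simp [hr]
  · rintro ⟨θ⟩ g hg
    obtain ⟨g, rfl⟩ := modSplit_exists_hom (η := θ) (ζ := η) g
    rw [← Functor.map_comp, modSplit_map_eq_zero_iff hE hsplit] at hg
    obtain ⟨s, hs⟩ := hg
    obtain ⟨l, hl, -⟩ := D.exists_lift g.hom.τ₃ s hs.symm
    obtain ⟨r, hr⟩ := D.exists_lift_j (θ.obj.g ≫ l - g.hom.τ₂ ≫ D.m) (by
      rw [Preadditive.sub_comp, Category.assoc, Category.assoc, D.m_v, hl, g.hom.comm₂₃,
        sub_self])
    obtain ⟨h, -, hh⟩ := Conflations.exists_hom hE (η := θ) (ζ := D.κ) (biprod.lift g.hom.τ₂ r) l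
      (by
        change biprod.lift _ _ ≫ (biprod.fst ≫ D.m + biprod.snd ≫ D.j) = _
        simp [hr])
    refine ⟨(modSplit conf).map h, ?_⟩
    rw [← Functor.map_comp, modSplit_map_eq_iff hE hsplit]
    refine ⟨0, ?_⟩
    change _ = h.hom.τ₃ ≫ k.hom.τ₃ - _
    rw [hh, hk, zero_comp]
    exact (sub_eq_zero_of_eq hl).symm

include hc in
/-- The class of `ζ ⟶ γ` is the cokernel of the class of `f`. -/
lemma nonempty_isColimit : Nonempty (IsColimit (CokernelCofork.ofπ _ (f_c hE hsplit hc))) := by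
  refine nonempty_isColimit_of_exists_desc _ ?_ ?_
  · rw [Preadditive.epi_iff_cancel_zero]
    rintro ⟨θ⟩ g hg
    obtain ⟨g, rfl⟩ := modSplit_exists_hom (η := D.γ) (ζ := θ) g
    rw [← Functor.map_comp, modSplit_map_eq_zero_iff hE hsplit] at hg
    obtain ⟨s, hs⟩ := hg
    rw [modSplit_map_eq_zero_iff hE hsplit]
    refine ⟨s, hs.trans ?_⟩
    change c.hom.τ₃ ≫ g.hom.τ₃ = _
    rw [hc]
    exact Category.id_comp _
  · rintro ⟨θ⟩ g hg
    obtain ⟨g, rfl⟩ := modSplit_exists_hom (η := ζ) (ζ := θ) g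
    rw [← Functor.map_comp, modSplit_map_eq_zero_iff hE hsplit] at hg
    obtain ⟨s, hs⟩ := hg
    replace hs : s ≫ θ.obj.g = f.hom.τ₃ ≫ g.hom.τ₃ := hs
    obtain ⟨h, -, hh⟩ := Conflations.exists_hom hE (η := D.γ) (ζ := θ) (biprod.desc g.hom.τ₂ s)
      g.hom.τ₃ (by
        change biprod.desc _ _ ≫ _ = (biprod.fst ≫ ζ.obj.g + biprod.snd ≫ f.hom.τ₃) ≫ _
        ext
        · simp [g.hom.comm₂₃]
        · simp [hs])
    refine ⟨(modSplit conf).map h, ?_⟩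
    rw [← Functor.map_comp, modSplit_map_eq_iff hE hsplit]
    refine ⟨0, ?_⟩
    change _ = c.hom.τ₃ ≫ h.hom.τ₃ - _
    rw [hh, hc, zero_comp]
    exact (sub_eq_zero_of_eq (Category.id_comp _)).symm

include hk hc in
/-- If the class of `f` is a monomorphism, then it is the kernel of its cokernel. -/
lemma nonempty_isLimit_of_mono (hf : Mono ((modSplit conf).map f)) :
    Nonempty (IsLimit (KernelFork.ofι _ (f_c hE hsplit hc))) := by
  have hk0 : (modSplit conf).map k = 0 := zero_of_comp_mono _ (k_f hE hsplit hk)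
  -- `s` lifts the projection `E ⟶ N` to `M`
  obtain ⟨s, hs⟩ := (modSplit_map_eq_zero_iff hE hsplit k).1 hk0
  rw [hk] at hs
  refine nonempty_isLimit_of_exists_lift _ hf ?_
  rintro ⟨θ⟩ g hg
  obtain ⟨g, rfl⟩ := modSplit_exists_hom (η := θ) (ζ := ζ) g
  rw [← Functor.map_comp, modSplit_map_eq_zero_iff hE hsplit] at hg
  obtain ⟨t, ht⟩ := hg
  change θ.obj.X₃ ⟶ ζ.obj.X₂ ⊞ η.obj.X₃ at t
  replace ht : t ≫ (biprod.fst ≫ ζ.obj.g + biprod.snd ≫ f.hom.τ₃) = g.hom.τ₃ ≫ c.hom.τ₃ := ht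
  rw [hc] at ht
  replace ht : (t ≫ biprod.fst) ≫ ζ.obj.g + (t ≫ biprod.snd) ≫ f.hom.τ₃ = g.hom.τ₃ := by
    rw [Category.assoc, Category.assoc, ← Preadditive.comp_add]
    exact ht.trans (Category.comp_id _)
  obtain ⟨l, hl, -⟩ := D.exists_lift (θ.obj.g ≫ t ≫ biprod.snd)
    (g.hom.τ₂ - θ.obj.g ≫ t ≫ biprod.fst) (by
      rw [Preadditive.sub_comp, g.hom.comm₂₃, ← ht]
      simp)
  obtain ⟨h, -, hh⟩ := Conflations.exists_hom hE (η := θ) (ζ := η) (l ≫ s) (t ≫ biprod.snd) (by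
    rw [Category.assoc]
    exact (congrArg (l ≫ ·) hs).trans hl)
  refine ⟨(modSplit conf).map h, ?_⟩
  rw [← Functor.map_comp, modSplit_map_eq_iff hE hsplit]
  refine ⟨-(t ≫ biprod.fst), ?_⟩
  change _ = h.hom.τ₃ ≫ f.hom.τ₃ - _
  rw [hh, ← ht, Preadditive.neg_comp]
  abel

include hk hc in
/-- If the class of `f` is an epimorphism, then it is the cokernel of its kernel. -/
lemma nonempty_isColimit_of_epi (hf : Epi ((modSplit conf).map f)) :
    Nonempty (IsColimit (CokernelCofork.ofπ _ (k_f hE hsplit hk))) := by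
  have hc0 : (modSplit conf).map c = 0 := zero_of_epi_comp _ (f_c hE hsplit hc)
  -- a section of `M' ⊞ N ⟶ N'`
  obtain ⟨s, hs⟩ := (modSplit_map_eq_zero_iff hE hsplit c).1 hc0
  rw [hc] at hs
  change ζ.obj.X₃ ⟶ ζ.obj.X₂ ⊞ η.obj.X₃ at s
  obtain ⟨s₁, s₂, hs⟩ : ∃ (s₁ : ζ.obj.X₃ ⟶ ζ.obj.X₂) (s₂ : ζ.obj.X₃ ⟶ η.obj.X₃),
      s₁ ≫ ζ.obj.g + s₂ ≫ f.hom.τ₃ = 𝟙 _ := ⟨s ≫ biprod.fst, s ≫ biprod.snd, by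
    rw [Category.assoc, Category.assoc, ← Preadditive.comp_add]
    exact hs⟩
  have hs' : s₂ ≫ f.hom.τ₃ = 𝟙 _ - s₁ ≫ ζ.obj.g := eq_sub_of_add_eq' hs
  refine nonempty_isColimit_of_exists_desc _ hf ?_
  rintro ⟨θ⟩ g hg
  obtain ⟨g, rfl⟩ := modSplit_exists_hom (η := η) (ζ := θ) g
  rw [← Functor.map_comp, modSplit_map_eq_zero_iff hE hsplit] at hg
  obtain ⟨u, hu⟩ := hg
  change D.E ⟶ _ at u
  replace hu : u ≫ θ.obj.g = D.v ≫ g.hom.τ₃ := by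
    rw [← hk]
    exact hu
  obtain ⟨l, hl, -⟩ := D.exists_lift (ζ.obj.g ≫ s₂) (𝟙 _ - ζ.obj.g ≫ s₁) (by
    rw [Category.assoc, hs']
    simp)
  obtain ⟨h, -, hh⟩ := Conflations.exists_hom hE (η := ζ) (ζ := θ) (l ≫ u) (s₂ ≫ g.hom.τ₃) (by
    rw [Category.assoc, hu, reassoc_of% hl])
  refine ⟨(modSplit conf).map h, ?_⟩
  rw [← Functor.map_comp, modSplit_map_eq_iff hE hsplit]
  obtain ⟨l', hl', -⟩ := D.exists_lift (f.hom.τ₃ ≫ s₂ - 𝟙 _) (-(f.hom.τ₃ ≫ s₁)) (by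
    rw [Preadditive.sub_comp, Category.assoc, hs']
    simp)
  refine ⟨l' ≫ u, ?_⟩
  change _ = f.hom.τ₃ ≫ h.hom.τ₃ - _
  rw [hh, Category.assoc, hu, reassoc_of% hl', Preadditive.sub_comp, Category.id_comp,
    Category.assoc]

end PullbackData

end ModSplit

/-- The category of conflations of an extension-closed subcategory of an abelian category becomes
abelian when the split conflations are annihilated. -/
theorem IsExtensionClosedEmbedding.nonempty_abelian {𝒜 : Type u} [Category.{v} 𝒜] [Abelian 𝒜]
    {F : B ⥤ 𝒜} [F.PreservesZeroMorphisms] (hF : IsExtensionClosedEmbedding F) :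
    Nonempty (Abelian (ModIdeal (splitConflations (inducedConf F)))) := by
  have hE := hF.isExactCategory
  have := hF.additive
  have hsplit : ∀ {S : ShortComplex B}, S.Splitting → inducedConf F S := inducedConf_of_splitting
  have := hF.conflations.hasFiniteBiproducts
  have : HasBinaryBiproducts (Conflations (inducedConf F)) :=
    hasBinaryBiproducts_of_finite_biproducts _
  have : HasZeroObject (Conflations (inducedConf F)) := hasZeroObject_of_hasFiniteBiproducts _
  have : IsAddClosed (splitConflations (inducedConf F)) := ⟨add_splitConflations hE⟩
  have := hasSums_of_isAddClosed (splitConflations (inducedConf F))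
  let Q := modSplit (inducedConf F)
  have hQ {η ζ : ModIdeal (splitConflations (inducedConf F))} (g : η ⟶ ζ) :
      ∃ f : η.as ⟶ ζ.as, Q.map f = g := modSplit_exists_hom g
  have : HasBinaryBiproducts (ModIdeal (splitConflations (inducedConf F))) :=
    hasBinaryBiproducts_of_surjective Q fun η => ⟨η.as, rfl⟩
  have : HasZeroObject (ModIdeal (splitConflations (inducedConf F))) :=
    hasZeroObject_of_additive Q
  have := hasFiniteBiproducts_of_binary (B := ModIdeal (splitConflations (inducedConf F)))
  have data {η ζ : Conflations (inducedConf F)} (f : η ⟶ ζ) :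
      ∃ (D : PullbackData f) (k : D.κ ⟶ η) (c : ζ ⟶ D.γ), k.hom.τ₃ = D.v ∧ c.hom.τ₃ = 𝟙 _ := by
    obtain ⟨D⟩ := hF.nonempty_pullbackData f
    obtain ⟨k, hk⟩ := D.exists_k hE
    obtain ⟨c, hc⟩ := D.exists_c hE
    exact ⟨D, k, c, hk, hc⟩
  have h₁ : HasKernels (ModIdeal (splitConflations (inducedConf F))) := ⟨fun {η ζ} g => by
    obtain ⟨f, rfl⟩ := hQ g
    obtain ⟨D, k, c, hk, hc⟩ := data f
    exact ⟨⟨⟨_, (PullbackData.nonempty_isLimit hE hsplit hk).some⟩⟩⟩⟩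
  have h₂ : HasCokernels (ModIdeal (splitConflations (inducedConf F))) := ⟨fun {η ζ} g => by
    obtain ⟨f, rfl⟩ := hQ g
    obtain ⟨D, k, c, hk, hc⟩ := data f
    exact ⟨⟨⟨_, (PullbackData.nonempty_isColimit hE hsplit hc).some⟩⟩⟩⟩
  have h₃ : IsNormalMonoCategory (ModIdeal (splitConflations (inducedConf F))) :=
    ⟨fun {η ζ} g hg => by
      obtain ⟨f, rfl⟩ := hQ g
      obtain ⟨D, k, c, hk, hc⟩ := data f
      exact ⟨⟨_, _, _, (PullbackData.nonempty_isLimit_of_mono hE hsplit hk hc hg).some⟩⟩⟩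
  have h₄ : IsNormalEpiCategory (ModIdeal (splitConflations (inducedConf F))) :=
    ⟨fun {η ζ} g hg => by
      obtain ⟨f, rfl⟩ := hQ g
      obtain ⟨D, k, c, hk, hc⟩ := data f
      exact ⟨⟨_, _, _, (PullbackData.nonempty_isColimit_of_epi hE hsplit hk hc hg).some⟩⟩⟩
  have : HasFiniteProducts (ModIdeal (splitConflations (inducedConf F))) := inferInstance
  exact ⟨{}⟩

end Quotient

/-! ### The quotient category `X_{n+1}^∨/[X]` -/

namespace Extriangulation

variable {C : Type u} [Category.{v} C] [Preadditive C] [HasZeroObject C] [HasBinaryBiproducts C]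
  {T : Extriangulation C} {H : T.HigherExtensions} {n : ℕ} {X : ObjectProperty C}

lemma classR_of_iso {G G' : (T.Stable (T.cores X n))ᵒᵖ ⥤ AddCommGrpCat.{v}} (e : G ≅ G')
    (hG : T.classR X n G) : T.classR X n G' := by
  obtain ⟨a, X₀, X₁, α, β, w, hX, h₁, h₂⟩ := hG
  refine ⟨Functor.additive_of_iso e, X₀, X₁, α, β ≫ e.hom, by rw [reassoc_of% w, zero_comp], hX,
    ?_, inferInstance⟩
  have w' : α ≫ β ≫ e.hom = 0 := by rw [reassoc_of% w, zero_comp]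
  let i : ShortComplex.mk α β w ≅ ShortComplex.mk α (β ≫ e.hom) w' :=
    ShortComplex.isoMk (Iso.refl _) (Iso.refl _) e
  exact ShortComplex.exact_of_iso i h₁

variable [IsAddClosed X]

instance : (T.toQuot X n).Additive where
  map_add := rfl

instance functorF_additive (hX : IsRigid H n X) : (T.functorF hX).Additive where
  map_add {M N} f g := by
    obtain ⟨f, rfl⟩ := (T.toQuot X n).map_surjective (X := M.as) (Y := N.as) f
    obtain ⟨g, rfl⟩ := (T.toQuot X n).map_surjective (X := M.as) (Y := N.as) g
    apply NatTrans.ext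
    funext Z
    have := T.additive_right (op Z.unop.as.obj)
    exact (T.E.obj (op Z.unop.as.obj)).map_add (f := f.hom) (g := g.hom)

lemma functorF_essImage_iff (hproj : T.EnoughProj) (hPX : T.IsProj ≤ X) (hX : IsRigid H n X)
    (G : (T.Stable (T.cores X n))ᵒᵖ ⥤ AddCommGrpCat.{v}) :
    (T.functorF hX).essImage G ↔ T.classR X n G :=
  ⟨fun ⟨M, ⟨e⟩⟩ => classR_of_iso e (classR_functorF hX M),
    fun hG => functorF_exists_iso hproj hPX hX hG⟩

lemma isExtensionClosedEmbedding_functorF (hproj : T.EnoughProj) (hPX : T.IsProj ≤ X)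
    (hX : IsRigid H n X) : IsExtensionClosedEmbedding (T.functorF hX) where
  full := functorF_full hX
  faithful := functorF_faithful hX
  additive := inferInstance
  zero := by
    obtain ⟨O, hO, h⟩ := classR_zero (T := T) (n := n) (X := X)
    exact ⟨O, hO, (functorF_essImage_iff hproj hPX hX O).2 h⟩
  ext S hS h₁ h₃ := by
    rw [functorF_essImage_iff hproj hPX hX] at *
    exact classR_of_shortExact hS h₁ h₃

lemma isExtensionClosedEmbedding_ι : IsExtensionClosedEmbedding (T.classR X n).ι := by
  have key (G) : (T.classR X n).ι.essImage G ↔ T.classR X n G :=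
    ⟨fun ⟨G', ⟨e⟩⟩ => classR_of_iso e G'.property, fun h => ⟨⟨G, h⟩, ⟨Iso.refl _⟩⟩⟩
  refine
    { full := inferInstance
      faithful := inferInstance
      additive := inferInstance
      zero := ?_
      ext := fun S hS h₁ h₃ => ?_ }
  · obtain ⟨O, hO, h⟩ := classR_zero (T := T) (n := n) (X := X)
    exact ⟨O, hO, (key O).2 h⟩
  · rw [key] at *
    exact classR_of_shortExact hS h₁ h₃

lemma functorFR_isEquivalence (hproj : T.EnoughProj) (hPX : T.IsProj ≤ X) (hX : IsRigid H n X)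
    (hR : ∀ M, T.classR X n ((T.functorF hX).obj M)) : (T.functorFR hX hR).IsEquivalence := by
  have := functorF_full hX
  have := functorF_faithful hX
  have : (T.functorFR hX hR).EssSurj := ⟨fun G => by
    obtain ⟨M, ⟨e⟩⟩ := functorF_exists_iso hproj hPX hX G.property
    exact ⟨M, ⟨(T.classR X n).isoMk e⟩⟩⟩
  exact {}

lemma pairs_confF_iff (hX : IsRigid H n X) (hR : ∀ M, T.classR X n ((T.functorF hX).obj M))
    {K M N : T.QuotCores X n} (i : K ⟶ M) (p : M ⟶ N) :
    pairs (T.confF hX) i p ↔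
      pairs (T.confR X n) ((T.functorFR hX hR).map i) ((T.functorFR hX hR).map p) := by
  have := functorF_faithful hX
  constructor
  · rintro ⟨w, h⟩
    have w' : (T.functorF hX).map i ≫ (T.functorF hX).map p = 0 := by
      rw [← Functor.map_comp, w, Functor.map_zero]
    exact ⟨ObjectProperty.hom_ext _ w', h⟩
  · rintro ⟨w, h⟩
    have w' : (T.functorF hX).map i ≫ (T.functorF hX).map p = 0 := congrArg (fun t => t.hom) w
    exact ⟨(T.functorF hX).map_injective (by rw [Functor.map_comp, w', Functor.map_zero]), h⟩

/-- If `(b g p) : M ⊞ W ⊞ P ⟶ N` is the deflation of a split `𝔼`-triangle with `W` and `P` in `X`,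
then the classes of `K ⟶ M` and `b` modulo `[X]` form a split short complex. -/
lemma exists_splitting_of_realizes_zero {K M N : (T.cores X (n + 1)).FullSubcategory} {W P : C}
    (hW : X W) (hP : X P) {b : M ⟶ N} {a : K.obj ⟶ (M.obj ⊞ W) ⊞ P} {g : W ⟶ N.obj}
    {p : P ⟶ N.obj}
    (h : T.Realizes a (biprod.desc (biprod.desc b.hom g) p) (0 : Extn T.E N.obj K.obj)) :
    ∃ w : (T.toQuot X n).map (ObjectProperty.homMk (a ≫ biprod.fst ≫ biprod.fst)) ≫
      (T.toQuot X n).map b = 0, Nonempty (ShortComplex.mk _ _ w).Splitting := by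
  obtain ⟨s, r, h₁, h₂, h₃, -⟩ := Realizes.exists_splitting h
  have h₀ := Realizes.comp_eq_zero h
  -- modulo `[X]`, the endomorphism of `M ⊞ W ⊞ P` projecting to `M` is the identity
  have key {U V : (T.cores X (n + 1)).FullSubcategory} (k : U.obj ⟶ (M.obj ⊞ W) ⊞ P)
      (l : (M.obj ⊞ W) ⊞ P ⟶ V.obj) :
      (T.toQuot X n).map (ObjectProperty.homMk
        ((k ≫ biprod.fst ≫ biprod.fst) ≫ biprod.inl ≫ biprod.inl ≫ l) : U ⟶ V) =
      (T.toQuot X n).map (ObjectProperty.homMk (k ≫ l)) := by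
    rw [CategoryTheory.Quotient.functor_map_eq_iff]
    -- the difference is the part which runs through `W ⊞ P`
    refine ⟨⟨W ⊞ P, le_cores X _ _ (prop_biprod_of_isAddClosed X hW hP)⟩,
      ObjectProperty.homMk (biprod.lift (k ≫ biprod.fst ≫ biprod.snd) (k ≫ biprod.snd)),
      ObjectProperty.homMk (-biprod.desc (biprod.inr ≫ biprod.inl ≫ l) (biprod.inr ≫ l)),
      prop_biprod_of_isAddClosed X hW hP, ObjectProperty.hom_ext _ ?_⟩
    change biprod.lift _ _ ≫ (-biprod.desc _ _) =
      (k ≫ biprod.fst ≫ biprod.fst) ≫ biprod.inl ≫ biprod.inl ≫ l - k ≫ l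
    have e : l = biprod.fst ≫ (biprod.fst ≫ biprod.inl + biprod.snd ≫ biprod.inr) ≫ biprod.inl ≫ l
        + biprod.snd ≫ biprod.inr ≫ l := by
      rw [biprod.total, Category.id_comp, ← Category.assoc, ← Category.assoc,
        ← Preadditive.add_comp, biprod.total, Category.id_comp]
    have e' := congrArg (k ≫ ·) e
    simp only [Preadditive.comp_add, Preadditive.add_comp, Category.assoc] at e'
    rw [Preadditive.comp_neg, biprod.lift_desc, e']
    simp only [Category.assoc]
    abel
  have hb : biprod.inl ≫ biprod.inl ≫ biprod.desc (biprod.desc b.hom g) p = b.hom := by simp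
  have w : (T.toQuot X n).map (ObjectProperty.homMk (a ≫ biprod.fst ≫ biprod.fst) : K ⟶ M) ≫
      (T.toQuot X n).map b = 0 := by
    rw [← Functor.map_comp, ← (T.toQuot X n).map_zero]
    have := key (U := K) (V := N) a (biprod.desc (biprod.desc b.hom g) p)
    rw [hb, h₀] at this
    exact this
  refine ⟨w, ⟨{
    r := (T.toQuot X n).map (ObjectProperty.homMk (biprod.inl ≫ biprod.inl ≫ r))
    s := (T.toQuot X n).map (ObjectProperty.homMk (s ≫ biprod.fst ≫ biprod.fst))
    f_r := ?_
    s_g := ?_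
    id := ?_ }⟩⟩
  · change (T.toQuot X n).map _ ≫ (T.toQuot X n).map _ = 𝟙 ((T.toQuot X n).obj K)
    rw [← Functor.map_comp, ← CategoryTheory.Functor.map_id]
    have := key (U := K) (V := K) a r
    rw [h₁] at this
    exact this
  · change (T.toQuot X n).map _ ≫ (T.toQuot X n).map _ = 𝟙 ((T.toQuot X n).obj N)
    rw [← Functor.map_comp, ← CategoryTheory.Functor.map_id]
    have := key (U := N) (V := N) s (biprod.desc (biprod.desc b.hom g) p)
    rw [hb, h₂] at this
    exact this
  · change (T.toQuot X n).map _ ≫ (T.toQuot X n).map _ + (T.toQuot X n).map _ ≫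
      (T.toQuot X n).map _ = 𝟙 ((T.toQuot X n).obj M)
    rw [← Functor.map_comp, ← Functor.map_comp, ← Functor.map_add, ← CategoryTheory.Functor.map_id]
    congr 1
    apply ObjectProperty.hom_ext
    change (biprod.inl ≫ biprod.inl ≫ r) ≫ a ≫ biprod.fst ≫ biprod.fst +
      b.hom ≫ s ≫ biprod.fst ≫ biprod.fst = 𝟙 M.obj
    have := congrArg (fun t => biprod.inl ≫ biprod.inl ≫ t ≫ biprod.fst ≫ biprod.fst) h₃
    simpa using this

/-- A morphism with split epimorphic class modulo `[X]` becomes a split deflation with kernel in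
`X_{n+1}^∨` after adding an object of `X` and a projective object to its source. -/
lemma exists_realizes_zero_of_section (hproj : T.EnoughProj) (hPX : T.IsProj ≤ X)
    (hX : IsRigid H n X) {M N : (T.cores X (n + 1)).FullSubcategory} (b : M ⟶ N)
    (s : (T.toQuot X n).obj N ⟶ (T.toQuot X n).obj M) (hs : s ≫ (T.toQuot X n).map b = 𝟙 _) :
    ∃ (K : (T.cores X (n + 1)).FullSubcategory) (W P : C) (a : K.obj ⟶ (M.obj ⊞ W) ⊞ P)
      (g : W ⟶ N.obj) (p : P ⟶ N.obj), X W ∧ T.IsProj P ∧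
      T.Realizes a (biprod.desc (biprod.desc b.hom g) p) (0 : Extn T.E N.obj K.obj) := by
  obtain ⟨s, rfl⟩ := (T.toQuot X n).map_surjective s
  rw [← Functor.map_comp, ← CategoryTheory.Functor.map_id,
    CategoryTheory.Quotient.functor_map_eq_iff] at hs
  obtain ⟨W, u, g, hW, e⟩ := hs
  have e' : u.hom ≫ g.hom = s.hom ≫ b.hom - 𝟙 N.obj := congrArg (fun t => t.hom) e
  obtain ⟨P, p, hP, hp⟩ := hproj.exists_defl N.obj
  -- `s ≫ b - 𝟙 = u ≫ g`, so that `(s, u, 0)` is a section of `(b, -g, p)`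
  obtain ⟨K, a, h⟩ := (hp.desc (biprod.desc b.hom (-g.hom))).exists_realizes_zero
    (biprod.lift (biprod.lift s.hom u.hom) 0) (by simp [e'])
  obtain ⟨-, r, hr, -⟩ := Realizes.exists_splitting h
  have hK : T.cores X (n + 1) K := cores_of_retract X hproj hPX hX le_rfl a r hr
    (cores_biprod X _ (cores_biprod X _ M.property (le_cores X _ _ hW))
      (le_cores X _ _ (hPX _ hP)))
  exact ⟨⟨K, hK⟩, W.obj, P, a, -g.hom, p, hW, hP, h⟩

lemma isWeaklyIdempotentComplete_quotCores (hproj : T.EnoughProj) (hPX : T.IsProj ≤ X)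
    (hX : IsRigid H n X) : IsWeaklyIdempotentComplete (T.QuotCores X n) := by
  have : HasZeroObject (T.QuotCores X n) := hasZeroObject_of_additive (T.toQuot X n)
  intro M N f s hs
  obtain ⟨f, rfl⟩ := (T.toQuot X n).map_surjective (X := M.as) (Y := N.as) f
  obtain ⟨K, W, P, a, g, p, hW, hP, h⟩ := exists_realizes_zero_of_section hproj hPX hX f s hs
  obtain ⟨w, ⟨σ⟩⟩ := exists_splitting_of_realizes_zero hW (hPX _ hP) h
  exact ⟨⟨⟨_, σ.fIsKernel⟩⟩⟩

end Extriangulation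

end Extri

open Extri
theorem mainTheorem8 {C : Type u} [Category.{v} C] [Preadditive C] [HasZeroObject C]
    [HasBinaryBiproducts C] (T : Extriangulation C) (H : T.HigherExtensions)
    (hproj : T.EnoughProj) (n : ℕ) (X : ObjectProperty C) [IsAddClosed X]
    (hX : Extriangulation.IsRigid H n X) (hPX : T.IsProj ≤ X) :
    IsWeaklyIdempotentComplete (T.QuotCores X n) ∧
    IsExactCategory (T.confF hX) ∧
    IsExactCategory (T.confR X n) ∧
    IsExactCategory (degreewise (T.confF hX)) ∧
    IsPseudoClusterTilting (degreewise (T.confF hX)) (splitConflations (T.confF hX)) ∧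
    resdimLE (pairs (degreewise (T.confF hX))) (splitConflations (T.confF hX)) 1 = ⊤ ∧
    coresdimLE (pairs (degreewise (T.confF hX))) (splitConflations (T.confF hX)) 1 = ⊤ ∧
    Nonempty (Abelian (ModIdeal (splitConflations (T.confF hX)))) ∧
    ∃ hR : ∀ M, T.classR X n ((T.functorF hX).obj M),
      (T.functorFR hX hR).IsEquivalence ∧
      (∀ ⦃K M N : T.QuotCores X n⦄ (i : K ⟶ M) (p : M ⟶ N),
        pairs (T.confF hX) i p ↔
          pairs (T.confR X n) ((T.functorFR hX hR).map i)
            ((T.functorFR hX hR).map p)) ∧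
      ∀ (K M N : (T.cores X (n + 1)).FullSubcategory) (a : K ⟶ M) (b : M ⟶ N)
        (w : (T.toQuot X n).map a ≫ (T.toQuot X n).map b = 0)
        (hη : T.confF hX (ShortComplex.mk _ _ w)),
        splitConflations (T.confF hX) ⟨ShortComplex.mk _ _ w, hη⟩ ↔
          ∃ (K' : (T.cores X (n + 1)).FullSubcategory) (W P : C)
            (a' : K'.obj ⟶ (M.obj ⊞ W) ⊞ P) (g : W ⟶ N.obj) (p : P ⟶ N.obj),
            X W ∧ T.IsProj P ∧
            T.Realizes a' (biprod.desc (biprod.desc b.hom g) p) 0 ∧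
            pairs (T.confR X n)
              ((T.functorFR hX hR).map
                ((T.toQuot X n).map (ObjectProperty.homMk (a' ≫ biprod.fst ≫ biprod.fst))))
              ((T.functorFR hX hR).map ((T.toQuot X n).map b)) ∧
            ∃ e : (T.functorFR hX hR).obj ((T.toQuot X n).obj K') ≅
                (T.functorFR hX hR).obj ((T.toQuot X n).obj K),
              e.hom ≫ (T.functorFR hX hR).map ((T.toQuot X n).map a) =
                (T.functorFR hX hR).map
                  ((T.toQuot X n).map
                    (ObjectProperty.homMk (a' ≫ biprod.fst ≫ biprod.fst))) := by
  have hF := Extriangulation.isExtensionClosedEmbedding_functorF hproj hPX hX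
  have hE := hF.isExactCategory
  have hT := hF.isPseudoClusterTilting
  have := hF.hasFiniteBiproducts
  have : HasBinaryBiproducts (T.QuotCores X n) := hasBinaryBiproducts_of_finite_biproducts _
  refine ⟨Extriangulation.isWeaklyIdempotentComplete_quotCores hproj hPX hX, hE,
    Extriangulation.isExtensionClosedEmbedding_ι.isExactCategory, hF.isExactCategory_degreewise,
    hT, hT.resdimLE_one, hT.coresdimLE_one, hF.nonempty_abelian,
    Extriangulation.classR_functorF hX,
    Extriangulation.functorFR_isEquivalence hproj hPX hX _,
    fun K M N i p => Extriangulation.pairs_confF_iff hX _ i p, fun K M N a b w hη => ?_⟩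
  constructor
  · intro hs
    obtain ⟨s, hs⟩ := (splitConflations_iff hE _).1 hs
    obtain ⟨K', W, P, a', g, p, hW, hP, h⟩ :=
      Extriangulation.exists_realizes_zero_of_section hproj hPX hX b s hs
    obtain ⟨w', ⟨σ⟩⟩ := Extriangulation.exists_splitting_of_realizes_zero hW (hPX _ hP) h
    obtain ⟨hk⟩ := hE.isKernel _ hη
    -- both `K'` and `K` are kernels of the class of `b`
    let e : (T.toQuot X n).obj K' ≅ (T.toQuot X n).obj K :=
      IsLimit.conePointUniqueUpToIso σ.fIsKernel hk
    have he : e.hom ≫ (T.toQuot X n).map a =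
        (T.toQuot X n).map (ObjectProperty.homMk (a' ≫ biprod.fst ≫ biprod.fst)) :=
      IsLimit.conePointUniqueUpToIso_hom_comp σ.fIsKernel hk .zero
    have hR := Extriangulation.classR_functorF (T := T) hX
    exact ⟨K', W, P, a', g, p, hW, hP, h,
      (Extriangulation.pairs_confF_iff hX hR _ _).1 ⟨w', inducedConf_of_splitting σ⟩,
      (T.functorFR hX hR).mapIso e, by
        rw [Functor.mapIso_hom, ← Functor.map_comp, he]⟩
  · rintro ⟨K', W, P, a', g, p, hW, hP, h, -⟩
    obtain ⟨w', ⟨σ⟩⟩ := Extriangulation.exists_splitting_of_realizes_zero hW (hPX _ hP) h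
    exact (splitConflations_iff hE _).2 ⟨σ.s, σ.s_g⟩
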